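/- **Notation.** Let $\mathbf S\in\{0,1,\square\}^{n\times \ell}$, where $\square$ is a missing entry. A completion of $\mathbf S$ is a matrix $\mathbf T\in\{0,1\}^{n\times\ell}$ that agrees with $\mathbf S$ on all non-missing entries. For $u,w\in\{0,1,\square\}^{\ell}$ let $D(u,w)$ be the set of positions at which $u$ and $w$ have different non-missing entries, and $d(u,w)=|D(u,w)|$. For a complete matrix $\mathbf T$ let $\delta(\mathbf T)=\max_{i\ne i'}d(\mathbf T[i],\mathbf T[i'])$. The problem $(0,3)$-DMC (Diameter Matrix Completion) asks, given $\mathbf S$, whether $\mathbf S$ has a completion $\mathbf T$ with $\delta(\mathbf T)\le 3$; if so, $\mathbf S$ is a yes-instance. The problem ConRMC (Constraint Radius Matrix Completion) asks, given $\mathbf S\in\{0,1,\square\}^{n\times \ell}$ and $r\in\mathbb N^n$, whether there is $v\in\{0,1\}^\ell$ with $d(v,\mathbf S[i])\le r[i]$ for all $i$. A column is dirty if it contains both $0$ and $1$. For a complete matrix $\mathbf T$, a row $\rho$ and $x\in\mathbb N$ let $\mathcal T_x=\{D(\mathbf T[i],\mathbf T[\rho]) : i\neq \rho,\ d(\mathbf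 T[i],\mathbf T[\rho])=x\}$. A sunflower with core $C$ is a set family $\mathcal F$ with $C\subseteq\bigcup\mathcal F$ in which any two distinct members intersect exactly in $C$. **Theorem.** 1. $(0,3)$-DMC can be solved in $O(n\ell^4)$ time, that is, by a single program of a unit-cost random access machine with words of $O(\log(n+\ell))$ bits and random access to the entries of the $n\times\ell$ input matrix. (For $n=0$ or $\ell=0$ the time is $O(1)$.) 2. Let $\mathbf T\in\{0,1\}^{n\times\ell}$ with $\ell\ge 14$, with all columns dirty, and with $\delta(\mathbf T)=3$. Then there is a row $\rho$ with $|\mathcal T_3|\ge 5$. For every row $\rho$ with $|\mathcal T_3|\ge5$ there are columns $j_1\ne j_2$ such that $\mathcal T_3$ is a sunflower with core $\{j_1,j_2\}$, and * $T_1\subseteq\{j_1,j_2\}$ for all $T_1\in\mathcal T_1$, $T_2\cap\{j_1,j_2\}\ne\emptyset$ for all $T_2\in\mathcal T_2$, and $\{j_1,j_2\}\subseteq T_3$ for all $T_3\in\mathcal T_3$; * for $\mathcal T_2'=\{T\in\mathcal T_2: j_1\in T,\ j_2\notin T\}$ and $\mathcal T_2''=\{T\in\mathcal T_2: j_1\notin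 T,\ j_2\in T\}$, exactly one of the following holds: (a) $\mathcal T_2'=\emptyset$ or $\mathcal T_2''=\emptyset$; (b) $\mathcal T_2'=\{\{j_1,j_3\}\}$ and $\mathcal T_2''=\{\{j_2,j_3\}\}$ for some column $j_3$. 3. $\mathbf S$ is a yes-instance of $(0,3)$-DMC if and only if the matrix obtained from $\mathbf S$ by deleting all columns that are not dirty is one. 4. Let $\mathbf S\in\{0,1,\square\}^{n\times\ell}$ with $\ell\ge14$ and all columns dirty. Let $\mathcal I_1$ consist of the ConRMC instances obtained from $\mathbf S$ by deleting one column $j$, with all radii $1$. Let $\mathcal I_2$ consist of the following instances, for three distinct columns $j_1,j_2,j_3$ and bits $v_1,v_2,v_3\in\{0,1\}$ such that no row $i$ satisfies $\mathbf S[i,j_t]=1-v_t$ for all $t\in\{1,2,3\}$: delete the three columns from $\mathbf S$ and let $r[i]=0$ if $\mathbf S[i,j_t]=1-v_t$ for some $t$, and $r[i]=1$ otherwise. Then $\mathcal I_1\cup\mathcal I_2$ consists of at most $9\ell^3=O(\ell^3)$ instances, all with radii at most one, and $\mathbf S$ is a yes-instance of $(0,3)$-DMC if and only if some instance in $\mathcal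 I_1\cup\mathcal I_2$ is a yes-instance of ConRMC. -/

import Mathlib

namespace DMC

/-! ### Incomplete binary matrices, Hamming distance, completions -/

/-- A matrix in `{0, 1, □}^{n × l}`; `none` is the missing entry `□`. Rows and columns are
indexed from `0`. -/
abbrev PMat (n l : ℕ) := Fin n → Fin l → Option Bool

/-- A matrix in `{0, 1}^{n × l}`. -/
abbrev CMat (n l : ℕ) := Fin n → Fin l → Bool

/-- A complete row vector as a vector over `{0, 1, □}`. -/
def toPartial {l : ℕ} (v : Fin l → Bool) : Fin l → Option Bool := fun j => some (v j)

/-- A complete matrix as a matrix over `{0, 1, □}`. -/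
def CMat.toPMat {n l : ℕ} (T : CMat n l) : PMat n l := fun i => toPartial (T i)

/-- `D(u, w)`: the positions at which `u` and `w` carry different non-missing entries. -/
def diffSet {l : ℕ} (u w : Fin l → Option Bool) : Finset (Fin l) :=
  Finset.univ.filter fun j => u j ≠ w j ∧ u j ≠ none ∧ w j ≠ none

/-- The Hamming distance `d(u, w) = |D(u, w)|`. -/
def hdist {l : ℕ} (u w : Fin l → Option Bool) : ℕ := (diffSet u w).card

/-- `T` is a completion of `S`. -/
def IsCompletion {n l : ℕ} (S : PMat n l) (T : CMat n l) : Prop :=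
  ∀ i j, S i j = none ∨ S i j = some (T i j)

/-- `γ(T)`: the least distance between two distinct rows (`⊤` if there are no two rows). -/
noncomputable def gamma {n l : ℕ} (T : CMat n l) : ℕ∞ :=
  ⨅ (i : Fin n) (i' : Fin n) (_ : i ≠ i'), (hdist (toPartial (T i)) (toPartial (T i')) : ℕ∞)

/-- `δ(T)`: the largest distance between two distinct rows (`0` if there are no two rows). -/
noncomputable def delta {n l : ℕ} (T : CMat n l) : ℕ∞ :=
  ⨆ (i : Fin n) (i' : Fin n) (_ : i ≠ i'), (hdist (toPartial (T i)) (toPartial (T i')) : ℕ∞)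

/-- `S` is a yes-instance of `(α, β)`-Diameter Matrix Completion. -/
def IsYes (α β : ℕ) {n l : ℕ} (S : PMat n l) : Prop :=
  ∃ T : CMat n l, IsCompletion S T ∧ (α : ℕ∞) ≤ gamma T ∧ delta T ≤ (β : ℕ∞)

/-- Column `j` is dirty: it contains both `0` and `1`. -/
def IsDirty {n l : ℕ} (S : PMat n l) (j : Fin l) : Prop :=
  (∃ i, S i j = some false) ∧ ∃ i, S i j = some true

instance {n l : ℕ} (S : PMat n l) : DecidablePred (IsDirty S) := fun j =>
  inferInstanceAs (Decidable ((∃ i, S i j = some false) ∧ ∃ i, S i j = some true))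

/-- `S[:, J]`: the submatrix of the columns in `J`, in their original order. -/
def subCols {n l : ℕ} (S : PMat n l) (J : Finset (Fin l)) : PMat n J.card :=
  fun i k => S i (J.orderEmbOfFin rfl k)

/-- The submatrix of the dirty columns. -/
def dirtyPart {n l : ℕ} (S : PMat n l) :
    PMat n (Finset.univ.filter fun j => IsDirty S j).card :=
  subCols S (Finset.univ.filter fun j => IsDirty S j)

/-! ### Difference set systems and sunflowers -/

/-- The set system `𝒯_x` of `T` with reference row `r`: all sets `D(T[i], T[r])`, `i ≠ r`, of
size `x`, without duplicates. -/
def diffSystem {n l : ℕ} (T : CMat n l) (r : Fin n) (x : ℕ) : Finset (Finset (Fin l)) :=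
  ((Finset.univ.filter fun i => i ≠ r).image
    fun i => diffSet (toPartial (T i)) (toPartial (T r))).filter fun A => A.card = x

/-- `F` is a sunflower (strong Δ-system) with core `C`. -/
def IsSunflower {ι : Type*} [DecidableEq ι] (F : Finset (Finset ι)) (C : Finset ι) : Prop :=
  C ⊆ F.biUnion id ∧ ∀ A ∈ F, ∀ B ∈ F, A ≠ B → A ∩ B = C

/-- The members of `F` that contain `a` but not `b`. -/
def withWithout {ι : Type*} [DecidableEq ι] (F : Finset (Finset ι)) (a b : ι) :
    Finset (Finset ι) :=
  F.filter fun A => a ∈ A ∧ b ∉ A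

/-- The structure of the difference sets of `T` with respect to the row `r`: `𝒯_3` is a sunflower
with core `{j₁, j₂}`, and the sets of size one, two and three lie around this core as described. -/
def HasSunflowerStructure {n l : ℕ} (T : CMat n l) (r : Fin n) : Prop :=
  ∃ j₁ j₂ : Fin l, j₁ ≠ j₂ ∧
    IsSunflower (diffSystem T r 3) {j₁, j₂} ∧
    (∀ A ∈ diffSystem T r 1, A ⊆ {j₁, j₂}) ∧
    (∀ A ∈ diffSystem T r 2, A ∩ {j₁, j₂} ≠ ∅) ∧
    (∀ A ∈ diffSystem T r 3, {j₁, j₂} ⊆ A) ∧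
    Xor
      (withWithout (diffSystem T r 2) j₁ j₂ = ∅ ∨ withWithout (diffSystem T r 2) j₂ j₁ = ∅)
      (∃ j₃ : Fin l, withWithout (diffSystem T r 2) j₁ j₂ = {{j₁, j₃}} ∧
        withWithout (diffSystem T r 2) j₂ j₁ = {{j₂, j₃}})

/-! ### Constraint Radius Matrix Completion and the reduction -/

/-- An instance `(S, r)` of Constraint Radius Matrix Completion with `n` rows. -/
structure ConRMC (n : ℕ) where
  width : ℕ
  matrix : PMat n width
  radius : Fin n → ℕ

/-- The instance is a yes-instance: there is a row vector within distance `r[i]` of each row. -/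
def ConRMC.IsYes {n : ℕ} (I : ConRMC n) : Prop :=
  ∃ v : Fin I.width → Bool, ∀ i, hdist (toPartial v) (I.matrix i) ≤ I.radius i

/-- The instance `I_j = (S[:, [l] ∖ {j}], 1^n)`. -/
def inst₁ {n l : ℕ} (S : PMat n l) (j : Fin l) : ConRMC n where
  width := ({j}ᶜ : Finset (Fin l)).card
  matrix := subCols S {j}ᶜ
  radius := fun _ => 1

/-- The instance for the three columns `j 0, j 1, j 2` and the bits `b 0, b 1, b 2`: these columns
are deleted, and the radius of a row is `0` if it has a known entry in one of the three columns
that differs from the bit of this column, and `1` otherwise. -/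
def inst₂ {n l : ℕ} (S : PMat n l) (j : Fin 3 → Fin l) (b : Fin 3 → Bool) : ConRMC n where
  width := ((Finset.univ.image j)ᶜ : Finset (Fin l)).card
  matrix := subCols S (Finset.univ.image j)ᶜ
  radius := fun i => if ∃ t, S i (j t) = some (!b t) then 0 else 1

/-- All instances that the reduction produces from `S`: the `I_j`, and, for three distinct columns
and three bits, the instance above, provided that no row of `S` has in all of the three columns a
known entry differing from the bit of the column. -/
def reductionInstances {n l : ℕ} (S : PMat n l) : Set (ConRMC n) :=
  {I | ∃ j : Fin l, I = inst₁ S j} ∪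
  {I | ∃ (j : Fin 3 → Fin l) (b : Fin 3 → Bool), Function.Injective j ∧
    (∀ i, ∃ t, S i (j t) ≠ some (!b t)) ∧ I = inst₂ S j b}

/-! ### A word RAM with unit-cost instructions

Programs are while-programs over registers and finitely many arrays, all holding natural numbers.
They have random access to the entries of the input matrix. All computed numbers have to fit into
a machine word: an instruction whose result would exceed the bound `W` is stuck. -/

/-- Tests on registers. -/
inductive Test where
  | lt (x y : ℕ)
  | eq (x y : ℕ)

/-- Programs. The arguments `x y z` name registers and `a` names an array. -/
inductive Prog where
  /-- `x := c` -/
  | const (x c : ℕ)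
  /-- `x := y` -/
  | copy (x y : ℕ)
  /-- `x := y + z` -/
  | add (x y z : ℕ)
  /-- `x := y - z`, truncated at `0` -/
  | sub (x y z : ℕ)
  /-- `x := y * z` -/
  | mul (x y z : ℕ)
  /-- `x := a[y]` -/
  | load (x a y : ℕ)
  /-- `a[x] := y` -/
  | store (a x y : ℕ)
  /-- `x :=` the input entry in row `y` and column `z` -/
  | read (x y z : ℕ)
  | seq (p q : Prog)
  | ite (b : Test) (p q : Prog)
  | while (b : Test) (p : Prog)

/-- Register contents, and the cells of the arrays. -/
structure State where
  reg : ℕ → ℕ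
  arr : ℕ → ℕ → ℕ

def State.setReg (s : State) (x v : ℕ) : State := { s with reg := Function.update s.reg x v }

def State.setArr (s : State) (a k v : ℕ) : State :=
  { s with arr := Function.update s.arr a (Function.update (s.arr a) k v) }

def Test.Holds (s : State) : Test → Prop
  | .lt x y => s.reg x < s.reg y
  | .eq x y => s.reg x = s.reg y

/-- `Exec W M p s s' t`: on word bound `W` and input `M`, the program `p` started in state `s` halts
in state `s'` after exactly `t` steps. Each executed instruction and each evaluated test is one
step. -/
inductive Exec (W : ℕ) (M : ℕ → ℕ → ℕ) : Prog → State → State → ℕ → Prop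
  | const {s x c} : c ≤ W → Exec W M (.const x c) s (s.setReg x c) 1
  | copy {s x y} : Exec W M (.copy x y) s (s.setReg x (s.reg y)) 1
  | add {s x y z} : s.reg y + s.reg z ≤ W →
      Exec W M (.add x y z) s (s.setReg x (s.reg y + s.reg z)) 1
  | sub {s x y z} : Exec W M (.sub x y z) s (s.setReg x (s.reg y - s.reg z)) 1
  | mul {s x y z} : s.reg y * s.reg z ≤ W →
      Exec W M (.mul x y z) s (s.setReg x (s.reg y * s.reg z)) 1
  | load {s x a y} : Exec W M (.load x a y) s (s.setReg x (s.arr a (s.reg y))) 1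
  | store {s a x y} : Exec W M (.store a x y) s (s.setArr a (s.reg x) (s.reg y)) 1
  | read {s x y z} : Exec W M (.read x y z) s (s.setReg x (M (s.reg y) (s.reg z))) 1
  | seq {p q s s' s'' t t'} : Exec W M p s s' t → Exec W M q s' s'' t' →
      Exec W M (.seq p q) s s'' (t + t')
  | iteTrue {b p q s s' t} : b.Holds s → Exec W M p s s' t →
      Exec W M (.ite b p q) s s' (t + 1)
  | iteFalse {b p q s s' t} : ¬ b.Holds s → Exec W M q s s' t →
      Exec W M (.ite b p q) s s' (t + 1)
  | whileTrue {b p s s' s'' t t'} : b.Holds s → Exec W M p s s' t →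
      Exec W M (.while b p) s' s'' t' → Exec W M (.while b p) s s'' (t + t' + 1)
  | whileFalse {b p s} : ¬ b.Holds s → Exec W M (.while b p) s s 1

/-- The code of an entry: `0` and `1` stand for themselves and `2` for `□`. -/
def entryCode : Option Bool → ℕ
  | some false => 0
  | some true => 1
  | none => 2

/-- The matrix as read by the machine; positions outside the matrix read as `□`. -/
def inputOf {n l : ℕ} (S : PMat n l) (i j : ℕ) : ℕ :=
  if h : i < n ∧ j < l then entryCode (S ⟨i, h.1⟩ ⟨j, h.2⟩) else 2

/-- Initially register `0` holds `n`, register `1` holds `l`, and everything else is `0`. -/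
def initState (n l : ℕ) : State where
  reg := fun x => if x = 0 then n else if x = 1 then l else 0
  arr := fun _ _ => 0

/-- `p` decides the property `Q` of matrices over `{0, 1, □}`, with the answer (`1` for yes, `0` for
no) in register `0`, within `f n l` steps on matrices with `n` rows and `l` columns, with
words of `O(log (n + l))` bits. -/
def DecidesInTime (p : Prog) (Q : ∀ n l : ℕ, PMat n l → Prop) (f : ℕ → ℕ → ℕ) : Prop :=
  ∃ k : ℕ, 1 ≤ k ∧ ∀ (n l : ℕ) (S : PMat n l), ∃ (s : State) (t : ℕ),
    Exec ((n + l + 2) ^ k) (inputOf S) p (initState n l) s t ∧ t ≤ f n l ∧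
      (Q n l S → s.reg 0 = 1) ∧ (¬ Q n l S → s.reg 0 = 0)

end DMC

/-! Fix a row `r` of a complete matrix of diameter at most three and consider the sets of columns in
which the other rows differ from it. Two rows differ exactly on the symmetric difference of their
sets `A`, `B`, so |A| + |B| ≤ 3 + 2|A ∩ B|. Hence two triples share two columns, a triple meets
every nonempty difference set, and two pairs meet.

If every row saw at most four triples, the triples around a suitable row would cover at most six
columns. Each of the remaining eight or more dirty columns k would be covered by a pair {c, k} with
one common c, and another row would then see eight triples (`exists_five_le_card`). Five triples
that pairwise share two columns have a common pair, since otherwise they all lie in one four-element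
set (`exists_common_pair`). A set of size one or two that avoids this core cannot meet five petals;
this gives the sunflower structure (`hasSunflowerStructure`).

Flipping row `r` in one or in both core columns produces a center v. Either all rows are within
distance one of v outside one column, or every row farther than one from v differs from it in two of
three fixed columns. Without distance three, a row itself is a center, because pairwise meeting
pairs form a star or a triangle. Conversely, filling the missing entries from a center gives
diameter at most three (`isYes_iff_exists_good`). Guessing the special columns and their bits yields
the ConRMC instances (`exists_reduction_iff`).

Radius at most one is a 2-SAT condition, but a separate 2-SAT test for each triple of literals would
be too slow. If no single column suffices, every two of the three literals are contradicted together
in some row. So one satisfiability test for the pair p, q handles the columns on which p and q do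
not agree in forcing a literal, and each third literal r costs only one unit propagation and one
pass over the rows (`Accepts.exists_good`). For D dirty columns this takes O(D^5 + nD^3) steps
besides the smaller cost of the clash table and of the first family, and D ≤ 3n for yes-instances
with a row. With fewer than 14 dirty columns only boundedly many distinct rows exist, and the answer
is tabulated. -/

namespace DMC

open scoped symmDiff

/-! ### Difference sets and their sunflower structure -/

section Combinatorics

variable {n l : ℕ}

theorem mem_diffSet_toPartial {u w : Fin l → Bool} {j : Fin l} :
    j ∈ diffSet (toPartial u) (toPartial w) ↔ u j ≠ w j := by
  simp [diffSet, toPartial]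

theorem diffSet_toPartial_symmDiff (u v w : Fin l → Bool) :
    diffSet (toPartial u) (toPartial v) =
      diffSet (toPartial u) (toPartial w) ∆ diffSet (toPartial v) (toPartial w) := by
  ext j
  rw [Finset.mem_symmDiff, mem_diffSet_toPartial, mem_diffSet_toPartial, mem_diffSet_toPartial]
  cases u j <;> cases v j <;> cases w j <;> simp

theorem card_add_card_eq_symmDiff {ι : Type*} [DecidableEq ι] (A B : Finset ι) :
    A.card + B.card = (A ∆ B).card + 2 * (A ∩ B).card := by
  have h1 := Finset.card_sdiff_add_card_inter A B
  have h2 := Finset.card_sdiff_add_card_inter B A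
  have h3 : (A ∆ B).card = (A \ B).card + (B \ A).card := by
    rw [symmDiff_def, Finset.sup_eq_union, Finset.card_union_of_disjoint]
    exact disjoint_sdiff_sdiff
  rw [Finset.inter_comm B A] at h2
  omega

/-- The rows of `T` are pairwise at distance at most `3`. -/
def DiamLeThree (T : CMat n l) : Prop :=
  ∀ i i', (diffSet (toPartial (T i)) (toPartial (T i'))).card ≤ 3

theorem delta_le_three_iff {T : CMat n l} : delta T ≤ 3 ↔ DiamLeThree T := by
  have h3 : (3 : ℕ∞) = ((3 : ℕ) : ℕ∞) := rfl
  simp only [delta, iSup_le_iff, h3, Nat.cast_le, DiamLeThree, hdist]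
  refine ⟨fun h i i' => ?_, fun h i i' _ => h i i'⟩
  by_cases hi : i = i'
  · subst hi
    simp [diffSet]
  · exact h i i' hi

theorem isYes_zero_three_iff {S : PMat n l} :
    IsYes 0 3 S ↔ ∃ T : CMat n l, IsCompletion S T ∧ DiamLeThree T := by
  simp only [IsYes, ← delta_le_three_iff]
  simp

theorem mem_diffSystem {T : CMat n l} {r : Fin n} {x : ℕ} (hx : x ≠ 0) {A : Finset (Fin l)} :
    A ∈ diffSystem T r x ↔ A.card = x ∧ ∃ i, diffSet (toPartial (T i)) (toPartial (T r)) = A := by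
  simp only [diffSystem, Finset.mem_filter, Finset.mem_image, Finset.mem_univ, true_and]
  constructor
  · rintro ⟨⟨i, -, h⟩, hA⟩
    exact ⟨hA, i, h⟩
  · rintro ⟨hA, i, h⟩
    refine ⟨⟨i, ?_, h⟩, hA⟩
    rintro rfl
    apply hx
    rw [← hA, ← h]
    simp [diffSet]

/-- Rows `i` and `i'` differ on the symmetric difference of their difference sets, which has |A| +
|B| - 2|A ∩ B| elements. All intersection properties used below are instances of this inequality. -/
theorem DiamLeThree.card_add_card_le {T : CMat n l} (hT : DiamLeThree T) (r i i' : Fin n) :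
    (diffSet (toPartial (T i)) (toPartial (T r))).card +
        (diffSet (toPartial (T i')) (toPartial (T r))).card ≤
      3 + 2 * (diffSet (toPartial (T i)) (toPartial (T r)) ∩
        diffSet (toPartial (T i')) (toPartial (T r))).card := by
  rw [card_add_card_eq_symmDiff, ← diffSet_toPartial_symmDiff]
  have := hT i i'
  omega

theorem DiamLeThree.inter {T : CMat n l} (hT : DiamLeThree T) {r : Fin n} {x y : ℕ} (hx : x ≠ 0)
    (hy : y ≠ 0) {A B : Finset (Fin l)} (hA : A ∈ diffSystem T r x) (hB : B ∈ diffSystem T r y) :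
    x + y ≤ 3 + 2 * (A ∩ B).card := by
  obtain ⟨rfl, i, rfl⟩ := (mem_diffSystem hx).1 hA
  obtain ⟨rfl, i', rfl⟩ := (mem_diffSystem hy).1 hB
  exact hT.card_add_card_le r i i'

/-- Every column differs from row `r` in some row, if all columns are dirty. -/
theorem exists_mem_diffSet {T : CMat n l} (hd : ∀ j, IsDirty T.toPMat j) (r : Fin n) (j : Fin l) :
    ∃ i, j ∈ diffSet (toPartial (T i)) (toPartial (T r)) := by
  obtain ⟨⟨a, ha⟩, b, hb⟩ := hd j
  simp only [CMat.toPMat, toPartial, Option.some.injEq] at ha hb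
  simp only [mem_diffSet_toPartial]
  cases h : T r j
  · exact ⟨b, by simp [hb]⟩
  · exact ⟨a, by simp [ha]⟩

/-- If every row sees at most four triples, those around `r` cover at most six columns. A further
column k is covered only by a pair {c, k} with c in the triple `A` of row `i₀`, and c is always the
same because these pairs meet. Seen from `i₀`, each such row has the triple (A ∖ {c}) ∪ {k}, which
makes eight triples. -/
theorem exists_five_le_card {T : CMat n l} (hl : 14 ≤ l) (hd : ∀ j, IsDirty T.toPMat j)
    (hT : DiamLeThree T) {r i₀ : Fin n}
    (h₀ : (diffSet (toPartial (T i₀)) (toPartial (T r))).card = 3) :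
    ∃ r : Fin n, 5 ≤ (diffSystem T r 3).card := by
  by_contra! hcon
  set D : Fin n → Finset (Fin l) := fun i => diffSet (toPartial (T i)) (toPartial (T r)) with hD
  set A := D i₀ with hA
  have hA3 : A.card = 3 := h₀
  have hAm : A ∈ diffSystem T r 3 := (mem_diffSystem (by norm_num)).2 ⟨hA3, i₀, rfl⟩
  set U := (diffSystem T r 3).biUnion id with hU
  have hAU : A ⊆ U := Finset.subset_biUnion_of_mem id hAm
  have hUcard : U.card ≤ 6 := by
    -- Each of the at most three other triples shares two columns with `A` and so adds at most one
    -- column to it.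
    have hsub : U ⊆ A ∪ ((diffSystem T r 3).erase A).biUnion fun B => B \ A := by
      intro x hx
      simp only [hU, Finset.mem_biUnion, id] at hx
      obtain ⟨B, hB, hxB⟩ := hx
      by_cases hxA : x ∈ A
      · exact Finset.mem_union_left _ hxA
      · refine Finset.mem_union_right _ (Finset.mem_biUnion.2 ⟨B, Finset.mem_erase.2 ⟨?_, hB⟩,
          Finset.mem_sdiff.2 ⟨hxB, hxA⟩⟩)
        rintro rfl
        exact hxA hxB
    have h1 : (((diffSystem T r 3).erase A).biUnion fun B => B \ A).card ≤
        ((diffSystem T r 3).erase A).card * 1 := by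
      refine Finset.card_biUnion_le_card_mul _ _ _ fun B hB => ?_
      have hB' := Finset.mem_of_mem_erase hB
      have h2 := hT.inter (by norm_num) (by norm_num) hB' hAm
      have h3 := Finset.card_sdiff_add_card_inter B A
      have h4 := ((mem_diffSystem (by norm_num)).1 hB').1
      omega
    rw [Finset.card_erase_of_mem hAm] at h1
    have h2 := hcon r
    have h3 := (Finset.card_le_card hsub).trans (Finset.card_union_le _ _)
    omega
  have key : ∀ k, k ∉ U → ∃ c ∈ A, ∃ i, D i = {c, k} := by
    intro k hk
    obtain ⟨i, hi⟩ := exists_mem_diffSet hd r k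
    have hik : k ∈ D i := hi
    have hkA : k ∉ A := fun h => hk (hAU h)
    have h3 : (D i).card ≤ 3 := hT i r
    have hne3 : (D i).card ≠ 3 := fun h =>
      hk (Finset.subset_biUnion_of_mem id ((mem_diffSystem (by norm_num)).2 ⟨h, i, rfl⟩) hik)
    have hint : (D i).card + A.card ≤ 3 + 2 * (D i ∩ A).card := hT.card_add_card_le r i i₀
    have hpos : 0 < (D i).card := Finset.card_pos.2 ⟨k, hik⟩
    obtain ⟨c, hc⟩ : (D i ∩ A).Nonempty := Finset.card_pos.1 (by omega)
    rw [Finset.mem_inter] at hc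
    refine ⟨c, hc.2, i, ?_⟩
    symm
    apply Finset.eq_of_subset_of_card_le
    · intro x hx
      rcases Finset.mem_insert.1 hx with rfl | hx
      · exact hc.1
      · rwa [Finset.mem_singleton.1 hx]
    · rw [Finset.card_pair (by rintro rfl; exact hkA hc.2)]
      omega
  -- At most six of the at least 14 columns lie in `U`.
  have hcomp : 8 ≤ Uᶜ.card := by
    rw [Finset.card_compl, Fintype.card_fin]
    omega
  obtain ⟨k₀, hk₀⟩ : (Uᶜ).Nonempty := Finset.card_pos.1 (by omega)
  obtain ⟨c, hcA, i₁, hi₁⟩ := key k₀ (Finset.mem_compl.1 hk₀)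
  have key2 : ∀ k, k ∉ U → ∃ i, D i = {c, k} := by
    intro k hk
    obtain ⟨c', hc', i, hi⟩ := key k hk
    by_cases hkk : k = k₀
    · subst hkk
      exact ⟨i₁, hi₁⟩
    have hkA : k ∉ A := fun h => hk (hAU h)
    have hkA₀ : k₀ ∉ A := fun h => Finset.mem_compl.1 hk₀ (hAU h)
    have hint : (D i).card + (D i₁).card ≤ 3 + 2 * (D i ∩ D i₁).card :=
      hT.card_add_card_le r i i₁
    rw [hi, hi₁, Finset.card_pair (by rintro rfl; exact hkA hc'),
      Finset.card_pair (by rintro rfl; exact hkA₀ hcA)] at hint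
    obtain ⟨x, hx⟩ : (({c', k} : Finset (Fin l)) ∩ {c, k₀}).Nonempty :=
      Finset.card_pos.1 (by omega)
    simp only [Finset.mem_inter, Finset.mem_insert, Finset.mem_singleton] at hx
    have : c' = c := by
      rcases hx with ⟨rfl | rfl, rfl | rfl⟩
      · rfl
      · exact absurd hc' hkA₀
      · exact absurd hcA hkA
      · exact absurd rfl hkk
    exact ⟨i, by rw [hi, this]⟩
  -- Passing from the reference row `r` to `i₀` takes the symmetric difference with `A`, which turns
  -- {c, k} into `A` with c exchanged for k.
  have himg : Uᶜ.image (fun k => A.erase c ∪ {k}) ⊆ diffSystem T i₀ 3 := by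
    intro B hB
    obtain ⟨k, hk, rfl⟩ := Finset.mem_image.1 hB
    have hkU := Finset.mem_compl.1 hk
    have hkA : k ∉ A := fun h => hkU (hAU h)
    obtain ⟨i, hi⟩ := key2 k hkU
    refine (mem_diffSystem (by norm_num)).2 ⟨?_, i, ?_⟩
    · rw [Finset.card_union_of_disjoint, Finset.card_erase_of_mem hcA, hA3,
        Finset.card_singleton]
      simp [hkA]
    · rw [diffSet_toPartial_symmDiff _ _ (T r)]
      change D i ∆ A = _
      rw [hi]
      ext x
      simp only [Finset.mem_symmDiff, Finset.mem_insert, Finset.mem_singleton, Finset.mem_union,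
        Finset.mem_erase]
      by_cases hxc : x = c
      · subst hxc
        have : x ≠ k := by rintro rfl; exact hkA hcA
        simp [this, hcA]
      · by_cases hxk : x = k
        · subst hxk
          simp [hkA]
        · simp [hxc, hxk]
  have hinj : Set.InjOn (fun k => A.erase c ∪ {k}) (Uᶜ : Finset (Fin l)) := by
    intro k hk k' hk' h
    have hkA : k ∉ A := fun h => Finset.mem_compl.1 hk (hAU h)
    have h' : A.erase c ∪ {k} = A.erase c ∪ {k'} := h
    have : k ∈ A.erase c ∪ {k'} := by
      rw [← h']
      simp
    simpa [hkA] using this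
  have := Finset.card_le_card himg
  rw [Finset.card_image_of_injOn hinj] at this
  have := hcon i₀
  omega

/-- Two distinct members meet in a pair. If some member `C` does not contain this pair, then all
members lie in the four-element union of the two, which has only four subsets of size three. -/
theorem exists_common_pair {ι : Type*} [DecidableEq ι] {F : Finset (Finset ι)}
    (h3 : ∀ A ∈ F, A.card = 3) (h2 : ∀ A ∈ F, ∀ B ∈ F, 2 ≤ (A ∩ B).card) (h5 : 5 ≤ F.card) :
    ∃ a b : ι, a ≠ b ∧ ∀ A ∈ F, {a, b} ⊆ A := by
  obtain ⟨A, hA, B, hB, hAB⟩ := Finset.one_lt_card.1 (by omega : 1 < F.card)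
  have hlt : (A ∩ B).card < 3 := by
    by_contra! h
    have e1 := Finset.eq_of_subset_of_card_le (Finset.inter_subset_left (s₁ := A) (s₂ := B))
      (by rw [h3 A hA]; exact h)
    have e2 := Finset.eq_of_subset_of_card_le (Finset.inter_subset_right (s₁ := A) (s₂ := B))
      (by rw [h3 B hB]; exact h)
    exact hAB (e1.symm.trans e2)
  have hI : (A ∩ B).card = 2 := by
    have := h2 A hA B hB
    omega
  obtain ⟨a, b, hab, hIab⟩ := Finset.card_eq_two.1 hI
  refine ⟨a, b, hab, ?_⟩
  by_contra! hcon
  obtain ⟨C, hC, hCab⟩ := hcon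
  have hU : (A ∪ B).card = 4 := by
    have := Finset.card_union_add_card_inter A B
    rw [h3 A hA, h3 B hB] at this
    omega
  -- `Z` has two elements in `X` and two in `Y`, and at most one element counts for both. So `Z` has
  -- three elements in `X ∪ Y`, which is all of `Z`.
  have hsub : ∀ X ∈ F, ∀ Y ∈ F, ∀ Z ∈ F, (X ∩ Y).card ≤ 2 → ¬ X ∩ Y ⊆ Z → Z ⊆ X ∪ Y := by
    intro X hX Y hY Z hZ hXY hn
    have e1 := Finset.card_union_add_card_inter (Z ∩ X) (Z ∩ Y)
    have e2 : ((Z ∩ X) ∩ (Z ∩ Y)).card < (X ∩ Y).card := by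
      apply Finset.card_lt_card
      refine ⟨Finset.inter_subset_inter Finset.inter_subset_right Finset.inter_subset_right, ?_⟩
      exact fun h => hn (h.trans (Finset.inter_subset_left.trans Finset.inter_subset_left))
    have e3 := h2 Z hZ X hX
    have e4 := h2 Z hZ Y hY
    rw [← Finset.inter_union_distrib_left] at e1
    have e5 := Finset.eq_of_subset_of_card_le (Finset.inter_subset_left (s₁ := Z) (s₂ := X ∪ Y))
      (by rw [h3 Z hZ]; omega)
    rw [← e5]
    exact Finset.inter_subset_right
  have hCU : C ⊆ A ∪ B := hsub A hA B hB C hC hI.le (by rwa [hIab])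
  have hall : ∀ Z ∈ F, Z ⊆ A ∪ B := by
    intro Z hZ
    by_cases hZab : A ∩ B ⊆ Z
    swap
    · exact hsub A hA B hB Z hZ hI.le hZab
    have habA : A ∩ B ⊆ A := Finset.inter_subset_left
    have hACn : ¬ A ∩ C ⊆ A ∩ B := by
      intro h
      have := Finset.eq_of_subset_of_card_le h (by rw [hI]; exact h2 A hA C hC)
      apply hCab
      rw [← hIab, ← this]
      exact Finset.inter_subset_right
    have hAC : (A ∩ C).card ≤ 2 := by
      by_contra! h
      have := Finset.eq_of_subset_of_card_le (Finset.inter_subset_left (s₁ := A) (s₂ := C))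
        (by rw [h3 A hA]; omega)
      apply hCab
      rw [← hIab]
      exact habA.trans (this ▸ Finset.inter_subset_right)
    -- `A ∩ C` has an element outside `A ∩ B`. If `Z` contains both intersections, it therefore
    -- equals `A`. Otherwise `hsub` for the members `A` and `C` applies, and `C` lies in `A ∪ B`.
    by_cases hZ2 : A ∩ C ⊆ Z
    · obtain ⟨x, hx, hxn⟩ := Finset.not_subset.1 hACn
      have hins : insert x (A ∩ B) ⊆ A ∩ Z := by
        intro y hy
        rcases Finset.mem_insert.1 hy with rfl | hy
        · exact Finset.mem_inter.2 ⟨(Finset.mem_inter.1 hx).1, hZ2 hx⟩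
        · exact Finset.mem_inter.2 ⟨habA hy, hZab hy⟩
      have hc := Finset.card_le_card hins
      rw [Finset.card_insert_of_notMem hxn, hI] at hc
      have := Finset.eq_of_subset_of_card_le (Finset.inter_subset_right (s₁ := A) (s₂ := Z))
        (by rw [h3 Z hZ]; omega)
      rw [← this]
      exact Finset.inter_subset_left.trans Finset.subset_union_left
    · exact (hsub A hA C hC Z hZ hAC hZ2).trans
        (Finset.union_subset Finset.subset_union_left hCU)
  have hF : F ⊆ (A ∪ B).powersetCard 3 := fun Z hZ =>
    Finset.mem_powersetCard.2 ⟨hall Z hZ, h3 Z hZ⟩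
  have := Finset.card_le_card hF
  rw [Finset.card_powersetCard, hU] at this
  have h43 : Nat.choose 4 3 = 4 := rfl
  omega

/-- The common pair {a, b} of the triples is the core, because distinct triples share at most two
columns. Difference sets of size one or two meet every triple, and off the core this would need a
separate column for each of five triples. Pairs {a, x} and {b, y} off the other core column can meet
only if x = y, which is the final dichotomy. -/
theorem hasSunflowerStructure {T : CMat n l} (hT : DiamLeThree T) {r : Fin n}
    (h5 : 5 ≤ (diffSystem T r 3).card) : HasSunflowerStructure T r := by
  have h33 : ∀ A ∈ diffSystem T r 3, A.card = 3 := fun A hA =>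
    ((mem_diffSystem (by norm_num)).1 hA).1
  obtain ⟨a, b, hab, hcore⟩ := exists_common_pair h33
    (fun A hA B hB => by
      have := hT.inter (by norm_num) (by norm_num) hA hB
      omega) h5
  have hsf : ∀ A ∈ diffSystem T r 3, ∀ B ∈ diffSystem T r 3, A ≠ B → A ∩ B = {a, b} := by
    intro A hA B hB hAB
    symm
    apply Finset.eq_of_subset_of_card_le (Finset.subset_inter (hcore A hA) (hcore B hB))
    rw [Finset.card_pair hab]
    by_contra! h
    have e1 := Finset.eq_of_subset_of_card_le (Finset.inter_subset_left (s₁ := A) (s₂ := B))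
      (by rw [h33 A hA]; exact h)
    have e2 := Finset.eq_of_subset_of_card_le (Finset.inter_subset_right (s₁ := A) (s₂ := B))
      (by rw [h33 B hB]; exact h)
    exact hAB (e1.symm.trans e2)
  -- a small set disjoint from the core cannot meet all petals
  have hmeet : ∀ X : Finset (Fin l), X.card ≤ 2 → (∀ A ∈ diffSystem T r 3, (X ∩ A).Nonempty) →
      (X ∩ {a, b}).Nonempty := by
    intro X hX hXA
    by_contra hne
    rw [Finset.not_nonempty_iff_eq_empty] at hne
    -- Choose a point of `X` in every triple. A point chosen twice would lie in two triples, hence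
    -- in the core, which `X` avoids.
    have hle : (diffSystem T r 3).card ≤ X.card := by
      have : Nonempty (Fin l) := ⟨a⟩
      choose! f hf using hXA
      apply Finset.card_le_card_of_injOn f
      · intro A hA
        exact (Finset.mem_inter.1 (hf A hA)).1
      · intro A hA B hB hfAB
        by_contra hAB
        have h1 := Finset.mem_inter.1 (hf A hA)
        have h2 := Finset.mem_inter.1 (hf B hB)
        have : f A ∈ X ∩ {a, b} := by
          rw [← hsf A hA B hB hAB]
          exact Finset.mem_inter.2 ⟨h1.1, Finset.mem_inter.2 ⟨h1.2, hfAB ▸ h2.2⟩⟩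
        rw [hne] at this
        simp at this
    omega
  have h12 : ∀ X : Finset (Fin l), ∀ x, x ≠ 0 → x ≤ 2 → X ∈ diffSystem T r x →
      (X ∩ {a, b}).Nonempty := by
    intro X x hx0 hx2 hX
    apply hmeet X
    · rw [((mem_diffSystem hx0).1 hX).1]
      exact hx2
    · intro A hA
      have := hT.inter hx0 (by norm_num) hX hA
      exact Finset.card_pos.1 (by omega)
  refine ⟨a, b, hab, ⟨?_, hsf⟩, ?_, ?_, hcore, ?_⟩
  · obtain ⟨A, hA⟩ : (diffSystem T r 3).Nonempty := Finset.card_pos.1 (by omega)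
    exact (hcore A hA).trans (Finset.subset_biUnion_of_mem id hA)
  · intro A hA
    obtain ⟨x, hx⟩ := h12 A 1 (by norm_num) (by norm_num) hA
    rw [Finset.mem_inter] at hx
    obtain ⟨y, rfl⟩ := Finset.card_eq_one.1 ((mem_diffSystem (by norm_num)).1 hA).1
    rw [Finset.mem_singleton] at hx
    rw [Finset.singleton_subset_iff, ← hx.1]
    exact hx.2
  · intro A hA
    exact (h12 A 2 (by norm_num) (by norm_num) hA).ne_empty
  · have hform : ∀ c d : Fin l, ∀ A ∈ withWithout (diffSystem T r 2) c d,
        ∃ x, x ≠ c ∧ x ≠ d ∧ A = {c, x} := by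
      intro c d A hA
      simp only [withWithout, Finset.mem_filter] at hA
      obtain ⟨hA, hc, hd⟩ := hA
      obtain ⟨y, z, hyz, rfl⟩ := Finset.card_eq_two.1 ((mem_diffSystem (by norm_num)).1 hA).1
      simp only [Finset.mem_insert, Finset.mem_singleton, not_or] at hc hd
      rcases hc with rfl | rfl
      · exact ⟨z, hyz.symm, Ne.symm hd.2, rfl⟩
      · exact ⟨y, hyz, Ne.symm hd.1, Finset.pair_comm _ _⟩
    have hcross : ∀ x y, {a, x} ∈ withWithout (diffSystem T r 2) a b →
        {b, y} ∈ withWithout (diffSystem T r 2) b a → x = y := by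
      intro x y hx hy
      simp only [withWithout, Finset.mem_filter, Finset.mem_insert, Finset.mem_singleton,
        not_or] at hx hy
      have := hT.inter (by norm_num) (by norm_num) hx.1 hy.1
      obtain ⟨z, hz⟩ : (({a, x} : Finset (Fin l)) ∩ {b, y}).Nonempty :=
        Finset.card_pos.1 (by omega)
      simp only [Finset.mem_inter, Finset.mem_insert, Finset.mem_singleton] at hz
      grind
    by_cases h : withWithout (diffSystem T r 2) a b = ∅ ∨ withWithout (diffSystem T r 2) b a = ∅
    · refine Or.inl ⟨h, ?_⟩
      rintro ⟨j, h1, h2⟩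
      rcases h with h | h
      · exact (Finset.singleton_ne_empty _) (h1.symm.trans h)
      · exact (Finset.singleton_ne_empty _) (h2.symm.trans h)
    · refine Or.inr ⟨?_, h⟩
      simp only [not_or, ← Finset.not_nonempty_iff_eq_empty, not_not] at h
      obtain ⟨⟨A, hA⟩, B, hB⟩ := h
      obtain ⟨x, -, -, rfl⟩ := hform _ _ A hA
      obtain ⟨y, -, -, rfl⟩ := hform _ _ B hB
      obtain rfl := hcross x y hA hB
      refine ⟨x, Finset.eq_singleton_iff_unique_mem.2 ⟨hA, fun C hC => ?_⟩,
        Finset.eq_singleton_iff_unique_mem.2 ⟨hB, fun C hC => ?_⟩⟩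
      · obtain ⟨z, -, -, rfl⟩ := hform _ _ C hC
        rw [hcross z x hC hB]
      · obtain ⟨z, -, -, rfl⟩ := hform _ _ C hC
        rw [hcross x z hA hC]

end Combinatorics

end DMC

namespace DMC

open scoped symmDiff

/-! ### Centers and completions of diameter three -/

section Centers

variable {n l : ℕ}

/-- The known entries of row `i` that disagree with `v`. -/
def mism (S : PMat n l) (v : Fin l → Bool) (i : Fin n) : Finset (Fin l) :=
  Finset.univ.filter fun j => S i j = some (!v j)

theorem mem_mism {S : PMat n l} {v : Fin l → Bool} {i : Fin n} {j : Fin l} :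
    j ∈ mism S v i ↔ S i j = some (!v j) := by
  simp [mism]

/-- Outside one column, `v` has distance at most one to each row. -/
def GoodOutsideOne (S : PMat n l) (v : Fin l → Bool) : Prop :=
  ∃ j, ∀ i, ((mism S v i).erase j).card ≤ 1

/-- Rows at distance more than one from `v` differ from it in two of three fixed columns. -/
def GoodOnThree (S : PMat n l) (v : Fin l → Bool) : Prop :=
  ∃ J : Fin 3 → Fin l, Function.Injective J ∧
    ∀ i, (mism S v i).card ≤ 1 ∨ (mism S v i ⊆ Finset.univ.image J ∧ (mism S v i).card ≤ 2)

def flipOn (F : Finset (Fin l)) (u : Fin l → Bool) : Fin l → Bool :=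
  fun j => if j ∈ F then !u j else u j

theorem mism_flipOn (T : CMat n l) (F : Finset (Fin l)) (r i : Fin n) :
    mism T.toPMat (flipOn F (T r)) i = diffSet (toPartial (T i)) (toPartial (T r)) ∆ F := by
  ext j
  rw [mem_mism, Finset.mem_symmDiff, mem_diffSet_toPartial]
  simp only [CMat.toPMat, toPartial, flipOn, Option.some.injEq]
  by_cases hj : j ∈ F <;> cases T i j <;> cases T r j <;> simp [hj]

/-- Flip `a` and ignore `b`. From the empty set or a subset of the core at most `a` remains. Every
pair contains `a`, because it meets the core and none contains `b` alone, so it loses `a`. A triple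
loses both core columns. -/
theorem goodOutsideOne_flipOn {T : CMat n l} (hT : DiamLeThree T) {r : Fin n} {a b : Fin l}
    (hab : a ≠ b) (h1 : ∀ A ∈ diffSystem T r 1, A ⊆ {a, b})
    (h2 : ∀ A ∈ diffSystem T r 2, A ∩ {a, b} ≠ ∅) (h3 : ∀ A ∈ diffSystem T r 3, {a, b} ⊆ A)
    (h : withWithout (diffSystem T r 2) b a = ∅) :
    GoodOutsideOne T.toPMat (flipOn {a} (T r)) := by
  refine ⟨b, fun i => ?_⟩
  rw [mism_flipOn]
  have hm : ∀ x, x ≠ 0 → (diffSet (toPartial (T i)) (toPartial (T r))).card = x →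
      diffSet (toPartial (T i)) (toPartial (T r)) ∈ diffSystem T r x :=
    fun x hx h => (mem_diffSystem hx).2 ⟨h, i, rfl⟩
  have hc := hT i r
  generalize diffSet (toPartial (T i)) (toPartial (T r)) = D at hm hc ⊢
  have hmemD : a ∈ D → D ∆ {a} = D.erase a := by
    intro ha
    ext x
    rw [Finset.mem_symmDiff, Finset.mem_singleton, Finset.mem_erase]
    grind
  have hcases : D.card = 0 ∨ D.card = 1 ∨ D.card = 2 ∨ D.card = 3 := by omega
  rcases hcases with hD | hD | hD | hD
  · rw [Finset.card_eq_zero.1 hD]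
    refine (Finset.card_erase_le).trans ?_
    rw [← Finset.bot_eq_empty, bot_symmDiff, Finset.card_singleton]
  · have := h1 D (hm 1 (by norm_num) hD)
    have hsub : (D ∆ {a}).erase b ⊆ {a} := by
      intro x hx
      simp only [Finset.mem_symmDiff, Finset.mem_singleton, Finset.mem_erase] at hx ⊢
      have h' := @this x
      simp only [Finset.mem_insert, Finset.mem_singleton] at h'
      tauto
    exact (Finset.card_le_card hsub).trans (by simp)
  · have haD : a ∈ D := by
      by_contra ha
      have hne := Finset.nonempty_iff_ne_empty.2 (h2 D (hm 2 (by norm_num) hD))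
      obtain ⟨x, hx⟩ := hne
      simp only [Finset.mem_inter, Finset.mem_insert, Finset.mem_singleton] at hx
      rcases hx with ⟨hx, rfl | rfl⟩
      · exact ha hx
      · have : D ∈ withWithout (diffSystem T r 2) x a :=
          Finset.mem_filter.2 ⟨hm 2 (by norm_num) hD, hx, ha⟩
        rw [h] at this
        simp at this
    rw [hmemD haD]
    refine Finset.card_erase_le.trans ?_
    rw [Finset.card_erase_of_mem haD, hD]
  · have := h3 D (hm 3 (by norm_num) hD)
    have haD : a ∈ D := this (by simp)
    have hbD : b ∈ D := this (by simp)
    rw [hmemD haD, Finset.card_erase_of_mem (Finset.mem_erase.2 ⟨hab.symm, hbD⟩),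
      Finset.card_erase_of_mem haD, hD]

theorem image_three {κ : Type*} [DecidableEq κ] (a b c : κ) :
    Finset.univ.image ![a, b, c] = {a, b, c} := by
  ext x
  simp [Fin.exists_fin_succ, eq_comm]

theorem injective_three {κ : Type*} {a b c : κ} (hab : a ≠ b) (hac : a ≠ c) (hbc : b ≠ c) :
    Function.Injective ![a, b, c] := by
  intro x y hxy
  fin_cases x <;> fin_cases y <;> simp_all

/-- Flipping both core columns turns the empty set into {a, b}, exchanges {a, c} and {b, c}, and
leaves at most one column of every other difference set. All resulting pairs lie in {a, b, c}. -/
theorem goodOnThree_flipOn {T : CMat n l} (hT : DiamLeThree T) {r : Fin n} {a b c : Fin l}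
    (hab : a ≠ b) (h1 : ∀ A ∈ diffSystem T r 1, A ⊆ {a, b})
    (h2 : ∀ A ∈ diffSystem T r 2, A ∩ {a, b} ≠ ∅) (h3 : ∀ A ∈ diffSystem T r 3, {a, b} ⊆ A)
    (ha : withWithout (diffSystem T r 2) a b = {{a, c}})
    (hb : withWithout (diffSystem T r 2) b a = {{b, c}}) :
    GoodOnThree T.toPMat (flipOn {a, b} (T r)) := by
  have hac : {a, c} ∈ withWithout (diffSystem T r 2) a b := by
    rw [ha]
    simp
  have hbc : {b, c} ∈ withWithout (diffSystem T r 2) b a := by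
    rw [hb]
    simp
  simp only [withWithout, Finset.mem_filter, Finset.mem_insert, Finset.mem_singleton,
    not_or] at hac hbc
  have hca : a ≠ c := hbc.2.2.2
  have hcb : b ≠ c := hac.2.2.2
  refine ⟨![a, b, c], injective_three hab hca hcb, fun i => ?_⟩
  rw [image_three, mism_flipOn]
  have hm : ∀ x, x ≠ 0 → (diffSet (toPartial (T i)) (toPartial (T r))).card = x →
      diffSet (toPartial (T i)) (toPartial (T r)) ∈ diffSystem T r x :=
    fun x hx h => (mem_diffSystem hx).2 ⟨h, i, rfl⟩
  have hc := hT i r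
  generalize diffSet (toPartial (T i)) (toPartial (T r)) = D at hm hc ⊢
  have hcard := card_add_card_eq_symmDiff D {a, b}
  rw [Finset.card_pair hab] at hcard
  have hpair : ∀ x y : Fin l, ({x, y} : Finset (Fin l)).card ≤ 2 := fun x y => Finset.card_le_two
  have hcases : D.card = 0 ∨ D.card = 1 ∨ D.card = 2 ∨ D.card = 3 := by omega
  rcases hcases with hD | hD | hD | hD
  · right
    rw [Finset.card_eq_zero.1 hD]
    rw [← Finset.bot_eq_empty, bot_symmDiff]
    refine ⟨fun x hx => ?_, hpair a b⟩
    simp only [Finset.mem_insert, Finset.mem_singleton] at hx ⊢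
    tauto
  · left
    have := h1 D (hm 1 (by norm_num) hD)
    rw [Finset.inter_eq_left.2 this] at hcard
    omega
  · have hne := Finset.nonempty_iff_ne_empty.2 (h2 D (hm 2 (by norm_num) hD))
    by_cases haD : a ∈ D
    · by_cases hbD : b ∈ D
      · left
        have hsub : {a, b} ⊆ D := by
          intro x hx
          rcases Finset.mem_insert.1 hx with rfl | hx
          · exact haD
          · rwa [Finset.mem_singleton.1 hx]
        rw [Finset.inter_eq_right.2 hsub, Finset.card_pair hab] at hcard
        omega
      · have : D ∈ withWithout (diffSystem T r 2) a b :=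
          Finset.mem_filter.2 ⟨hm 2 (by norm_num) hD, haD, hbD⟩
        rw [ha, Finset.mem_singleton] at this
        subst this
        right
        refine ⟨fun x hx => ?_, ?_⟩
        · simp only [Finset.mem_symmDiff, Finset.mem_insert, Finset.mem_singleton] at hx ⊢
          tauto
        · have := Finset.card_pos.2 hne
          omega
    · by_cases hbD : b ∈ D
      · have : D ∈ withWithout (diffSystem T r 2) b a :=
          Finset.mem_filter.2 ⟨hm 2 (by norm_num) hD, hbD, haD⟩
        rw [hb, Finset.mem_singleton] at this
        subst this
        right
        refine ⟨fun x hx => ?_, ?_⟩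
        · simp only [Finset.mem_symmDiff, Finset.mem_insert, Finset.mem_singleton] at hx ⊢
          tauto
        · have := Finset.card_pos.2 hne
          omega
      · obtain ⟨x, hx⟩ := hne
        simp only [Finset.mem_inter, Finset.mem_insert, Finset.mem_singleton] at hx
        rcases hx with ⟨hx, rfl | rfl⟩ <;> contradiction
  · left
    have := h3 D (hm 3 (by norm_num) hD)
    rw [Finset.inter_eq_right.2 this, Finset.card_pair hab] at hcard
    omega

/-- If there is no common point, take a pair {a, b}, a pair that avoids a and a pair that avoids b.
They are {b, c} and {a, c} for one point c. A pair that meets all three sides of this triangle has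
both its points among a, b, c. -/
theorem star_or_triangle {ι κ : Type*} [DecidableEq κ] (j₀ : κ) (D : ι → Finset κ)
    (h : ∀ i i', (D i).card = 2 → (D i').card = 2 → (D i ∩ D i').Nonempty) :
    (∃ j, ∀ i, (D i).card = 2 → j ∈ D i) ∨
      ∃ a b c : κ, a ≠ b ∧ a ≠ c ∧ b ≠ c ∧ ∀ i, (D i).card = 2 → D i ⊆ {a, b, c} := by
  rw [or_iff_not_imp_left]
  intro hno
  push Not at hno
  -- The point `j₀` is arbitrary. It only serves to obtain a first pair.
  obtain ⟨i₀, hi₀, -⟩ := hno j₀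
  obtain ⟨a, b, hab, hA⟩ := Finset.card_eq_two.1 hi₀
  obtain ⟨i₁, hi₁, ha₁⟩ := hno a
  obtain ⟨i₂, hi₂, hb₂⟩ := hno b
  have hform : ∀ i x y, (D i).card = 2 → x ≠ y → x ∈ D i → y ∈ D i → D i = {x, y} := by
    intro i x y hi hxy hx hy
    symm
    apply Finset.eq_of_subset_of_card_le
    · intro z hz
      rcases Finset.mem_insert.1 hz with rfl | hz
      · exact hx
      · rwa [Finset.mem_singleton.1 hz]
    · rw [hi, Finset.card_pair hxy]
  have hb₁ : b ∈ D i₁ := by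
    obtain ⟨x, hx⟩ := h i₀ i₁ hi₀ hi₁
    rw [Finset.mem_inter, hA, Finset.mem_insert, Finset.mem_singleton] at hx
    rcases hx with ⟨rfl | rfl, hx⟩
    · contradiction
    · exact hx
  have ha₂ : a ∈ D i₂ := by
    obtain ⟨x, hx⟩ := h i₀ i₂ hi₀ hi₂
    rw [Finset.mem_inter, hA, Finset.mem_insert, Finset.mem_singleton] at hx
    rcases hx with ⟨rfl | rfl, hx⟩
    · exact hx
    · contradiction
  obtain ⟨c, hc⟩ := h i₁ i₂ hi₁ hi₂
  rw [Finset.mem_inter] at hc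
  have hac : a ≠ c := by
    rintro rfl
    exact ha₁ hc.1
  have hbc : b ≠ c := by
    rintro rfl
    exact hb₂ hc.2
  have hB := hform i₁ b c hi₁ hbc hb₁ hc.1
  have hC := hform i₂ a c hi₂ hac ha₂ hc.2
  refine ⟨a, b, c, hab, hac, hbc, fun i hi => ?_⟩
  obtain ⟨x, hx⟩ := h i i₀ hi hi₀
  obtain ⟨y, hy⟩ := h i i₁ hi hi₁
  obtain ⟨z, hz⟩ := h i i₂ hi hi₂
  simp only [hA, hB, hC, Finset.mem_inter, Finset.mem_insert, Finset.mem_singleton] at hx hy hz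
  have key : ∃ u w, u ≠ w ∧ u ∈ D i ∧ w ∈ D i ∧ u ∈ ({a, b, c} : Finset κ) ∧
      w ∈ ({a, b, c} : Finset κ) := by
    simp only [Finset.mem_insert, Finset.mem_singleton]
    grind
  obtain ⟨u, w, huw, hu, hw, hu', hw'⟩ := key
  rw [hform i u w hi huw hu hw]
  intro t ht
  rcases Finset.mem_insert.1 ht with rfl | ht
  · exact hu'
  · rwa [Finset.mem_singleton.1 ht]

theorem exists_good_of_diam_two {T : CMat n l} (hl : 0 < l) (hT : DiamLeThree T) (r : Fin n)
    (h2 : ∀ i, (diffSet (toPartial (T i)) (toPartial (T r))).card ≤ 2) :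
    GoodOutsideOne T.toPMat (T r) ∨ GoodOnThree T.toPMat (T r) := by
  have hmism : ∀ i, mism T.toPMat (T r) i = diffSet (toPartial (T i)) (toPartial (T r)) := by
    intro i
    have := mism_flipOn T ∅ r i
    rw [← Finset.bot_eq_empty, symmDiff_bot] at this
    rw [← this]
    congr 1
  have hmeet : ∀ i i', (mism T.toPMat (T r) i).card = 2 → (mism T.toPMat (T r) i').card = 2 →
      (mism T.toPMat (T r) i ∩ mism T.toPMat (T r) i').Nonempty := by
    intro i i' h h'
    have := hT.card_add_card_le r i i'
    rw [← hmism, ← hmism] at this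
    exact Finset.card_pos.1 (by omega)
  simp only [← hmism] at h2
  rcases star_or_triangle ⟨0, hl⟩ _ hmeet with ⟨j, hj⟩ | ⟨a, b, c, hab, hac, hbc, hsub⟩
  · left
    refine ⟨j, fun i => ?_⟩
    by_cases hi : (mism T.toPMat (T r) i).card = 2
    · rw [Finset.card_erase_of_mem (hj i hi), hi]
    · have := h2 i
      exact Finset.card_erase_le.trans (by omega)
  · right
    refine ⟨![a, b, c], injective_three hab hac hbc, fun i => ?_⟩
    rw [image_three]
    have := h2 i
    by_cases hi : (mism T.toPMat (T r) i).card = 2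
    · exact Or.inr ⟨hsub i hi, this⟩
    · exact Or.inl (by omega)

theorem exists_good {T : CMat n l} (hl : 14 ≤ l) (hd : ∀ j, IsDirty T.toPMat j)
    (hT : DiamLeThree T) : ∃ v, GoodOutsideOne T.toPMat v ∨ GoodOnThree T.toPMat v := by
  by_cases h3 : ∃ i r, (diffSet (toPartial (T i)) (toPartial (T r))).card = 3
  · obtain ⟨i, r, hir⟩ := h3
    obtain ⟨r, hr⟩ := exists_five_le_card hl hd hT hir
    obtain ⟨a, b, hab, -, h1, h2, h3, hx⟩ := hasSunflowerStructure hT hr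
    rcases hx with ⟨h | h, -⟩ | ⟨⟨c, ha, hb⟩, -⟩
    · rw [Finset.pair_comm] at h1 h2 h3
      exact ⟨_, Or.inl (goodOutsideOne_flipOn hT hab.symm h1 h2 h3 h)⟩
    · exact ⟨_, Or.inl (goodOutsideOne_flipOn hT hab h1 h2 h3 h)⟩
    · exact ⟨_, Or.inr (goodOnThree_flipOn hT hab h1 h2 h3 ha hb)⟩
  · push Not at h3
    obtain ⟨⟨r, -⟩, -⟩ := hd ⟨0, by omega⟩
    refine ⟨T r, exists_good_of_diam_two (by omega) hT r fun i => ?_⟩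
    have := hT i r
    have := h3 i r
    omega

theorem GoodOutsideOne.mono {S S' : PMat n l} {v : Fin l → Bool}
    (h : ∀ i, mism S v i ⊆ mism S' v i) (hS : GoodOutsideOne S' v) : GoodOutsideOne S v := by
  obtain ⟨j, hj⟩ := hS
  exact ⟨j, fun i => (Finset.card_le_card (Finset.erase_subset_erase _ (h i))).trans (hj i)⟩

theorem GoodOnThree.mono {S S' : PMat n l} {v : Fin l → Bool}
    (h : ∀ i, mism S v i ⊆ mism S' v i) (hS : GoodOnThree S' v) : GoodOnThree S v := by
  obtain ⟨J, hJ, hj⟩ := hS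
  refine ⟨J, hJ, fun i => (hj i).imp (fun h' => (Finset.card_le_card (h i)).trans h') fun h' => ?_⟩
  exact ⟨(h i).trans h'.1, (Finset.card_le_card (h i)).trans h'.2⟩

theorem IsCompletion.mism_subset {S : PMat n l} {T : CMat n l} (h : IsCompletion S T)
    (v : Fin l → Bool) (i : Fin n) : mism S v i ⊆ mism T.toPMat v i := by
  intro j hj
  rw [mem_mism] at hj ⊢
  rcases h i j with h | h
  · rw [h] at hj
    simp at hj
  · rw [← hj, h]
    rfl

theorem IsCompletion.isDirty {S : PMat n l} {T : CMat n l} (h : IsCompletion S T) {j : Fin l}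
    (hj : IsDirty S j) : IsDirty T.toPMat j := by
  obtain ⟨⟨a, ha⟩, b, hb⟩ := hj
  refine ⟨⟨a, ?_⟩, b, ?_⟩
  · rcases h a j with h | h <;> rw [h] at ha
    · simp at ha
    · exact ha
  · rcases h b j with h | h <;> rw [h] at hb
    · simp at hb
    · exact hb

/-- Missing entries are filled in from `v`. -/
def fillWith (S : PMat n l) (v : Fin l → Bool) : CMat n l := fun i j => (S i j).getD (v j)

theorem isCompletion_fillWith (S : PMat n l) (v : Fin l → Bool) :
    IsCompletion S (fillWith S v) := by
  intro i j
  cases h : S i j <;> simp [fillWith, h]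

theorem diffSet_fillWith (S : PMat n l) (v : Fin l → Bool) (i : Fin n) :
    diffSet (toPartial (fillWith S v i)) (toPartial v) = mism S v i := by
  ext j
  rw [mem_diffSet_toPartial, mem_mism]
  cases h : S i j with
  | none => simp [fillWith, h]
  | some b => cases b <;> cases v j <;> simp [fillWith, h]

theorem card_diffSet_fillWith (S : PMat n l) (v : Fin l → Bool) (i i' : Fin n) :
    (mism S v i).card + (mism S v i').card =
      (diffSet (toPartial (fillWith S v i)) (toPartial (fillWith S v i'))).card +
        2 * (mism S v i ∩ mism S v i').card := by
  rw [card_add_card_eq_symmDiff, diffSet_toPartial_symmDiff _ _ v, diffSet_fillWith,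
    diffSet_fillWith]

/-- Rows filled from `v` differ on the symmetric difference of their mismatch sets. Either two such
sets both contain `j`, which then cancels, or their sizes add up to at most three. -/
theorem GoodOutsideOne.isYes {S : PMat n l} {v : Fin l → Bool} (h : GoodOutsideOne S v) :
    IsYes 0 3 S := by
  obtain ⟨j, hj⟩ := h
  refine isYes_zero_three_iff.2 ⟨_, isCompletion_fillWith S v, fun i i' => ?_⟩
  have h0 := card_diffSet_fillWith S v i i'
  have h1 := hj i
  have h2 := hj i'
  rw [Finset.card_erase_eq_ite] at h1 h2
  by_cases hji : j ∈ mism S v i <;> by_cases hji' : j ∈ mism S v i' <;>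
    simp only [hji, hji', if_true, if_false] at h1 h2
  · have := Finset.card_pos.2 ⟨j, Finset.mem_inter.2 ⟨hji, hji'⟩⟩
    omega
  all_goals omega

/-- The only critical case is that of two mismatch sets of size two. Both lie in the same three
columns, so they share one. -/
theorem GoodOnThree.isYes {S : PMat n l} {v : Fin l → Bool} (h : GoodOnThree S v) :
    IsYes 0 3 S := by
  obtain ⟨J, hJ, hj⟩ := h
  refine isYes_zero_three_iff.2 ⟨_, isCompletion_fillWith S v, fun i i' => ?_⟩
  have h0 := card_diffSet_fillWith S v i i'
  by_cases hc : (mism S v i).card + (mism S v i').card ≤ 3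
  · omega
  rcases hj i with h1 | h1 <;> rcases hj i' with h2 | h2
  · omega
  · omega
  · omega
  · have h3 := Finset.card_union_add_card_inter (mism S v i) (mism S v i')
    have h4 := Finset.card_le_card (Finset.union_subset h1.1 h2.1)
    rw [Finset.card_image_of_injective _ hJ, Finset.card_univ, Fintype.card_fin] at h4
    omega

/-- A center of a completion is also a center of `S`, since forgetting entries shrinks the mismatch
sets. In the other direction the missing entries are copied from the center. -/
theorem isYes_iff_exists_good {S : PMat n l} (hl : 14 ≤ l) (hd : ∀ j, IsDirty S j) :
    IsYes 0 3 S ↔ ∃ v, GoodOutsideOne S v ∨ GoodOnThree S v := by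
  constructor
  · intro h
    obtain ⟨T, hST, hT⟩ := isYes_zero_three_iff.1 h
    obtain ⟨v, hv⟩ := exists_good hl (fun j => hST.isDirty (hd j)) hT
    exact ⟨v, hv.imp (·.mono (hST.mism_subset v)) (·.mono (hST.mism_subset v))⟩
  · rintro ⟨v, hv | hv⟩
    · exact hv.isYes
    · exact hv.isYes

end Centers

/-! ### Deletion of columns that are not dirty -/

section Columns

variable {n l m : ℕ}

theorem card_diffSet_comp_le {c : Fin m → Fin l} (hc : Function.Injective c)
    (u w : Fin l → Option Bool) :
    (diffSet (fun k => u (c k)) fun k => w (c k)).card ≤ (diffSet u w).card := by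
  rw [← Finset.card_image_of_injective _ hc]
  apply Finset.card_le_card
  intro j hj
  obtain ⟨k, hk, rfl⟩ := Finset.mem_image.1 hj
  simpa [diffSet] using hk

/-- Whether `S` is a yes-instance only depends on the dirty columns. -/
theorem isYes_comp_iff {S : PMat n l} {c : Fin m → Fin l} (hc : Function.Injective c)
    (hd : ∀ j, IsDirty S j → ∃ k, c k = j) :
    IsYes 0 3 S ↔ IsYes 0 3 (fun i k => S i (c k) : PMat n m) := by
  rw [isYes_zero_three_iff, isYes_zero_three_iff]
  constructor
  · rintro ⟨T, hST, hT⟩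
    exact ⟨fun i k => T i (c k), fun i k => hST i (c k),
      fun i i' => (card_diffSet_comp_le hc _ _).trans (hT i i')⟩
  · rintro ⟨T, hST, hT⟩
    classical
    -- The known entries of a column outside the range of `c` all agree. Every row receives this
    -- common value there (`false` if no entry is known), so the column contributes to no distance.
    let T' : CMat n l := fun i j =>
      if h : ∃ k, c k = j then T i h.choose else decide (∃ i', S i' j = some true)
    have hT'c : ∀ i k, T' i (c k) = T i k := by
      intro i k
      have h : ∃ k', c k' = c k := ⟨k, rfl⟩
      simp only [T', dif_pos h]
      rw [hc h.choose_spec]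
    refine ⟨T', fun i j => ?_, fun i i' => ?_⟩
    · by_cases h : ∃ k, c k = j
      · obtain ⟨k, rfl⟩ := h
        rw [hT'c]
        exact hST i k
      · simp only [T', dif_neg h]
        have hnd : ¬ IsDirty S j := fun hj => h (hd j hj)
        cases hS : S i j with
        | none => exact Or.inl rfl
        | some b =>
          right
          cases b
          · have : ¬ ∃ i', S i' j = some true := fun h' => hnd ⟨⟨i, hS⟩, h'⟩
            simp [this]
          · have : ∃ i', S i' j = some true := ⟨i, hS⟩
            simp [this]
    · refine le_trans ?_ (hT i i')
      rw [← Finset.card_image_of_injective _ hc]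
      apply Finset.card_le_card
      intro j hj
      rw [mem_diffSet_toPartial] at hj
      by_cases h : ∃ k, c k = j
      · obtain ⟨k, rfl⟩ := h
        rw [hT'c, hT'c] at hj
        exact Finset.mem_image_of_mem _ (mem_diffSet_toPartial.2 hj)
      · simp only [T', dif_neg h] at hj
        exact absurd rfl hj

theorem isYes_dirtyPart_iff (S : PMat n l) : IsYes 0 3 S ↔ IsYes 0 3 (dirtyPart S) := by
  refine isYes_comp_iff (c := Finset.orderEmbOfFin _ rfl)
    (Finset.orderEmbOfFin _ rfl).injective fun j hj => ?_
  have : j ∈ Finset.univ.filter fun j => IsDirty S j := by simpa using hj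
  rw [← Finset.mem_coe, ← Finset.range_orderEmbOfFin _ rfl] at this
  exact this

end Columns

/-! ### The reduction to ConRMC with radii at most one -/

section Reduction

variable {n l : ℕ}

theorem hdist_subCols_comp (S : PMat n l) (J : Finset (Fin l)) (v : Fin l → Bool) (i : Fin n) :
    hdist (toPartial fun k => v (J.orderEmbOfFin rfl k)) (subCols S J i) =
      (mism S v i ∩ J).card := by
  rw [hdist, ← Finset.card_map (J.orderEmbOfFin rfl).toEmbedding]
  congr 1
  ext j
  have hk : ∀ k, k ∈ diffSet (toPartial fun k => v (J.orderEmbOfFin rfl k)) (subCols S J i) ↔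
      S i (J.orderEmbOfFin rfl k) = some (!v (J.orderEmbOfFin rfl k)) := by
    intro k
    rw [diffSet, Finset.mem_filter]
    change _ ∧ some (v (J.orderEmbOfFin rfl k)) ≠ S i (J.orderEmbOfFin rfl k) ∧ _ ∧
      S i (J.orderEmbOfFin rfl k) ≠ none ↔ _
    generalize S i (J.orderEmbOfFin rfl k) = x
    generalize v (J.orderEmbOfFin rfl k) = y
    rcases x with - | x
    · simp
    · cases x <;> cases y <;> simp [toPartial]
  simp only [Finset.mem_map, Finset.mem_inter, mem_mism, hk]
  constructor
  · rintro ⟨k, hk, rfl⟩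
    exact ⟨hk, Finset.orderEmbOfFin_mem _ rfl k⟩
  · rintro ⟨h, hj⟩
    rw [← Finset.mem_coe, ← Finset.range_orderEmbOfFin J rfl] at hj
    obtain ⟨k, rfl⟩ := hj
    exact ⟨k, h, rfl⟩

theorem exists_comp_orderEmb (J : Finset (Fin l)) (w : Fin J.card → Bool) (u : Fin l → Bool) :
    ∃ v : Fin l → Bool, (∀ k, v (J.orderEmbOfFin rfl k) = w k) ∧ ∀ j ∉ J, v j = u j := by
  classical
  refine ⟨fun j => if h : ∃ k, J.orderEmbOfFin rfl k = j then w h.choose else u j, ?_, ?_⟩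
  · intro k
    have h : ∃ k', J.orderEmbOfFin rfl k' = J.orderEmbOfFin rfl k := ⟨k, rfl⟩
    simp only [dif_pos h]
    rw [(J.orderEmbOfFin rfl).injective h.choose_spec]
  · intro j hj
    apply dif_neg
    rintro ⟨k, rfl⟩
    exact hj (Finset.orderEmbOfFin_mem _ rfl k)

theorem inst₁_isYes_iff {S : PMat n l} {j : Fin l} :
    (inst₁ S j).IsYes ↔ ∃ v, ∀ i, ((mism S v i).erase j).card ≤ 1 := by
  have he : ∀ v i, (mism S v i).erase j = mism S v i ∩ {j}ᶜ := by
    intro v i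
    ext x
    simp [and_comm]
  simp only [he]
  constructor
  · rintro ⟨w, hw⟩
    obtain ⟨v, hv, -⟩ := exists_comp_orderEmb {j}ᶜ w fun _ => false
    refine ⟨v, fun i => ?_⟩
    rw [← hdist_subCols_comp]
    simp only [hv]
    exact hw i
  · rintro ⟨v, hv⟩
    refine ⟨fun k => v (({j}ᶜ : Finset (Fin l)).orderEmbOfFin rfl k), fun i => ?_⟩
    have := hv i
    rw [← hdist_subCols_comp] at this
    exact this

theorem inst₂_isYes_iff {S : PMat n l} {J : Fin 3 → Fin l} {b : Fin 3 → Bool}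
    (hJ : Function.Injective J) :
    (inst₂ S J b).IsYes ↔ ∃ v, (∀ t, v (J t) = b t) ∧
      ∀ i, (mism S v i ∩ (Finset.univ.image J)ᶜ).card ≤
        if ∃ t, S i (J t) = some (!b t) then 0 else 1 := by
  constructor
  · rintro ⟨w, hw⟩
    -- On the deleted columns the row is given the guessed bits. This is consistent because `J` is
    -- injective.
    obtain ⟨v, hv, hv'⟩ := exists_comp_orderEmb (Finset.univ.image J)ᶜ w
      fun j => decide (∃ t, J t = j ∧ b t = true)
    refine ⟨v, fun t => ?_, fun i => ?_⟩
    · rw [hv' _ (by simp)]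
      have : (∃ t', J t' = J t ∧ b t' = true) ↔ b t = true :=
        ⟨fun ⟨t', h, h'⟩ => hJ h ▸ h', fun h => ⟨t, rfl, h⟩⟩
      simp [this]
    · rw [← hdist_subCols_comp]
      simp only [hv]
      exact hw i
  · rintro ⟨v, -, hv⟩
    refine ⟨fun k => v ((Finset.univ.image J)ᶜ.orderEmbOfFin rfl k), fun i => ?_⟩
    have := hv i
    rw [← hdist_subCols_comp] at this
    exact this

/-- The guessed bits are the values of the center on the three columns. Radius zero says that a row
with a mismatch among them has none elsewhere, and excluding rows that contradict all three bits
keeps the mismatch sets inside the triple at size two. -/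
theorem exists_reduction_iff {S : PMat n l} :
    (∃ I ∈ reductionInstances S, I.IsYes) ↔ ∃ v, GoodOutsideOne S v ∨ GoodOnThree S v := by
  constructor
  · rintro ⟨I, ⟨j, rfl⟩ | ⟨J, b, hJ, hb, rfl⟩, hI⟩
    · obtain ⟨v, hv⟩ := inst₁_isYes_iff.1 hI
      exact ⟨v, Or.inl ⟨j, hv⟩⟩
    · obtain ⟨v, hvJ, hv⟩ := (inst₂_isYes_iff hJ).1 hI
      refine ⟨v, Or.inr ⟨J, hJ, fun i => ?_⟩⟩
      have hi := hv i
      split_ifs at hi with h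
      · right
        rw [Nat.le_zero, Finset.card_eq_zero] at hi
        have hsub : mism S v i ⊆ Finset.univ.image J := by
          intro x hx
          by_contra hxJ
          have : x ∈ mism S v i ∩ (Finset.univ.image J)ᶜ :=
            Finset.mem_inter.2 ⟨hx, Finset.mem_compl.2 hxJ⟩
          rw [hi] at this
          simp at this
        refine ⟨hsub, ?_⟩
        obtain ⟨t, ht⟩ := hb i
        have : mism S v i ⊆ (Finset.univ.image J).erase (J t) := by
          intro x hx
          refine Finset.mem_erase.2 ⟨?_, hsub hx⟩
          rintro rfl
          rw [mem_mism, hvJ] at hx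
          exact ht hx
        have := Finset.card_le_card this
        rw [Finset.card_erase_of_mem (by simp), Finset.card_image_of_injective _ hJ] at this
        simpa using this
      · left
        have : mism S v i ∩ (Finset.univ.image J)ᶜ = mism S v i := by
          rw [Finset.inter_eq_left]
          intro x hx
          rw [Finset.mem_compl]
          intro hxJ
          obtain ⟨t, -, rfl⟩ := Finset.mem_image.1 hxJ
          rw [mem_mism, hvJ] at hx
          exact h ⟨t, hx⟩
        rwa [this] at hi
  · rintro ⟨v, ⟨j, hj⟩ | ⟨J, hJ, hv⟩⟩
    · exact ⟨inst₁ S j, Or.inl ⟨j, rfl⟩, inst₁_isYes_iff.2 ⟨v, hj⟩⟩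
    · refine ⟨inst₂ S J fun t => v (J t), Or.inr ⟨J, _, hJ, fun i => ?_, rfl⟩,
        (inst₂_isYes_iff hJ).2 ⟨v, fun _ => rfl, fun i => ?_⟩⟩
      · by_contra! h
        have hsub : Finset.univ.image J ⊆ mism S v i := by
          intro x hx
          obtain ⟨t, -, rfl⟩ := Finset.mem_image.1 hx
          exact mem_mism.2 (h t)
        have := Finset.card_le_card hsub
        rw [Finset.card_image_of_injective _ hJ, Finset.card_univ, Fintype.card_fin] at this
        rcases hv i with h | h <;> omega
      · split_ifs with h
        · obtain ⟨t, ht⟩ := h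
          rw [Nat.le_zero, Finset.card_eq_zero]
          have htm : J t ∈ mism S v i := mem_mism.2 ht
          rcases hv i with h | h
          · rw [Finset.card_le_one] at h
            ext y
            simp only [Finset.mem_inter, Finset.mem_compl, Finset.notMem_empty, iff_false, not_and,
              not_not]
            intro hy
            rw [h y hy _ htm]
            simp
          · ext y
            simp only [Finset.mem_inter, Finset.mem_compl, Finset.notMem_empty, iff_false, not_and,
              not_not]
            exact fun hy => h.1 hy
        · rcases hv i with h' | h'
          · exact (Finset.card_le_card Finset.inter_subset_left).trans h'
          · have : mism S v i ∩ (Finset.univ.image J)ᶜ = ∅ := by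
              ext y
              simp only [Finset.mem_inter, Finset.mem_compl, Finset.notMem_empty, iff_false,
                not_and, not_not]
              exact fun hy => h'.1 hy
            simp [this]

theorem reductionInstances_subset (S : PMat n l) :
    reductionInstances S ⊆ Set.range (inst₁ S) ∪
      Set.range fun q : (Fin 3 → Fin l) × (Fin 3 → Bool) => inst₂ S q.1 q.2 := by
  rintro I (⟨j, rfl⟩ | ⟨J, b, -, -, rfl⟩)
  · exact Or.inl ⟨j, rfl⟩
  · exact Or.inr ⟨(J, b), rfl⟩

theorem finite_reductionInstances (S : PMat n l) : (reductionInstances S).Finite :=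
  ((Set.finite_range _).union (Set.finite_range _)).subset (reductionInstances_subset S)

theorem ncard_reductionInstances_le (S : PMat n l) :
    (reductionInstances S).ncard ≤ 9 * l ^ 3 := by
  have hr : ∀ {α β : Type} [Fintype α] (f : α → β), (Set.range f).ncard ≤ Fintype.card α := by
    intro α β _ f
    rw [← Set.image_univ, ← Nat.card_eq_fintype_card, ← Set.ncard_univ]
    exact Set.ncard_image_le Set.finite_univ
  have h0 := Set.ncard_le_ncard (reductionInstances_subset S)
    ((Set.finite_range _).union (Set.finite_range _))
  have h1 := Set.ncard_union_le (Set.range (inst₁ S))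
    (Set.range fun q : (Fin 3 → Fin l) × (Fin 3 → Bool) => inst₂ S q.1 q.2)
  have h2 := hr (inst₁ S)
  have h3 := hr fun q : (Fin 3 → Fin l) × (Fin 3 → Bool) => inst₂ S q.1 q.2
  simp only [Fintype.card_fin, Fintype.card_prod, Fintype.card_fun, Fintype.card_bool] at h2 h3
  -- There are at most `l` instances of the first kind and `2 ^ 3 * l ^ 3` of the second.
  have h4 : l ≤ l ^ 3 := Nat.le_self_pow (by norm_num) l
  omega

theorem radius_le_one_of_mem {S : PMat n l} {I : ConRMC n} (hI : I ∈ reductionInstances S)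
    (i : Fin n) : I.radius i ≤ 1 := by
  rcases hI with ⟨j, rfl⟩ | ⟨J, b, -, -, rfl⟩
  · exact le_rfl
  · simp only [inst₂]
    split_ifs <;> omega

end Reduction

end DMC

namespace DMC

/-! ### Two-satisfiability

The literal `p < D` says that column `p` is `0`, and the literal `D ≤ p < 2 * D` says that column
`p - D` is `1`. A clause forbids that two clashing literals hold. -/

section TwoSat

/-- The column of a literal. -/
def litVar (D p : ℕ) : ℕ := if p < D then p else p - D

/-- The negation of a literal. -/
def litNeg (D p : ℕ) : ℕ := if p < D then p + D else p - D

variable {D p q : ℕ}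

theorem litVar_lt (hp : p < 2 * D) : litVar D p < D := by
  unfold litVar
  split_ifs <;> omega

theorem litNeg_lt (hp : p < 2 * D) : litNeg D p < 2 * D := by
  unfold litNeg
  split_ifs <;> omega

theorem litNeg_litNeg (hp : p < 2 * D) : litNeg D (litNeg D p) = p := by
  unfold litNeg
  split_ifs <;> omega

theorem litVar_litNeg (hp : p < 2 * D) : litVar D (litNeg D p) = litVar D p := by
  unfold litVar litNeg
  split_ifs <;> omega

theorem litVar_of_lt (hp : p < D) : litVar D p = p := if_pos hp

theorem litVar_add (p : ℕ) : litVar D (p + D) = p := by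
  simp [litVar]

theorem litNeg_of_lt (hp : p < D) : litNeg D p = p + D := if_pos hp

theorem litNeg_add (p : ℕ) : litNeg D (p + D) = p := by
  simp [litNeg]

theorem eq_or_eq_litNeg (hp : p < 2 * D) (hq : q < 2 * D) (h : litVar D p = litVar D q) :
    q = p ∨ q = litNeg D p := by
  unfold litVar at h
  unfold litNeg
  split_ifs at h ⊢ <;> omega

theorem lit_cases (hp : p < 2 * D) :
    (p = litVar D p ∧ litNeg D p = litVar D p + D) ∨
      (p = litVar D p + D ∧ litNeg D p = litVar D p) := by
  unfold litVar litNeg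
  split_ifs <;> omega

/-- `P` is closed under unit propagation on the unmasked columns. -/
def PropClosed (D : ℕ) (X : ℕ → ℕ → Prop) (mask P : ℕ → Prop) : Prop :=
  ∀ p < 2 * D, P p → ∀ q < 2 * D, X p q → ¬ mask (litVar D q) → P (litNeg D q)

def Consistent (D : ℕ) (P : ℕ → Prop) : Prop := ∀ k < D, ¬ (P k ∧ P (k + D))

/-- Unit propagation from the literals `seeds` does not reach a contradiction. -/
def Propagates (D : ℕ) (X : ℕ → ℕ → Prop) (mask seeds : ℕ → Prop) : Prop :=
  ∃ P : ℕ → Prop, (∀ p < 2 * D, seeds p → P p) ∧ (∀ p < 2 * D, P p → ¬ mask (litVar D p)) ∧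
    PropClosed D X mask P ∧ Consistent D P

/-- `T` is an assignment of the unmasked columns without clashing literals. -/
def IsModel (D : ℕ) (X : ℕ → ℕ → Prop) (mask T : ℕ → Prop) : Prop :=
  (∀ p < 2 * D, ¬ mask (litVar D p) → (T (litNeg D p) ↔ ¬ T p)) ∧
    ∀ p < 2 * D, ∀ q < 2 * D, T p → T q → ¬ mask (litVar D p) → ¬ mask (litVar D q) → ¬ X p q

def Sat (D : ℕ) (X : ℕ → ℕ → Prop) (mask : ℕ → Prop) : Prop := ∃ T, IsModel D X mask T

theorem Consistent.not_litNeg {P : ℕ → Prop} (h : Consistent D P) (hp : p < 2 * D) (hP : P p) :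
    ¬ P (litNeg D p) := by
  intro hn
  have := h _ (litVar_lt hp)
  rcases lit_cases hp with ⟨h1, h2⟩ | ⟨h1, h2⟩
  · rw [h2] at hn
    rw [h1] at hP
    exact this ⟨hP, hn⟩
  · rw [h2] at hn
    rw [h1] at hP
    exact this ⟨hn, hP⟩

/-- A propagated set extends to a model, if the columns that it leaves open have a model. -/
theorem exists_model_of_closed {X : ℕ → ℕ → Prop} (hX : ∀ p q, X p q → X q p)
    {mask mask' P : ℕ → Prop} (hPc : PropClosed D X mask P) (hP : Consistent D P)
    (hsat : Sat D X mask')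
    (hmask : ∀ p < 2 * D, mask' (litVar D p) → ¬ mask (litVar D p) → P p ∨ P (litNeg D p)) :
    ∃ T, IsModel D X mask T ∧ ∀ p < 2 * D, P p → T p := by
  obtain ⟨T', hT', hT'X⟩ := hsat
  have hopen : ∀ p < 2 * D, ¬ mask (litVar D p) → ¬ P p → ¬ P (litNeg D p) →
      ¬ mask' (litVar D p) := by
    intro p hp hm h1 h2 h3
    rcases hmask p hp h3 hm with h | h <;> contradiction
  -- `P` decides its own columns and `T'` decides the rest. No clash arises between the two: a
  -- literal that clashes with one in `P` has its negation in `P`, by closedness.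
  refine ⟨fun p => P p ∨ (¬ P p ∧ ¬ P (litNeg D p) ∧ T' p), ⟨?_, ?_⟩, fun p _ => Or.inl⟩
  · intro p hp hm
    have h1 := fun h1 h2 => hT' p hp (hopen p hp hm h1 h2)
    have h2 := hP.not_litNeg hp
    beta_reduce
    rw [litNeg_litNeg hp]
    tauto
  · intro p hp q hq hTp hTq hpm hqm hpq
    have h1 : P p → P (litNeg D q) := fun h => hPc p hp h q hq hpq hqm
    have h2 : P q → P (litNeg D p) := fun h => hPc q hq h p hp (hX _ _ hpq) hpm
    have h3 := hP.not_litNeg hp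
    have h4 := hP.not_litNeg hq
    have h5 := fun a b c d => hT'X p hp q hq a b (hopen p hp hpm c d)
    have h6 := hopen q hq hqm
    tauto

/-- Columns can be decided one after the other without backtracking. Once a set of literals is
closed under propagation and consistent, it imposes nothing on the columns that it leaves open, so
each open column may be tested on its own. -/
theorem sat_iff_propagates {X : ℕ → ℕ → Prop} (hX : ∀ p q, X p q → X q p) {mask : ℕ → Prop} :
    Sat D X mask ↔ ∀ k < D, ¬ mask k →
      Propagates D X mask (· = k) ∨ Propagates D X mask (· = k + D) := by
  constructor
  · rintro ⟨T, hT, hTX⟩ k hk hm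
    have hprop : ∀ x < 2 * D, litVar D x = k → T x → Propagates D X mask (· = x) := by
      intro x hx hxk hTx
      refine ⟨fun p => T p ∧ ¬ mask (litVar D p), ?_, fun p _ h => h.2, ?_, ?_⟩
      · rintro p hp rfl
        exact ⟨hTx, hxk ▸ hm⟩
      · intro p hp hp' q hq hpq hqm
        rw [litVar_litNeg hq, hT q hq hqm]
        exact ⟨fun hTq => hTX p hp q hq hp'.1 hTq hp'.2 hqm hpq, hqm⟩
      · intro k hk h
        have := hT k (by omega) (litVar_of_lt hk ▸ h.1.2)
        rw [litNeg_of_lt hk] at this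
        exact this.1 h.2.1 h.1.1
    have := hT k (by omega) (by rwa [litVar_of_lt hk])
    rw [litNeg_of_lt hk] at this
    by_cases hTk : T k
    · exact Or.inl (hprop k (by omega) (litVar_of_lt hk) hTk)
    · exact Or.inr (hprop (k + D) (by omega) (litVar_add k) (this.2 hTk))
  · intro h
    have key : ∀ m ≤ D, ∃ P : ℕ → Prop, (∀ p < 2 * D, P p → ¬ mask (litVar D p)) ∧
        PropClosed D X mask P ∧ Consistent D P ∧ ∀ k < m, ¬ mask k → P k ∨ P (k + D) := by
      intro m
      induction m with
      | zero =>
        exact fun _ => ⟨fun _ => False, fun _ _ h => h.elim, fun _ _ h => h.elim,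
          fun _ _ h => h.1, fun _ h => absurd h (Nat.not_lt_zero _)⟩
      | succ m ih =>
        intro hm
        obtain ⟨P, hPm, hPc, hP, hall⟩ := ih (by omega)
        by_cases hdone : mask m ∨ P m ∨ P (m + D)
        · refine ⟨P, hPm, hPc, hP, fun k hk hkm => ?_⟩
          rcases Nat.lt_succ_iff_lt_or_eq.1 hk with hk | rfl
          · exact hall k hk hkm
          · tauto
        · rw [not_or, not_or] at hdone
          obtain ⟨Q, hQm, hQc, hQ, hQmem⟩ : ∃ Q : ℕ → Prop,
              (∀ p < 2 * D, Q p → ¬ mask (litVar D p)) ∧ PropClosed D X mask Q ∧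
              Consistent D Q ∧ (Q m ∨ Q (m + D)) := by
            rcases h m hm hdone.1 with ⟨Q, h1, h2, h3, h4⟩ | ⟨Q, h1, h2, h3, h4⟩
            · exact ⟨Q, h2, h3, h4, Or.inl (h1 _ (by omega) rfl)⟩
            · exact ⟨Q, h2, h3, h4, Or.inr (h1 _ (by omega) rfl)⟩
          -- `Q` is used only on columns that `P` leaves open. If a literal of `Q` clashed with one
          -- in `P`, then by symmetry of `X` its negation would already be in `P`.
          refine ⟨fun p => P p ∨ (Q p ∧ ¬ P p ∧ ¬ P (litNeg D p)), ?_, ?_, ?_, ?_⟩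
          · rintro p hp (h | h)
            · exact hPm p hp h
            · exact hQm p hp h.1
          · rintro p hp (h | ⟨h, h1, h2⟩) q hq hpq hqm
            · exact Or.inl (hPc p hp h q hq hpq hqm)
            · have h3 := hQc p hp h q hq hpq hqm
              rw [litNeg_litNeg hq]
              have h4 : P q → P (litNeg D p) := fun h' =>
                hPc q hq h' p hp (hX _ _ hpq) (hQm p hp h)
              tauto
          · intro k hk
            have h1 := hP k hk
            have h2 := hQ k hk
            beta_reduce
            rw [litNeg_of_lt hk, litNeg_add]
            tauto
          · intro k hk hkm
            rcases Nat.lt_succ_iff_lt_or_eq.1 hk with hk | rfl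
            · exact (hall k hk hkm).imp Or.inl Or.inl
            · beta_reduce
              rw [litNeg_of_lt (by omega), litNeg_add]
              tauto
    obtain ⟨P, hPm, hPc, hP, hall⟩ := key D le_rfl
    -- `P` decides every unmasked column, so the remaining system may be taken with all columns
    -- masked, where every assignment is a model.
    obtain ⟨T, hT, -⟩ := exists_model_of_closed (mask' := fun _ => True) hX hPc hP
      ⟨fun _ => True, fun _ _ h => (h trivial).elim, fun _ _ _ _ _ _ h => (h trivial).elim⟩ (by
        intro p hp _ hpm
        have := hall _ (litVar_lt hp) hpm
        rcases lit_cases hp with ⟨h1, h2⟩ | ⟨h1, h2⟩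
        · rw [h2]
          rw [← h1] at this ⊢
          exact this
        · rw [h2]
          rw [h1, litVar_add]
          exact this.symm)
    exact ⟨T, hT⟩

end TwoSat

/-! ### Centers as models of 2-SAT systems -/

section Acceptance

variable {n D : ℕ}

/-- Row `i` has a known entry that contradicts the literal `p`. -/
def Hit (S : PMat n D) (i p : ℕ) : Prop :=
  inputOf S i (litVar D p) = if p < D then 1 else 0

/-- Some row contradicts both of the literals `p` and `q`, which are on different columns. -/
def Clash (S : PMat n D) (p q : ℕ) : Prop :=
  litVar D p ≠ litVar D q ∧ ∃ i < n, Hit S i p ∧ Hit S i q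

/-- The columns of `p` and `q` and those on which `p` and `q` force the same literal. -/
def pairMask (D : ℕ) (X : ℕ → ℕ → Prop) (p q k : ℕ) : Prop :=
  k = litVar D p ∨ k = litVar D q ∨ (X p k ∧ X q k) ∨ (X p (k + D) ∧ X q (k + D))

def tripleMask (D p q r k : ℕ) : Prop := k = litVar D p ∨ k = litVar D q ∨ k = litVar D r

/-- The literals that are forced by one of `p`, `q`, `r`. -/
def tripleSeeds (D : ℕ) (X : ℕ → ℕ → Prop) (p q r s : ℕ) : Prop :=
  ¬ tripleMask D p q r (litVar D s) ∧
    (X p (litNeg D s) ∨ X q (litNeg D s) ∨ X r (litNeg D s))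

/-- The criterion that the algorithm evaluates. -/
def Accepts (S : PMat n D) : Prop :=
  (∃ j < D, Sat D (Clash S) (· = j)) ∨
    ∃ p < 2 * D, ∃ q < 2 * D, litVar D p ≠ litVar D q ∧ Sat D (Clash S) (pairMask D (Clash S) p q) ∧
      ∃ r < 2 * D, Clash S p r ∧ Clash S q r ∧
        Propagates D (Clash S) (tripleMask D p q r) (tripleSeeds D (Clash S) p q r) ∧
        ¬ ∃ i < n, Hit S i p ∧ Hit S i q ∧ Hit S i r

theorem Clash.symm {S : PMat n D} {p q : ℕ} (h : Clash S p q) : Clash S q p := by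
  obtain ⟨h1, i, hi, h2, h3⟩ := h
  exact ⟨h1.symm, i, hi, h3, h2⟩

theorem hit_iff {S : PMat n D} {p : ℕ} (hp : p < 2 * D) (i : Fin n) :
    Hit S i p ↔ S i ⟨litVar D p, litVar_lt hp⟩ = some (decide (p < D)) := by
  have h : (i : ℕ) < n ∧ litVar D p < D := ⟨i.2, litVar_lt hp⟩
  rw [Hit, inputOf, dif_pos h]
  change entryCode (S i _) = _ ↔ _
  rcases S i ⟨litVar D p, litVar_lt hp⟩ with - | b
  · by_cases h : p < D <;> simp [h, entryCode]
  · by_cases h : p < D <;> cases b <;> simp [h, entryCode]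

/-- The literal `p` holds under the assignment `v`. -/
def LitTrue (v : Fin D → Bool) (p : ℕ) : Prop :=
  ∃ h : litVar D p < D, v ⟨litVar D p, h⟩ = !decide (p < D)

theorem litTrue_litNeg {v : Fin D → Bool} {p : ℕ} (hp : p < 2 * D) :
    LitTrue v (litNeg D p) ↔ ¬ LitTrue v p := by
  simp only [LitTrue, litVar_litNeg hp, litVar_lt hp, exists_true_left]
  have : litNeg D p < D ↔ ¬ p < D := by
    unfold litNeg
    split_ifs <;> omega
  by_cases h : p < D <;> simp [this, h]

theorem LitTrue.hit_iff {S : PMat n D} {v : Fin D → Bool} {p : ℕ} (hp : p < 2 * D)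
    (h : LitTrue v p) (i : Fin n) : Hit S i p ↔ ⟨litVar D p, litVar_lt hp⟩ ∈ mism S v i := by
  obtain ⟨_, hv⟩ := h
  rw [DMC.hit_iff hp, mem_mism, hv, Bool.not_not]

/-- The literal of column `j` that holds under `v`. -/
def litOf (v : Fin D → Bool) (j : Fin D) : ℕ := if v j then j + D else j

theorem litOf_lt (v : Fin D → Bool) (j : Fin D) : litOf v j < 2 * D := by
  unfold litOf
  split_ifs <;> omega

theorem litVar_litOf (v : Fin D → Bool) (j : Fin D) : litVar D (litOf v j) = j := by
  unfold litOf
  split_ifs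
  · exact litVar_add _
  · exact litVar_of_lt j.2

theorem litTrue_litOf (v : Fin D → Bool) (j : Fin D) : LitTrue v (litOf v j) := by
  refine ⟨(litVar_litOf v j).symm ▸ j.2, ?_⟩
  simp only [litVar_litOf]
  unfold litOf
  cases h : v j <;> simp

theorem hit_litOf {S : PMat n D} {v : Fin D → Bool} {i : Fin n} {j : Fin D} :
    Hit S i (litOf v j) ↔ j ∈ mism S v i := by
  rw [(litTrue_litOf v j).hit_iff (litOf_lt v j)]
  simp only [litVar_litOf]

theorem clash_litOf {S : PMat n D} {v : Fin D → Bool} {i : Fin n} {j k : Fin D} (hjk : j ≠ k)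
    (hj : j ∈ mism S v i) (hk : k ∈ mism S v i) : Clash S (litOf v j) (litOf v k) := by
  refine ⟨?_, i, i.2, hit_litOf.2 hj, hit_litOf.2 hk⟩
  rw [litVar_litOf, litVar_litOf]
  exact fun h => hjk (Fin.ext h)

theorem exists_mism_of_clash {S : PMat n D} {v : Fin D → Bool} {p q : ℕ} (hp : p < 2 * D)
    (hq : q < 2 * D) (hvp : LitTrue v p) (hvq : LitTrue v q) (h : Clash S p q) :
    ∃ i, ⟨litVar D p, litVar_lt hp⟩ ∈ mism S v i ∧ ⟨litVar D q, litVar_lt hq⟩ ∈ mism S v i ∧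
      (⟨litVar D p, litVar_lt hp⟩ : Fin D) ≠ ⟨litVar D q, litVar_lt hq⟩ := by
  obtain ⟨h1, i, hi, h2, h3⟩ := h
  refine ⟨⟨i, hi⟩, (hvp.hit_iff hp ⟨i, hi⟩).1 h2, (hvq.hit_iff hq ⟨i, hi⟩).1 h3, ?_⟩
  exact fun h => h1 (Fin.mk.inj h)

theorem exists_litOf_iff (T : ℕ → Prop) :
    ∃ v : Fin D → Bool, ∀ j : Fin D, T (j + D) ↔ v j = true := by
  classical
  exact ⟨fun j => decide (T (j + D)), fun j => by simp⟩

theorem IsModel.litOf {X : ℕ → ℕ → Prop} {mask T : ℕ → Prop} (hT : IsModel D X mask T)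
    {v : Fin D → Bool} {j : Fin D} (hv : T (j + D) ↔ v j = true) (hj : ¬ mask j) :
    T (litOf v j) := by
  have := hT.1 j (by omega) (by rwa [litVar_of_lt j.2])
  rw [litNeg_of_lt j.2, hv] at this
  unfold DMC.litOf
  split_ifs with h
  · exact hv.2 h
  · by_contra hn
    exact h (this.2 hn)

theorem GoodOutsideOne.accepts {S : PMat n D} {v : Fin D → Bool} (h : GoodOutsideOne S v) :
    Accepts S := by
  obtain ⟨j, hj⟩ := h
  refine Or.inl ⟨j, j.2, LitTrue v, fun p hp _ => litTrue_litNeg hp, ?_⟩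
  intro p hp q hq hvp hvq hpj hqj hpq
  obtain ⟨i, h1, h2, h3⟩ := exists_mism_of_clash hp hq hvp hvq hpq
  refine h3 (Finset.card_le_one.1 (hj i) _ (Finset.mem_erase.2 ⟨?_, h1⟩) _
    (Finset.mem_erase.2 ⟨?_, h2⟩))
  · exact fun h => hpj (by rw [← h])
  · exact fun h => hqj (by rw [← h])

/-- If one of the three columns belongs to all mismatch pairs, deleting it alone suffices. Otherwise
each of the three is avoided by some mismatch pair, which then consists of the other two. So the
literals of `v` on the three columns clash pairwise, as required of p, q, r. -/
theorem GoodOnThree.accepts {S : PMat n D} {v : Fin D → Bool} (h : GoodOnThree S v) :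
    Accepts S := by
  obtain ⟨J, hJ, hv⟩ := h
  by_cases hstar : ∃ t, ∀ i, (mism S v i).card = 2 → J t ∈ mism S v i
  · obtain ⟨t, ht⟩ := hstar
    refine GoodOutsideOne.accepts (v := v) ⟨J t, fun i => ?_⟩
    by_cases hi : (mism S v i).card = 2
    · rw [Finset.card_erase_of_mem (ht i hi), hi]
    · refine Finset.card_erase_le.trans ?_
      rcases hv i with h | h <;> omega
  · push Not at hstar
    have hrow : ∀ t, ∃ i, ∀ t', t' ≠ t → J t' ∈ mism S v i := by
      intro t
      obtain ⟨i, hi, hti⟩ := hstar t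
      refine ⟨i, fun t' ht' => ?_⟩
      have hsub : mism S v i ⊆ (Finset.univ.image J).erase (J t) := by
        intro x hx
        refine Finset.mem_erase.2 ⟨fun h => hti (h ▸ hx), ?_⟩
        rcases hv i with h | h
        · omega
        · exact h.1 hx
      have := Finset.eq_of_subset_of_card_le hsub (by
        rw [Finset.card_erase_of_mem (by simp), Finset.card_image_of_injective _ hJ, hi]
        simp)
      rw [this]
      exact Finset.mem_erase.2 ⟨fun h => ht' (hJ h), by simp⟩
    have hin : ∀ p q (hp : p < 2 * D) (hq : q < 2 * D), LitTrue v p → LitTrue v q → Clash S p q →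
        ⟨litVar D p, litVar_lt hp⟩ ∈ Finset.univ.image J ∧
          ⟨litVar D q, litVar_lt hq⟩ ∈ Finset.univ.image J := by
      intro p q hp hq hvp hvq hpq
      obtain ⟨i, h1, h2, h3⟩ := exists_mism_of_clash hp hq hvp hvq hpq
      rcases hv i with h | h
      · exact absurd (Finset.card_le_one.1 h _ h1 _ h2) h3
      · exact ⟨h.1 h1, h.1 h2⟩
    obtain ⟨i₀, hi₀⟩ := hrow 0
    obtain ⟨i₁, hi₁⟩ := hrow 1
    have h01 : J 0 ≠ J 1 := hJ.ne (by decide)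
    have h02 : J 0 ≠ J 2 := hJ.ne (by decide)
    have h12 : J 1 ≠ J 2 := hJ.ne (by decide)
    have hpr : Clash S (litOf v (J 0)) (litOf v (J 2)) :=
      clash_litOf h02 (hi₁ 0 (by decide)) (hi₁ 2 (by decide))
    have hqr : Clash S (litOf v (J 1)) (litOf v (J 2)) :=
      clash_litOf h12 (hi₀ 1 (by decide)) (hi₀ 2 (by decide))
    have htriple : ∀ k (hk : k < D), (⟨k, hk⟩ : Fin D) ∈ Finset.univ.image J →
        tripleMask D (litOf v (J 0)) (litOf v (J 1)) (litOf v (J 2)) k := by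
      intro k hk h
      obtain ⟨t, -, ht⟩ := Finset.mem_image.1 h
      simp only [tripleMask, litVar_litOf]
      have hk' : k = J t := by rw [ht]
      fin_cases t
      · exact Or.inl hk'
      · exact Or.inr (Or.inl hk')
      · exact Or.inr (Or.inr hk')
    -- The third column is in the pair mask because both of the first two literals clash with the
    -- literal of `v` on it.
    have hpair : ∀ k, tripleMask D (litOf v (J 0)) (litOf v (J 1)) (litOf v (J 2)) k →
        pairMask D (Clash S) (litOf v (J 0)) (litOf v (J 1)) k := by
      rintro k (h | h | h)
      · exact Or.inl h
      · exact Or.inr (Or.inl h)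
      · refine Or.inr (Or.inr ?_)
        rcases lit_cases (litOf_lt v (J 2)) with ⟨h', -⟩ | ⟨h', -⟩
        · left
          rw [h, ← h']
          exact ⟨hpr, hqr⟩
        · right
          rw [h, ← h']
          exact ⟨hpr, hqr⟩
    -- Clashes between literals that hold under `v` stay inside the triple. Hence a literal off the
    -- triple that clashes with a true literal is false.
    have hforced : ∀ p < 2 * D, LitTrue v p → ∀ q < 2 * D, Clash S p q →
        ¬ tripleMask D (litOf v (J 0)) (litOf v (J 1)) (litOf v (J 2)) (litVar D q) →
        LitTrue v (litNeg D q) := by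
      intro p hp hvp q hq hpq hqm
      rw [litTrue_litNeg hq]
      exact fun hvq => hqm (htriple _ (litVar_lt hq) (hin p q hp hq hvp hvq hpq).2)
    refine Or.inr ⟨litOf v (J 0), litOf_lt _ _, litOf v (J 1), litOf_lt _ _, ?_,
      ⟨LitTrue v, fun p hp _ => litTrue_litNeg hp, ?_⟩, litOf v (J 2), litOf_lt _ _, hpr, hqr,
      ⟨fun p => LitTrue v p ∧
        ¬ tripleMask D (litOf v (J 0)) (litOf v (J 1)) (litOf v (J 2)) (litVar D p),
        ?_, fun p _ h => h.2, ?_, ?_⟩, ?_⟩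
    · rw [litVar_litOf, litVar_litOf]
      exact fun h => h01 (Fin.ext h)
    · intro p hp q hq hvp hvq hpm _ hpq
      exact hpm (hpair _ (htriple _ (litVar_lt hp) (hin p q hp hq hvp hvq hpq).1))
    · rintro s hs ⟨hsm, h⟩
      refine ⟨?_, hsm⟩
      have hs' := litNeg_lt hs
      have hsm' := hsm
      rw [← litVar_litNeg hs] at hsm'
      rw [← litNeg_litNeg hs]
      rcases h with h | h | h
      · exact hforced _ (litOf_lt _ _) (litTrue_litOf _ _) _ hs' h hsm'
      · exact hforced _ (litOf_lt _ _) (litTrue_litOf _ _) _ hs' h hsm'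
      · exact hforced _ (litOf_lt _ _) (litTrue_litOf _ _) _ hs' h hsm'
    · intro p hp h q hq hpq hqm
      refine ⟨hforced p hp h.1 q hq hpq hqm, ?_⟩
      rwa [litVar_litNeg hq]
    · rintro k hk ⟨h1, h2⟩
      have := litTrue_litNeg (v := v) (p := k) (by omega)
      rw [litNeg_of_lt hk] at this
      exact this.1 h2.1 h1.1
    · rintro ⟨i, hi, h0, h1, h2⟩
      rw [hit_litOf (i := ⟨i, hi⟩)] at h0 h1 h2
      have hsub : {J 0, J 1, J 2} ⊆ mism S v ⟨i, hi⟩ := by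
        intro x hx
        simp only [Finset.mem_insert, Finset.mem_singleton] at hx
        rcases hx with rfl | rfl | rfl
        · exact h0
        · exact h1
        · exact h2
      have := Finset.card_le_card hsub
      rw [Finset.card_eq_three.2 ⟨_, _, _, h01, h02, h12, rfl⟩] at this
      rcases hv ⟨i, hi⟩ with h | h <;> omega

/-- The satisfiability test depends on p and q only and says nothing about the columns of the pair
mask. Off the triple, each such column is forced by p and hence decided by the seeds of the
propagation. So the propagated set and the model of the other columns combine to a model off the
triple, which is completed by p, q, r themselves. -/
theorem Accepts.exists_good {S : PMat n D} (h : Accepts S) :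
    ∃ v, GoodOutsideOne S v ∨ GoodOnThree S v := by
  rcases h with ⟨j, hj, T, hT⟩ | ⟨p, hp, q, hq, hpq, hsat, r, hr, hpr, hqr, ⟨P, hPs, -, hPc, hP⟩,
    hrow⟩
  · obtain ⟨v, hv⟩ := exists_litOf_iff (D := D) T
    refine ⟨v, Or.inl ⟨⟨j, hj⟩, fun i => Finset.card_le_one.2 fun a ha b hb => ?_⟩⟩
    by_contra hab
    rw [Finset.mem_erase] at ha hb
    have hm : ∀ c : Fin D, c ≠ ⟨j, hj⟩ → ¬ (c : ℕ) = j := fun c hc h => hc (Fin.ext h)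
    refine hT.2 _ (litOf_lt v a) _ (litOf_lt v b) (hT.litOf (hv a) (hm a ha.1))
      (hT.litOf (hv b) (hm b hb.1)) ?_ ?_ (clash_litOf hab ha.2 hb.2)
    · rw [litVar_litOf]
      exact hm a ha.1
    · rw [litVar_litOf]
      exact hm b hb.1
  · obtain ⟨T, hT, hPT⟩ := exists_model_of_closed (fun _ _ => Clash.symm) hPc hP hsat (by
      intro s hs hm hnm
      have hX : ∀ s' < 2 * D, litVar D s' = litVar D s → Clash S p s' → P (litNeg D s') := by
        intro s' hs' hss h
        refine hPs _ (litNeg_lt hs') ⟨?_, Or.inl ?_⟩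
        · rwa [litVar_litNeg hs', hss]
        · rwa [litNeg_litNeg hs']
      have hX' : ∀ s' < 2 * D, litVar D s' = litVar D s → Clash S p s' →
          P s ∨ P (litNeg D s) := by
        intro s' hs' hss h
        have := hX s' hs' hss h
        rcases eq_or_eq_litNeg hs hs' hss.symm with rfl | rfl
        · exact Or.inr this
        · rw [litNeg_litNeg hs] at this
          exact Or.inl this
      have hlt := litVar_lt hs
      rcases hm with h | h | h | h
      · exact absurd (Or.inl h) hnm
      · exact absurd (Or.inr (Or.inl h)) hnm
      · exact hX' _ (by omega) (litVar_of_lt hlt) h.1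
      · exact hX' _ (by omega) (litVar_add _) h.1)
    have hprv : litVar D p ≠ litVar D r := hpr.1
    have hqrv : litVar D q ≠ litVar D r := hqr.1
    -- The center makes p, q, r true on their columns and follows `T` everywhere else.
    obtain ⟨v, hv⟩ := exists_litOf_iff (D := D) fun s =>
      (tripleMask D p q r (litVar D s) ∧ (s = p ∨ s = q ∨ s = r)) ∨
        (¬ tripleMask D p q r (litVar D s) ∧ T s)
    simp only [litVar_add] at hv
    have hvT : ∀ j : Fin D, ¬ tripleMask D p q r j → T (litOf v j) := by
      intro j hj
      have := hv j
      simp only [hj, not_false_eq_true, false_and, true_and, false_or] at this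
      exact hT.litOf this hj
    have hvJ : ∀ j : Fin D, tripleMask D p q r j →
        litOf v j = p ∨ litOf v j = q ∨ litOf v j = r := by
      intro j hj
      have := hv j
      simp only [hj, not_true_eq_false, false_and, true_and, or_false] at this
      unfold litOf
      split_ifs with h
      · exact this.2 h
      · rw [← this, not_or, not_or] at h
        unfold tripleMask litVar at hj
        unfold litVar at hpq hprv hqrv
        split_ifs at hj hpq hprv hqrv <;> omega
    -- no clash with a literal outside of the triple
    have hno : ∀ a b : Fin D, a ≠ b → ¬ tripleMask D p q r b →
        ¬ Clash S (litOf v a) (litOf v b) := by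
      intro a b hab hb hcl
      have hbm : ¬ tripleMask D p q r (litVar D (litOf v b)) := by rwa [litVar_litOf]
      by_cases ha : tripleMask D p q r a
      · have hneg : T (litNeg D (litOf v b)) := by
          refine hPT _ (litNeg_lt (litOf_lt v b)) (hPs _ (litNeg_lt (litOf_lt v b)) ⟨?_, ?_⟩)
          · rwa [litVar_litNeg (litOf_lt v b)]
          · rw [litNeg_litNeg (litOf_lt v b)]
            rcases hvJ a ha with h | h | h <;> rw [h] at hcl
            · exact Or.inl hcl
            · exact Or.inr (Or.inl hcl)
            · exact Or.inr (Or.inr hcl)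
        exact (hT.1 _ (litOf_lt v b) hbm).1 hneg (hvT b hb)
      · exact hT.2 _ (litOf_lt v a) _ (litOf_lt v b) (hvT a ha) (hvT b hb)
          (by rwa [litVar_litOf]) hbm hcl
    refine ⟨v, Or.inr ⟨![⟨_, litVar_lt hp⟩, ⟨_, litVar_lt hq⟩, ⟨_, litVar_lt hr⟩],
      injective_three (fun h => hpq (Fin.mk.inj h)) (fun h => hprv (Fin.mk.inj h))
        (fun h => hqrv (Fin.mk.inj h)), fun i => ?_⟩⟩
    rw [image_three]
    by_cases hout : ∃ b ∈ mism S v i, ¬ tripleMask D p q r (b : ℕ)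
    · left
      obtain ⟨b, hb, hbm⟩ := hout
      have hall : ∀ a ∈ mism S v i, a = b := by
        intro a ha
        by_contra hab
        exact hno a b hab hbm (clash_litOf hab ha hb)
      exact Finset.card_le_one.2 fun a ha c hc => (hall a ha).trans (hall c hc).symm
    · right
      push Not at hout
      have hsub : mism S v i ⊆ {⟨_, litVar_lt hp⟩, ⟨_, litVar_lt hq⟩, ⟨_, litVar_lt hr⟩} := by
        intro x hx
        simp only [Finset.mem_insert, Finset.mem_singleton, Fin.ext_iff]
        exact hout x hx
      refine ⟨hsub, ?_⟩
      by_contra! hcard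
      have hthree : ({⟨_, litVar_lt hp⟩, ⟨_, litVar_lt hq⟩, ⟨_, litVar_lt hr⟩} :
          Finset (Fin D)).card ≤ 3 := Finset.card_le_three
      have heq := Finset.eq_of_subset_of_card_le hsub (by omega)
      have hhit : ∀ s (hs : s < 2 * D), (s = p ∨ s = q ∨ s = r) → Hit S i s := by
        intro s hs hs'
        have hm : tripleMask D p q r (litVar D s) := by
          rcases hs' with rfl | rfl | rfl
          · exact Or.inl rfl
          · exact Or.inr (Or.inl rfl)
          · exact Or.inr (Or.inr rfl)
        have hl := hvJ ⟨litVar D s, litVar_lt hs⟩ hm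
        have hl' := litVar_litOf v ⟨litVar D s, litVar_lt hs⟩
        have hsl : litOf v ⟨litVar D s, litVar_lt hs⟩ = s := by
          rcases hs' with rfl | rfl | rfl <;> rcases hl with h | h | h <;> rw [h] at hl' ⊢ <;>
            simp only at hl' <;> omega
        rw [← hsl, hit_litOf, heq]
        simp only [Finset.mem_insert, Finset.mem_singleton, Fin.ext_iff]
        exact hm
      exact hrow ⟨i, i.2, hhit p hp (by simp), hhit q hq (by simp), hhit r hr (by simp)⟩

theorem isYes_iff_accepts {S : PMat n D} (hD : 14 ≤ D) (hd : ∀ j, IsDirty S j) :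
    IsYes 0 3 S ↔ Accepts S := by
  rw [isYes_iff_exists_good hD hd]
  constructor
  · rintro ⟨v, hv | hv⟩
    · exact hv.accepts
    · exact hv.accepts
  · exact fun h => h.exists_good

/-- A yes-instance with `n` rows has at most `3 * n` dirty columns. -/
theorem le_three_mul_of_isYes {S : PMat n D} (hn : 0 < n) (hd : ∀ j, IsDirty S j)
    (h : IsYes 0 3 S) : D ≤ 3 * n := by
  obtain ⟨T, hST, hT⟩ := isYes_zero_three_iff.1 h
  have hcov : (Finset.univ : Finset (Fin D)) ⊆
      Finset.univ.biUnion fun i => diffSet (toPartial (T i)) (toPartial (T ⟨0, hn⟩)) := by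
    intro j _
    obtain ⟨i, hi⟩ := exists_mem_diffSet (fun j => hST.isDirty (hd j)) ⟨0, hn⟩ j
    exact Finset.mem_biUnion.2 ⟨i, Finset.mem_univ _, hi⟩
  have h1 := (Finset.card_le_card hcov).trans
    (Finset.card_biUnion_le_card_mul _ _ 3 fun i _ => hT i _)
  rw [Finset.card_univ, Finset.card_univ, Fintype.card_fin, Fintype.card_fin] at h1
  omega

end Acceptance

end DMC

namespace DMC

/-! ### A program logic for the word RAM

Registers below `64` hold the variables of a program, and the registers from `64` on are used to
evaluate expressions. -/

section Machine

/-- Expressions. `reg x` is the content of register `x`. -/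
inductive Exp where
  | reg (x : ℕ)
  | const (c : ℕ)
  | add (a b : Exp)
  | sub (a b : Exp)
  | mul (a b : Exp)
  | load (r : ℕ) (a : Exp)
  | read (a b : Exp)
  | lt (a b : Exp)
  | eq (a b : Exp)
  | cond (c a b : Exp)

namespace Exp

def eval (M : ℕ → ℕ → ℕ) (s : State) : Exp → ℕ
  | reg x => s.reg x
  | const c => c
  | add a b => a.eval M s + b.eval M s
  | sub a b => a.eval M s - b.eval M s
  | mul a b => a.eval M s * b.eval M s
  | load r a => s.arr r (a.eval M s)
  | read a b => M (a.eval M s) (b.eval M s)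
  | lt a b => if a.eval M s < b.eval M s then 1 else 0
  | eq a b => if a.eval M s = b.eval M s then 1 else 0
  | cond c a b => if c.eval M s = 0 then b.eval M s else a.eval M s

/-- The expression only uses variables, and all intermediate results fit into a word. -/
def Ok (W : ℕ) (M : ℕ → ℕ → ℕ) (s : State) : Exp → Prop
  | reg x => x < 64
  | const c => c ≤ W
  | add a b => a.Ok W M s ∧ b.Ok W M s ∧ a.eval M s + b.eval M s ≤ W
  | sub a b => a.Ok W M s ∧ b.Ok W M s
  | mul a b => a.Ok W M s ∧ b.Ok W M s ∧ a.eval M s * b.eval M s ≤ W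
  | load _ a => a.Ok W M s
  | read a b => a.Ok W M s ∧ b.Ok W M s
  | lt a b => a.Ok W M s ∧ b.Ok W M s ∧ 1 ≤ W
  | eq a b => a.Ok W M s ∧ b.Ok W M s ∧ 1 ≤ W
  | cond c a b => c.Ok W M s ∧ a.Ok W M s ∧ b.Ok W M s

/-- Evaluates the expression into register `k`, using only registers from `k` on. -/
def compile : ℕ → Exp → Prog
  | k, reg x => .copy k x
  | k, const c => .const k c
  | k, add a b => .seq (compile k a) (.seq (compile (k + 1) b) (.add k k (k + 1)))
  | k, sub a b => .seq (compile k a) (.seq (compile (k + 1) b) (.sub k k (k + 1)))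
  | k, mul a b => .seq (compile k a) (.seq (compile (k + 1) b) (.mul k k (k + 1)))
  | k, load r a => .seq (compile k a) (.load k r k)
  | k, read a b => .seq (compile k a) (.seq (compile (k + 1) b) (.read k k (k + 1)))
  | k, lt a b => .seq (compile k a) (.seq (compile (k + 1) b)
      (.ite (.lt k (k + 1)) (.const k 1) (.const k 0)))
  | k, eq a b => .seq (compile k a) (.seq (compile (k + 1) b)
      (.ite (.eq k (k + 1)) (.const k 1) (.const k 0)))
  | k, cond c a b => .seq (compile k c) (.seq (.const (k + 1) 0)
      (.ite (.eq k (k + 1)) (compile k b) (compile k a)))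

/-- Both branches of a conditional are charged, so the bound does not depend on the state. -/
def cost : Exp → ℕ
  | reg _ => 1
  | const _ => 1
  | add a b => a.cost + (b.cost + 1)
  | sub a b => a.cost + (b.cost + 1)
  | mul a b => a.cost + (b.cost + 1)
  | load _ a => a.cost + 1
  | read a b => a.cost + (b.cost + 1)
  | lt a b => a.cost + (b.cost + 2)
  | eq a b => a.cost + (b.cost + 2)
  | cond c a b => c.cost + (1 + (a.cost + b.cost + 1))

end Exp

/-- Two states agree on the variables and on the arrays. -/
def Sim (s s' : State) : Prop := s'.arr = s.arr ∧ ∀ x < 64, s'.reg x = s.reg x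

theorem Sim.refl (s : State) : Sim s s := ⟨rfl, fun _ _ => rfl⟩

@[simp] theorem State.reg_setReg (s : State) (x v y : ℕ) :
    (s.setReg x v).reg y = if y = x then v else s.reg y := by
  simp [State.setReg, Function.update_apply]

@[simp] theorem State.arr_setReg (s : State) (x v : ℕ) : (s.setReg x v).arr = s.arr := rfl

@[simp] theorem State.reg_setArr (s : State) (a x v : ℕ) : (s.setArr a x v).reg = s.reg := rfl

@[simp] theorem State.arr_setArr (s : State) (a x v b y : ℕ) :
    (s.setArr a x v).arr b y = if b = a ∧ y = x then v else s.arr b y := by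
  simp only [State.setArr, Function.update_apply]
  by_cases h : b = a
  · subst h
    by_cases h' : y = x <;> simp [h']
  · simp [h]

variable {W : ℕ} {M : ℕ → ℕ → ℕ}

/-- The result of evaluating an expression into register `k`. -/
def EvalPost (k v : ℕ) (s s' : State) : Prop :=
  s'.arr = s.arr ∧ (∀ x < k, s'.reg x = s.reg x) ∧ s'.reg k = v

theorem EvalPost.sim {k v : ℕ} {s s₀ s' : State} (hk : 64 ≤ k) (hs : Sim s s₀)
    (h : EvalPost k v s₀ s') : Sim s s' :=
  ⟨h.1.trans hs.1, fun x hx => (h.2.1 x (by omega)).trans (hs.2 x hx)⟩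

/-- The value of the first operand stays in register `k`, since the second is evaluated from
register `k + 1` on. -/
theorem exec_binary {k : ℕ} {p q o : Prog} {u v w tp tq t : ℕ} {s₀ : State}
    (hp : ∃ s' t', Exec W M p s₀ s' t' ∧ t' ≤ tp ∧ EvalPost k u s₀ s')
    (hq : ∀ s₁, EvalPost k u s₀ s₁ →
      ∃ s' t', Exec W M q s₁ s' t' ∧ t' ≤ tq ∧ EvalPost (k + 1) v s₁ s')
    (ho : ∀ s₂ : State, s₂.reg k = u → s₂.reg (k + 1) = v → ∃ t', Exec W M o s₂ (s₂.setReg k w) t' ∧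
      t' ≤ t) :
    ∃ s' t', Exec W M (.seq p (.seq q o)) s₀ s' t' ∧ t' ≤ tp + (tq + t) ∧ EvalPost k w s₀ s' := by
  obtain ⟨s₁, t₁, h1, ht1, hs1⟩ := hp
  obtain ⟨s₂, t₂, h2, ht2, hs2⟩ := hq s₁ hs1
  obtain ⟨t₃, h3, ht3⟩ := ho s₂ ((hs2.2.1 k (by omega)).trans hs1.2.2) hs2.2.2
  refine ⟨_, _, .seq h1 (.seq h2 h3), by omega, ?_, ?_, ?_⟩
  · exact hs2.1.trans hs1.1
  · intro x hx
    rw [State.reg_setReg, if_neg (by omega), hs2.2.1 x (by omega), hs1.2.1 x hx]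
  · simp

/-- The expression is evaluated in `s` but executed from any `s₀` that agrees with it on variables
and arrays. This freedom makes the induction go through, because evaluating the first operand
changes scratch registers. -/
theorem exec_compile (e : Exp) {k : ℕ} (hk : 64 ≤ k) {s s₀ : State} (hs : Sim s s₀)
    (he : e.Ok W M s) :
    ∃ s' t, Exec W M (e.compile k) s₀ s' t ∧ t ≤ e.cost ∧ EvalPost k (e.eval M s) s₀ s' := by
  induction e generalizing k s₀ with
  | reg x =>
    refine ⟨_, _, .copy, le_rfl, rfl, fun y hy => ?_, ?_⟩
    · rw [State.reg_setReg, if_neg (by omega)]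
    · rw [State.reg_setReg, if_pos rfl]
      exact hs.2 x he
  | const c =>
    refine ⟨_, _, .const he, le_rfl, rfl, fun y hy => ?_, ?_⟩
    · rw [State.reg_setReg, if_neg (by omega)]
    · rw [State.reg_setReg, if_pos rfl]
      rfl
  | add a b iha ihb =>
    refine exec_binary (iha hk hs he.1) (fun s₁ h₁ => ihb (by omega) (h₁.sim hk hs) he.2.1)
      fun s₂ hu hv => ⟨1, ?_, le_rfl⟩
    have := Exec.add (W := W) (M := M) (s := s₂) (x := k) (y := k) (z := k + 1)
    rw [hu, hv] at this
    exact this he.2.2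
  | sub a b iha ihb =>
    refine exec_binary (iha hk hs he.1) (fun s₁ h₁ => ihb (by omega) (h₁.sim hk hs) he.2)
      fun s₂ hu hv => ⟨1, ?_, le_rfl⟩
    have := Exec.sub (W := W) (M := M) (s := s₂) (x := k) (y := k) (z := k + 1)
    rw [hu, hv] at this
    exact this
  | mul a b iha ihb =>
    refine exec_binary (iha hk hs he.1) (fun s₁ h₁ => ihb (by omega) (h₁.sim hk hs) he.2.1)
      fun s₂ hu hv => ⟨1, ?_, le_rfl⟩
    have := Exec.mul (W := W) (M := M) (s := s₂) (x := k) (y := k) (z := k + 1)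
    rw [hu, hv] at this
    exact this he.2.2
  | load r a iha =>
    obtain ⟨s₁, t₁, h1, ht1, hs1⟩ := iha hk hs he
    refine ⟨_, _, .seq h1 .load, by simp only [Exp.cost]; omega, hs1.1, fun x hx => ?_, ?_⟩
    · rw [State.reg_setReg, if_neg (by omega), hs1.2.1 x hx]
    · rw [State.reg_setReg, if_pos rfl, hs1.1, hs.1, hs1.2.2]
      rfl
  | read a b iha ihb =>
    refine exec_binary (iha hk hs he.1) (fun s₁ h₁ => ihb (by omega) (h₁.sim hk hs) he.2)
      fun s₂ hu hv => ⟨1, ?_, le_rfl⟩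
    have := Exec.read (W := W) (M := M) (s := s₂) (x := k) (y := k) (z := k + 1)
    rw [hu, hv] at this
    exact this
  | lt a b iha ihb =>
    refine exec_binary (iha hk hs he.1) (fun s₁ h₁ => ihb (by omega) (h₁.sim hk hs) he.2.1)
      fun s₂ hu hv => ⟨2, ?_, le_rfl⟩
    simp only [Exp.eval]
    split_ifs with h
    · exact .iteTrue (by simpa [Test.Holds, hu, hv] using h) (.const he.2.2)
    · exact .iteFalse (by simpa [Test.Holds, hu, hv] using h) (.const (Nat.zero_le _))
  | eq a b iha ihb =>
    refine exec_binary (iha hk hs he.1) (fun s₁ h₁ => ihb (by omega) (h₁.sim hk hs) he.2.1)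
      fun s₂ hu hv => ⟨2, ?_, le_rfl⟩
    simp only [Exp.eval]
    split_ifs with h
    · exact .iteTrue (by simpa [Test.Holds, hu, hv] using h) (.const he.2.2)
    · exact .iteFalse (by simpa [Test.Holds, hu, hv] using h) (.const (Nat.zero_le _))
  | cond c a b ihc iha ihb =>
    obtain ⟨s₁, t₁, h1, ht1, hs1⟩ := ihc hk hs he.1
    set s₂ := s₁.setReg (k + 1) 0 with hs₂
    have hk2 : s₂.reg k = c.eval M s := by
      rw [hs₂, State.reg_setReg, if_neg (by omega), hs1.2.2]
    have hk3 : s₂.reg (k + 1) = 0 := by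
      rw [hs₂, State.reg_setReg, if_pos rfl]
    have hsim : Sim s s₂ := by
      refine ⟨(hs1.sim hk hs).1, fun x hx => ?_⟩
      rw [hs₂, State.reg_setReg, if_neg (by omega)]
      exact (hs1.sim hk hs).2 x hx
    have hpost : ∀ v s₃, EvalPost k v s₂ s₃ → EvalPost k v s₀ s₃ := by
      intro v s₃ h
      refine ⟨h.1.trans hs1.1, fun x hx => ?_, h.2.2⟩
      rw [h.2.1 x hx, hs₂, State.reg_setReg, if_neg (by omega), hs1.2.1 x hx]
    simp only [Exp.eval, Exp.cost]
    by_cases h : c.eval M s = 0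
    · obtain ⟨s₃, t₃, h3, ht3, hs3⟩ := ihb hk hsim he.2.2
      refine ⟨s₃, _, .seq h1 (.seq (.const (Nat.zero_le _)) (.iteTrue ?_ h3)), by omega, ?_⟩
      · change s₂.reg k = s₂.reg (k + 1)
        rw [hk2, hk3, h]
      · rw [if_pos h]
        exact hpost _ _ hs3
    · obtain ⟨s₃, t₃, h3, ht3, hs3⟩ := iha hk hsim he.2.1
      refine ⟨s₃, _, .seq h1 (.seq (.const (Nat.zero_le _)) (.iteFalse ?_ h3)), by omega, ?_⟩
      · change ¬ s₂.reg k = s₂.reg (k + 1)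
        rwa [hk2, hk3]
      · rw [if_neg h]
        exact hpost _ _ hs3

/-- From every state that agrees with `s`, the program halts within `t` steps in a state that
agrees with one satisfying `Q`. -/
def Runs (W : ℕ) (M : ℕ → ℕ → ℕ) (p : Prog) (s : State) (t : ℕ) (Q : State → Prop) : Prop :=
  ∀ s₀, Sim s s₀ → ∃ s₁ s' t', Exec W M p s₀ s₁ t' ∧ t' ≤ t ∧ Sim s' s₁ ∧ Q s'

/-- `x := e` -/
def assign (x : ℕ) (e : Exp) : Prog := .seq (e.compile 64) (.copy x 64)

/-- `a[i] := e` -/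
def put (a : ℕ) (i e : Exp) : Prog :=
  .seq (i.compile 64) (.seq (e.compile 65) (.store a 64 65))

/-- `if e ≠ 0 then p else q` -/
def cond (e : Exp) (p q : Prog) : Prog :=
  .seq (e.compile 64) (.seq (.const 65 0) (.ite (.eq 64 65) q p))

def skip : Prog := .copy 64 64

/-- `for x = 0, 1, …` while `x` is less than the content of register `N` -/
def forUpto (x N : ℕ) (body : Prog) : Prog :=
  .seq (assign x (.const 0))
    (.while (.lt x N) (.seq body (assign x (.add (.reg x) (.const 1)))))

theorem Runs.mono {p : Prog} {s : State} {t t' : ℕ} {Q Q' : State → Prop}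
    (h : Runs W M p s t Q) (ht : t ≤ t') (hQ : ∀ s', Q s' → Q' s') : Runs W M p s t' Q' := by
  intro s₀ hs
  obtain ⟨s₁, s', t₁, h1, h2, h3, h4⟩ := h s₀ hs
  exact ⟨s₁, s', t₁, h1, h2.trans ht, h3, hQ _ h4⟩

theorem Runs.seq {p q : Prog} {s : State} {t t' : ℕ} {Q : State → Prop}
    (h : Runs W M p s t fun s' => Runs W M q s' t' Q) : Runs W M (.seq p q) s (t + t') Q := by
  intro s₀ hs
  obtain ⟨s₁, s', t₁, h1, h2, h3, h4⟩ := h s₀ hs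
  obtain ⟨s₂, s'', t₂, h5, h6, h7, h8⟩ := h4 s₁ h3
  exact ⟨s₂, s'', _, .seq h1 h5, by omega, h7, h8⟩

theorem Runs.skip {s : State} {Q : State → Prop} (h : Q s) : Runs W M skip s 1 Q := by
  intro s₀ hs
  refine ⟨_, s, _, .copy, le_rfl, ⟨hs.1, fun x hx => ?_⟩, h⟩
  rw [State.reg_setReg, if_neg (by omega), hs.2 x hx]

theorem Runs.assign {x t : ℕ} {e : Exp} {s : State} {Q : State → Prop} (ht : e.cost + 1 ≤ t)
    (he : e.Ok W M s) (h : Q (s.setReg x (e.eval M s))) : Runs W M (assign x e) s t Q := by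
  intro s₀ hs
  obtain ⟨s₁, t₁, h1, h2, h3⟩ := exec_compile e le_rfl hs he
  refine ⟨_, s.setReg x (e.eval M s), _, .seq h1 .copy, by omega,
    ⟨h3.1.trans hs.1, fun y hy => ?_⟩, h⟩
  rw [State.reg_setReg, State.reg_setReg, h3.2.2, h3.2.1 y hy, hs.2 y hy]

theorem Runs.put {a t : ℕ} {i e : Exp} {s : State} {Q : State → Prop}
    (ht : i.cost + (e.cost + 1) ≤ t) (hi : i.Ok W M s) (he : e.Ok W M s)
    (h : Q (s.setArr a (i.eval M s) (e.eval M s))) :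
    Runs W M (put a i e) s t Q := by
  intro s₀ hs
  obtain ⟨s₁, t₁, h1, h2, h3⟩ := exec_compile i le_rfl hs hi
  have hs1 := h3.sim le_rfl hs
  obtain ⟨s₂, t', h4, h5, h6⟩ := exec_compile e (k := 65) (by omega) hs1 he
  have hs2 := h6.sim (by omega) hs1
  refine ⟨_, _, _, .seq h1 (.seq h4 .store), by omega, ⟨?_, ?_⟩, h⟩
  · rw [h6.2.2, h6.2.1 64 (by omega), h3.2.2]
    simp only [State.setArr, hs2.1]
  · exact hs2.2

theorem Runs.cond {e : Exp} {p q : Prog} {s : State} {t t' : ℕ} {Q : State → Prop}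
    (ht : e.cost + (t + 2) ≤ t') (he : e.Ok W M s)
    (hp : e.eval M s ≠ 0 → Runs W M p s t Q) (hq : e.eval M s = 0 → Runs W M q s t Q) :
    Runs W M (cond e p q) s t' Q := by
  intro s₀ hs
  obtain ⟨s₁, t₁, h1, h2, h3⟩ := exec_compile e le_rfl hs he
  have hsim : Sim s (s₁.setReg 65 0) := by
    refine ⟨(h3.sim le_rfl hs).1, fun x hx => ?_⟩
    rw [State.reg_setReg, if_neg (by omega), (h3.sim le_rfl hs).2 x hx]
  have hk : (s₁.setReg 65 0).reg 64 = e.eval M s := by simpa using h3.2.2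
  have hk' : (s₁.setReg 65 0).reg 65 = 0 := by simp
  by_cases h : e.eval M s = 0
  · obtain ⟨s₂, s', t₂, h4, h5, h6⟩ := hq h _ hsim
    refine ⟨s₂, s', _, .seq h1 (.seq (.const (Nat.zero_le _)) (.iteTrue ?_ h4)), by omega, h6⟩
    change (s₁.setReg 65 0).reg 64 = (s₁.setReg 65 0).reg 65
    rw [hk, hk', h]
  · obtain ⟨s₂, s', t₂, h4, h5, h6⟩ := hp h _ hsim
    refine ⟨s₂, s', _, .seq h1 (.seq (.const (Nat.zero_le _)) (.iteFalse ?_ h4)), by omega, h6⟩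
    change ¬ (s₁.setReg 65 0).reg 64 = (s₁.setReg 65 0).reg 65
    rwa [hk, hk']

/-- `I i` describes the state in which the counter is `i`. Each round costs four steps for the
increment and one for the test besides the body; the initialization and the last test add three. -/
theorem Runs.forUpto {x N m t : ℕ} {body : Prog} {s : State} {Q : State → Prop}
    (I : ℕ → State → Prop) (hx : x < 64) (hN : N < 64) (hm : m + 1 ≤ W)
    (hI : ∀ i s', I i s' → s'.reg N = m) (h0 : I 0 (s.setReg x 0))
    (hstep : ∀ i < m, ∀ s', I i s' → s'.reg x = i →
      Runs W M body s' t fun s'' => s''.reg x = i ∧ I (i + 1) (s''.setReg x (i + 1)))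
    (hQ : ∀ s', I m s' → s'.reg x = m → Q s') :
    Runs W M (forUpto x N body) s (m * (t + 5) + 3) Q := by
  have hloop : ∀ d i s', m = i + d → I i s' → s'.reg x = i →
      Runs W M (.while (.lt x N) (.seq body (DMC.assign x (.add (.reg x) (.const 1))))) s'
        (d * (t + 5) + 1) Q := by
    intro d
    induction d with
    | zero =>
      intro i s' hi hIs hxs s₀ hs₀
      obtain rfl : m = i := hi
      refine ⟨s₀, s', _, .whileFalse ?_, by omega, hs₀, hQ s' hIs hxs⟩
      change ¬ s₀.reg x < s₀.reg N
      rw [hs₀.2 x hx, hs₀.2 N hN, hxs, hI _ _ hIs]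
      omega
    | succ d ih =>
      intro i s' hi hIs hxs s₀ hs₀
      have hbody : Runs W M (.seq body (DMC.assign x (.add (.reg x) (.const 1)))) s' (t + 4)
          fun s'' => I (i + 1) s'' ∧ s''.reg x = i + 1 := by
        refine (Runs.seq (t' := 4) ((hstep i (by omega) s' hIs hxs).mono le_rfl ?_))
        rintro s'' ⟨hx'', hI''⟩
        refine Runs.assign le_rfl ⟨hx, ?_, ?_⟩ ?_
        · change 1 ≤ W
          omega
        · simp only [Exp.eval, hx'']
          omega
        · simp only [Exp.eval, hx'']
          exact ⟨hI'', by simp⟩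
      obtain ⟨s₁, s'', t₁, h1, h2, h3, h4, h5⟩ := hbody s₀ hs₀
      obtain ⟨s₂, s''', t₂, h6, h7, h8, h9⟩ := ih (i + 1) s'' (by omega) h4 h5 s₁ h3
      refine ⟨s₂, s''', _, .whileTrue ?_ h1 h6, ?_, h8, h9⟩
      · change s₀.reg x < s₀.reg N
        rw [hs₀.2 x hx, hs₀.2 N hN, hxs, hI _ _ hIs]
        omega
      · rw [Nat.succ_mul]
        omega
  refine (Runs.seq (t := 2) (t' := m * (t + 5) + 1) (Runs.assign le_rfl (Nat.zero_le _) ?_)).mono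
    (by omega) fun _ h => h
  exact hloop m 0 _ (by omega) h0 (by simp [Exp.eval])

open Classical in
/-- The truth value of a proposition. -/
noncomputable def ind (φ : Prop) : ℕ := if φ then 1 else 0

theorem ind_of {φ : Prop} (h : φ) : ind φ = 1 := if_pos h

theorem ind_of_not {φ : Prop} (h : ¬ φ) : ind φ = 0 := if_neg h

theorem ind_le_one (φ : Prop) : ind φ ≤ 1 := by
  unfold ind
  split_ifs <;> omega

theorem ind_ne_zero_iff {φ : Prop} : ind φ ≠ 0 ↔ φ := by
  unfold ind
  split_ifs with h <;> simp [h]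

theorem ind_eq_zero_iff {φ : Prop} : ind φ = 0 ↔ ¬ φ := by
  unfold ind
  split_ifs with h <;> simp [h]

theorem ind_congr {φ ψ : Prop} (h : φ ↔ ψ) : ind φ = ind ψ := by
  rw [propext h]

theorem ite_eq_ind (φ : Prop) [Decidable φ] : (if φ then 1 else 0) = ind φ := by
  unfold ind
  congr

theorem one_sub_ind (φ : Prop) : 1 - ind φ = ind (¬ φ) := by
  unfold ind
  split_ifs <;> rfl

theorem ind_mul_ind (φ ψ : Prop) : ind φ * ind ψ = ind (φ ∧ ψ) := by
  unfold ind
  split_ifs <;> simp_all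

/-- Registers below `k` and arrays below `a` are unchanged. -/
def Frame (k a : ℕ) (s s' : State) : Prop :=
  (∀ x < k, s'.reg x = s.reg x) ∧ ∀ b < a, s'.arr b = s.arr b

theorem Frame.refl (k a : ℕ) (s : State) : Frame k a s s := ⟨fun _ _ => rfl, fun _ _ => rfl⟩

theorem Frame.trans {k a k' a' : ℕ} {s s' s'' : State} (h : Frame k a s s')
    (h' : Frame k' a' s' s'') (hk : k ≤ k') (ha : a ≤ a') : Frame k a s s'' :=
  ⟨fun x hx => (h'.1 x (by omega)).trans (h.1 x hx),
    fun b hb => (h'.2 b (by omega)).trans (h.2 b hb)⟩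

theorem Frame.setReg {k a x v : ℕ} {s s' : State} (h : Frame k a s s') (hx : k ≤ x) :
    Frame k a s (s'.setReg x v) := by
  refine ⟨fun y hy => ?_, h.2⟩
  rw [State.reg_setReg, if_neg (by omega), h.1 y hy]

theorem Frame.mono {k a k' a' : ℕ} {s s' : State} (h : Frame k' a' s s') (hk : k ≤ k')
    (ha : a ≤ a') : Frame k a s s' := (Frame.refl k a s).trans h hk ha

/-- The program computes `v` into register `k`. Registers below `k` and arrays below `a` are
unchanged. -/
def Computes (W : ℕ) (M : ℕ → ℕ → ℕ) (k a : ℕ) (p : Prog) (s : State) (t v : ℕ) : Prop :=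
  Runs W M p s t fun s' => Frame k a s s' ∧ s'.reg k = v

theorem computes_assign {k a : ℕ} {e : Exp} {s : State} {t v : ℕ} (ht : e.cost + 1 ≤ t)
    (he : e.Ok W M s) (h : e.eval M s = v) : Computes W M k a (assign k e) s t v :=
  Runs.assign ht he ⟨(Frame.refl k a s).setReg le_rfl, by simp [h]⟩

/-- Register `k` becomes `1` if the body computes a nonzero value for some value of the counter
`k` below the content of register `N`. -/
def existsLoop (k N : ℕ) (body : Prog) : Prog :=
  .seq (assign (k + 1) (.const 0)) (.seq
    (forUpto k N (.seq body (assign (k + 1) (.cond (.reg (k + 2)) (.const 1) (.reg (k + 1))))))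
    (assign k (.reg (k + 1))))

/-- Register `k + 1` accumulates the answer and register `k + 2` receives the verdict of the body. A
witness does not end the loop but only keeps the accumulator at `1`. -/
theorem computes_existsLoop {k a N m t : ℕ} {body : Prog} {s : State} {φ : ℕ → Prop}
    (hk : k + 2 < 64) (hN : N < k) (hm : m + 1 ≤ W) (hs : s.reg N = m)
    (hbody : ∀ i < m, ∀ s', Frame k a s s' → s'.reg k = i →
      Computes W M (k + 2) a body s' t (ind (φ i))) :
    Computes W M k a (existsLoop k N body) s (m * (t + 12) + 7) (ind (∃ i < m, φ i)) := by
  refine (Runs.seq (t := 2) (t' := m * (t + 12) + 3 + 2) (Runs.assign le_rfl (Nat.zero_le _)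
    (Runs.seq (Runs.forUpto (t := t + 7)
      (fun i s' => Frame k a s s' ∧ s'.reg (k + 1) = ind (∃ j < i, φ j)) (m := m)
      (by omega) (by omega) hm ?_ ⟨?_, ?_⟩ ?_ ?_)))).mono (by omega) fun _ h => h
  · intro i s' h
    rw [h.1.1 N hN, hs]
  · exact ((Frame.refl k a s).setReg (by omega)).setReg le_rfl
  · rw [ind_of_not (by simp)]
    simp [Exp.eval]
  · rintro i hi s' ⟨hf, hacc⟩ hx
    refine (Runs.seq (t' := 7) ((hbody i hi s' hf hx).mono le_rfl ?_)).mono (by omega)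
      fun _ h => h
    rintro s₁ ⟨hf₁, hv⟩
    refine Runs.assign (by simp [Exp.cost]) ⟨?_, ?_, ?_⟩ ⟨?_, ?_, ?_⟩
    · change k + 2 < 64
      omega
    · change 1 ≤ W
      omega
    · change k + 1 < 64
      omega
    · rw [State.reg_setReg, if_neg (by omega), hf₁.1 k (by omega), hx]
    · exact ((hf.trans hf₁ (by omega) le_rfl).setReg (by omega)).setReg le_rfl
    · rw [State.reg_setReg, if_neg (by omega), State.reg_setReg, if_pos rfl]
      have hacc₁ := (hf₁.1 (k + 1) (by omega)).trans hacc
      by_cases h : φ i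
      · rw [ind_of h] at hv
        simp only [Exp.eval, hv, one_ne_zero, if_false]
        rw [ind_of ⟨i, by omega, h⟩]
      · rw [ind_of_not h] at hv
        simp only [Exp.eval, hv, hacc₁, if_true]
        refine ind_congr ⟨fun ⟨j, hj, hφ⟩ => ⟨j, by omega, hφ⟩, fun ⟨j, hj, hφ⟩ => ⟨j, ?_, hφ⟩⟩
        rcases Nat.lt_succ_iff_lt_or_eq.1 hj with hj | rfl
        · exact hj
        · exact absurd hφ h
  · rintro s' ⟨hf, hacc⟩ -
    refine Runs.assign le_rfl (by change k + 1 < 64; omega) ⟨hf.setReg le_rfl, ?_⟩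
    simpa [Exp.eval] using hacc

/-- `a[i] := e` for all `i` below the content of register `N`; `i` is the counter `k`. -/
def fill (k N a : ℕ) (e : Exp) : Prog := forUpto k N (put a (.reg k) e)

/-- At round `i` cell `i` still has its old content, so `e` may refer to it. Unit propagation relies
on this to update its array in place. -/
theorem runs_fill {k N a m : ℕ} {e : Exp} {s : State} {v : ℕ → ℕ} (hk : k < 64) (hN : N < k)
    (hm : m + 1 ≤ W) (hs : s.reg N = m)
    (he : ∀ i < m, ∀ s' : State, (∀ x < k, s'.reg x = s.reg x) → (∀ b ≠ a, s'.arr b = s.arr b) →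
      s'.arr a i = s.arr a i → s'.reg k = i → e.Ok W M s' ∧ e.eval M s' = v i) :
    Runs W M (fill k N a e) s (m * (e.cost + 7) + 3) fun s' =>
      (∀ x < k, s'.reg x = s.reg x) ∧ (∀ b ≠ a, s'.arr b = s.arr b) ∧
        ∀ i < m, s'.arr a i = v i := by
  refine (Runs.forUpto (t := 1 + (e.cost + 1)) (m := m) (fun i s' => (∀ x < k, s'.reg x = s.reg x) ∧
    (∀ b ≠ a, s'.arr b = s.arr b) ∧ (∀ j < i, s'.arr a j = v j) ∧ ∀ j ≥ i, s'.arr a j = s.arr a j)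
    hk (by omega) hm ?_ ?_ ?_ ?_).mono (by rw [show 1 + (e.cost + 1) + 5 = e.cost + 7 by omega])
      fun _ h => h
  · intro i s' h
    rw [h.1 N hN, hs]
  · refine ⟨fun x hx => ?_, fun _ _ => rfl, fun _ h => absurd h (Nat.not_lt_zero _),
      fun _ _ => rfl⟩
    rw [State.reg_setReg, if_neg (by omega)]
  · rintro i hi s' ⟨h1, h2, h3, h4⟩ hx
    obtain ⟨h5, h6⟩ := he i hi s' h1 h2 (h4 i le_rfl) hx
    refine Runs.put le_rfl hk h5 ⟨by simpa using hx, fun x hx => ?_, fun b hb => ?_, fun j hj => ?_,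
      fun j hj => ?_⟩
    · simp only [State.reg_setReg, State.reg_setArr]
      rw [if_neg (by omega), h1 x hx]
    · rw [← h2 b hb]
      funext y
      simp [hb]
    · simp only [State.arr_setReg, State.arr_setArr, true_and, Exp.eval, hx]
      split_ifs with h
      · rw [h, h6]
      · exact h3 j (by omega)
    · simp only [State.arr_setReg, State.arr_setArr, true_and, Exp.eval, hx]
      rw [if_neg (by omega)]
      exact h4 j (by omega)
  · rintro s' ⟨h1, h2, h3, -⟩ -
    exact ⟨h1, h2, h3⟩

end Machine

end DMC

namespace DMC

/-! ### Unit propagation in quadratic time -/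

section Propagation

variable {W : ℕ} {M : ℕ → ℕ → ℕ}

/-- The expression `e` can be evaluated in state `s`, with value `v`. -/
def Ev (W : ℕ) (M : ℕ → ℕ → ℕ) (s : State) (e : Exp) (v : ℕ) : Prop :=
  e.Ok W M s ∧ e.eval M s = v

namespace Exp

def not (e : Exp) : Exp := .sub (.const 1) e

def and (a b : Exp) : Exp := .mul a b

def or (a b : Exp) : Exp := .cond a (.const 1) b

/-- The column of a literal; register `2` holds the number of columns. -/
def litVar (e : Exp) : Exp := .cond (.lt e (.reg 2)) e (.sub e (.reg 2))

/-- The negation of a literal. -/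
def litNeg (e : Exp) : Exp := .cond (.lt e (.reg 2)) (.add e (.reg 2)) (.sub e (.reg 2))

/-- The entry of the table of clashes for two literals; register `3` holds the number of
literals. -/
def clash (a b : Exp) : Exp := .load 2 (.add (.mul a (.reg 3)) b)

end Exp

namespace Ev

variable {s : State} {a b c : Exp} {u v w : ℕ} {φ ψ : Prop}

theorem reg {x : ℕ} (hx : x < 64) (h : s.reg x = v) : Ev W M s (.reg x) v := ⟨hx, h⟩

theorem const {c : ℕ} (hc : c ≤ W) : Ev W M s (.const c) c := ⟨hc, rfl⟩

theorem add (ha : Ev W M s a u) (hb : Ev W M s b v) (h : u + v ≤ W) :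
    Ev W M s (.add a b) (u + v) := by
  obtain ⟨ha, rfl⟩ := ha
  obtain ⟨hb, rfl⟩ := hb
  exact ⟨⟨ha, hb, h⟩, rfl⟩

theorem sub (ha : Ev W M s a u) (hb : Ev W M s b v) : Ev W M s (.sub a b) (u - v) := by
  obtain ⟨ha, rfl⟩ := ha
  obtain ⟨hb, rfl⟩ := hb
  exact ⟨⟨ha, hb⟩, rfl⟩

theorem mul (ha : Ev W M s a u) (hb : Ev W M s b v) (h : u * v ≤ W) :
    Ev W M s (.mul a b) (u * v) := by
  obtain ⟨ha, rfl⟩ := ha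
  obtain ⟨hb, rfl⟩ := hb
  exact ⟨⟨ha, hb, h⟩, rfl⟩

theorem load {r : ℕ} (ha : Ev W M s a u) (h : s.arr r u = v) : Ev W M s (.load r a) v := by
  obtain ⟨ha, rfl⟩ := ha
  exact ⟨ha, h⟩

theorem read (ha : Ev W M s a u) (hb : Ev W M s b v) : Ev W M s (.read a b) (M u v) := by
  obtain ⟨ha, rfl⟩ := ha
  obtain ⟨hb, rfl⟩ := hb
  exact ⟨⟨ha, hb⟩, rfl⟩

theorem lt (hW : 1 ≤ W) (ha : Ev W M s a u) (hb : Ev W M s b v) :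
    Ev W M s (.lt a b) (ind (u < v)) := by
  obtain ⟨ha, rfl⟩ := ha
  obtain ⟨hb, rfl⟩ := hb
  exact ⟨⟨ha, hb, hW⟩, ite_eq_ind _⟩

theorem eq (hW : 1 ≤ W) (ha : Ev W M s a u) (hb : Ev W M s b v) :
    Ev W M s (.eq a b) (ind (u = v)) := by
  obtain ⟨ha, rfl⟩ := ha
  obtain ⟨hb, rfl⟩ := hb
  exact ⟨⟨ha, hb, hW⟩, ite_eq_ind _⟩

theorem cond [Decidable φ] (hc : Ev W M s c (ind φ)) (ha : Ev W M s a u) (hb : Ev W M s b v) :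
    Ev W M s (.cond c a b) (if φ then u else v) := by
  obtain ⟨ha, rfl⟩ := ha
  obtain ⟨hb, rfl⟩ := hb
  refine ⟨⟨hc.1, ha, hb⟩, ?_⟩
  simp only [Exp.eval, hc.2]
  by_cases h : φ
  · rw [ind_of h, if_pos h, if_neg one_ne_zero]
  · rw [ind_of_not h, if_neg h, if_pos rfl]

theorem not (hW : 1 ≤ W) (ha : Ev W M s a (ind φ)) : Ev W M s (.not a) (ind (¬ φ)) := by
  rw [← one_sub_ind]
  exact (const hW).sub ha

theorem and (hW : 1 ≤ W) (ha : Ev W M s a (ind φ)) (hb : Ev W M s b (ind ψ)) :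
    Ev W M s (.and a b) (ind (φ ∧ ψ)) := by
  rw [← ind_mul_ind]
  exact ha.mul hb ((Nat.mul_le_mul (ind_le_one _) (ind_le_one _)).trans hW)

theorem or (hW : 1 ≤ W) (ha : Ev W M s a (ind φ)) (hb : Ev W M s b (ind ψ)) :
    Ev W M s (.or a b) (ind (φ ∨ ψ)) := by
  classical
  have h : ind (φ ∨ ψ) = if φ then 1 else ind ψ := by
    by_cases h : φ <;> simp [h, ind]
  rw [h]
  exact ha.cond (const hW) hb

theorem litVar {D : ℕ} (hW : 1 ≤ W) (hD : s.reg 2 = D) (ha : Ev W M s a u) :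
    Ev W M s (.litVar a) (litVar D u) :=
  (ha.lt hW (reg (by norm_num) hD)).cond ha (ha.sub (reg (by norm_num) hD))

theorem litNeg {D : ℕ} (hW : 1 ≤ W) (hD : s.reg 2 = D) (ha : Ev W M s a u) (h : u + D ≤ W) :
    Ev W M s (.litNeg a) (litNeg D u) :=
  (ha.lt hW (reg (by norm_num) hD)).cond (ha.add (reg (by norm_num) hD) h)
    (ha.sub (reg (by norm_num) hD))

end Ev

/-- A state of unit propagation: the literals in `P` have been derived from `seeds`, and the
consequences of those in `E` have been drawn. -/
structure PropState (D : ℕ) (X : ℕ → ℕ → Prop) (mask seeds P : ℕ → Prop) (E : Finset ℕ) :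
    Prop where
  seeds_le : ∀ p < 2 * D, seeds p → P p
  least : ∀ P' : ℕ → Prop, (∀ p < 2 * D, seeds p → P' p) → PropClosed D X mask P' →
    ∀ p < 2 * D, P p → P' p
  unmasked : ∀ p < 2 * D, P p → ¬ mask (litVar D p)
  closed : ∀ p ∈ E, ∀ q < 2 * D, X p q → ¬ mask (litVar D q) → P (litNeg D q)
  drawn : ∀ p ∈ E, p < 2 * D ∧ P p

section

variable {D : ℕ} {X : ℕ → ℕ → Prop} {mask seeds P : ℕ → Prop} {E : Finset ℕ}

theorem PropState.step (h : PropState D X mask seeds P E) {w : ℕ} (hw : w < 2 * D) (hP : P w) :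
    PropState D X mask seeds
      (fun p => P p ∨ (X w (litNeg D p) ∧ ¬ mask (litVar D p))) (insert w E) where
  seeds_le p hp hs := Or.inl (h.seeds_le p hp hs)
  least P' h1 h2 p hp hpP := by
    rcases hpP with hpP | ⟨h3, h4⟩
    · exact h.least P' h1 h2 p hp hpP
    · rw [← litNeg_litNeg hp]
      rw [← litVar_litNeg hp] at h4
      exact h2 w hw (h.least P' h1 h2 w hw hP) _ (litNeg_lt hp) h3 h4
  unmasked p hp hpP := by
    rcases hpP with hpP | h'
    · exact h.unmasked p hp hpP
    · exact h'.2
  closed p hp q hq hpq hm := by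
    rcases Finset.mem_insert.1 hp with rfl | hp
    · refine Or.inr ⟨?_, ?_⟩
      · rwa [litNeg_litNeg hq]
      · rwa [litVar_litNeg hq]
    · exact Or.inl (h.closed p hp q hq hpq hm)
  drawn p hp := by
    rcases Finset.mem_insert.1 hp with rfl | hp
    · exact ⟨hw, Or.inl hP⟩
    · exact ⟨(h.drawn p hp).1, Or.inl (h.drawn p hp).2⟩

theorem PropState.start (h : ∀ p < 2 * D, seeds p → ¬ mask (litVar D p)) :
    PropState D X mask seeds seeds ∅ where
  seeds_le _ _ hs := hs
  least _ h1 _ := h1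
  unmasked := h
  closed p hp := by simp at hp
  drawn p hp := by simp at hp

/-- By `least`, a contradiction in `P` appears in every closed set that contains the seeds. Without
one, `P` itself is the witness, as all of its literals have been processed. -/
theorem PropState.propagates_iff (h : PropState D X mask seeds P E)
    (hE : ∀ p < 2 * D, P p → p ∈ E) :
    Propagates D X mask seeds ↔ ¬ ∃ k < D, P k ∧ P (k + D) := by
  constructor
  · rintro ⟨P', h1, -, h2, h3⟩ ⟨k, hk, h4, h5⟩
    exact h3 k hk ⟨h.least P' h1 h2 _ (by omega) h4, h.least P' h1 h2 _ (by omega) h5⟩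
  · intro hc
    exact ⟨P, h.seeds_le, h.unmasked, fun p hp hpP => h.closed p (hE p hp hpP),
      fun k hk hkP => hc ⟨k, hk, hkP⟩⟩

theorem PropState.all_drawn (h : PropState D X mask seeds P E) (hE : 2 * D ≤ E.card) :
    ∀ p < 2 * D, P p → p ∈ E := by
  intro p hp _
  have hsub : E ⊆ Finset.range (2 * D) := fun q hq => Finset.mem_range.2 (h.drawn q hq).1
  rw [Finset.eq_of_subset_of_card_le hsub (by rwa [Finset.card_range])]
  exact Finset.mem_range.2 hp

/-- The registers and arrays that unit propagation reads: the number of columns, the number of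
literals, the table of clashes, and the masked columns. -/
structure Tables (D : ℕ) (X : ℕ → ℕ → Prop) (mask : ℕ → Prop) (s : State) : Prop where
  reg_two : s.reg 2 = D
  reg_three : s.reg 3 = 2 * D
  clash : ∀ p < 2 * D, ∀ q < 2 * D, s.arr 2 (p * (2 * D) + q) = ind (X p q)
  mask : ∀ k < D, s.arr 3 k = ind (mask k)

theorem Tables.frame {s s' : State} {k a : ℕ} (h : Tables D X mask s) (hf : Frame k a s s')
    (hk : 4 ≤ k) (ha : 4 ≤ a) : Tables D X mask s' where
  reg_two := by rw [hf.1 2 (by omega), h.reg_two]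
  reg_three := by rw [hf.1 3 (by omega), h.reg_three]
  clash := by
    rw [hf.2 2 (by omega)]
    exact h.clash
  mask := by
    rw [hf.2 3 (by omega)]
    exact h.mask

theorem ev_clash {s : State} (hW : (2 * D + 2) * (2 * D + 2) ≤ W) (h3 : s.reg 3 = 2 * D)
    (hX : ∀ p < 2 * D, ∀ q < 2 * D, s.arr 2 (p * (2 * D) + q) = ind (X p q)) {a b : Exp} {p q : ℕ}
    (ha : Ev W M s a p) (hb : Ev W M s b q) (hp : p < 2 * D) (hq : q < 2 * D) :
    Ev W M s (.clash a b) (ind (X p q)) := by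
  have h1 : p * (2 * D) ≤ 2 * D * (2 * D) := Nat.mul_le_mul_right _ hp.le
  refine ((ha.mul (.reg (by norm_num) h3) ?_).add hb ?_).load (hX p hp q hq)
  · nlinarith
  · nlinarith

/-- Stores an unprocessed derived literal in register `k + 2`, if there is one, and whether there is
one in register `k + 1`. -/
def findUnprocessed (k : ℕ) : Prog :=
  .seq (assign (k + 1) (.const 0)) (forUpto (k + 3) 3
    (cond (.and (.load 4 (.reg (k + 3))) (.not (.load 5 (.reg (k + 3)))))
      (.seq (assign (k + 1) (.const 1)) (assign (k + 2) (.reg (k + 3)))) skip))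

/-- Draws the consequences of one literal. -/
def propagateOnce (k : ℕ) : Prog :=
  .seq (findUnprocessed k) (cond (.reg (k + 1))
    (.seq (put 5 (.reg (k + 2)) (.const 1))
      (fill (k + 3) 3 4 (.or (.load 4 (.reg (k + 3)))
        (.and (.clash (.reg (k + 2)) (.litNeg (.reg (k + 3))))
          (.not (.load 3 (.litVar (.reg (k + 3)))))))))
    skip)

/-- Unit propagation from the literals in array `4`. Register `k` becomes `1` if no contradiction is
reached, and `0` otherwise. -/
def propagate (k : ℕ) : Prog :=
  .seq (forUpto k 3 (propagateOnce k)) (.seq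
    (existsLoop k 2
      (assign (k + 2) (.and (.load 4 (.reg k)) (.load 4 (.add (.reg k) (.reg 2))))))
    (assign k (.not (.reg k))))

theorem runs_findUnprocessed {k : ℕ} (hk : k + 4 < 64) (hk4 : 4 ≤ k) {s : State}
    (hW : (2 * D + 2) * (2 * D + 2) ≤ W) (h3 : s.reg 3 = 2 * D)
    (hP : ∀ p < 2 * D, s.arr 4 p = ind (P p)) (hE : ∀ p < 2 * D, s.arr 5 p = ind (p ∈ E)) :
    Runs W M (findUnprocessed k) s (2 * D * 18 + 5) fun s' =>
      Frame (k + 1) 6 s s' ∧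
        ((s'.reg (k + 1) = 0 ∧ ∀ p < 2 * D, P p → p ∈ E) ∨
          (s'.reg (k + 1) = 1 ∧ s'.reg (k + 2) < 2 * D ∧ P (s'.reg (k + 2)) ∧
            s'.reg (k + 2) ∉ E)) := by
  have hW1 : 1 ≤ W := by nlinarith
  have hWD : 2 * D + 1 ≤ W := by nlinarith
  refine (Runs.seq (t := 2) (t' := 2 * D * (13 + 5) + 3) (Runs.assign le_rfl (Nat.zero_le _)
    (Runs.forUpto (fun i s' => Frame (k + 1) 6 s s' ∧
      ((s'.reg (k + 1) = 0 ∧ ∀ p < i, P p → p ∈ E) ∨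
          (s'.reg (k + 1) = 1 ∧ s'.reg (k + 2) < 2 * D ∧ P (s'.reg (k + 2)) ∧
            s'.reg (k + 2) ∉ E))) (m := 2 * D)
      (by omega) (by omega) hWD ?_ ?_ ?_ ?_))).mono (by omega) fun _ h => h
  · intro i s' h
    rw [h.1.1 3 (by omega), h3]
  · refine ⟨((Frame.refl _ _ _).setReg (by omega)).setReg (by omega), Or.inl ⟨?_, by simp⟩⟩
    simp [Exp.eval]
  · rintro i hi s' ⟨hf, hI⟩ hx
    have hev : Ev W M s' (.and (.load 4 (.reg (k + 3))) (.not (.load 5 (.reg (k + 3)))))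
        (ind (P i ∧ ¬ i ∈ E)) := by
      refine .and hW1 (.load (.reg (by omega) hx) ?_) (.not hW1 (.load (.reg (by omega) hx) ?_))
      · rw [hf.2 4 (by omega), hP i hi]
      · rw [hf.2 5 (by omega), hE i hi]
    refine Runs.cond (t := 4) (by simp [Exp.cost, Exp.and, Exp.not]) hev.1 ?_ ?_
    · rw [hev.2, ind_ne_zero_iff]
      rintro ⟨h1, h2⟩
      refine Runs.seq (t := 2) (t' := 2) (Runs.assign le_rfl hW1
        (Runs.assign le_rfl (by change k + 3 < 64; omega) ⟨?_, ?_, Or.inr ⟨?_, ?_⟩⟩))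
      · simp [hx]
      · exact ((hf.setReg (by omega)).setReg (by omega)).setReg (by omega)
      · simp [Exp.eval]
      · simp [Exp.eval, hx, hi, h1, h2]
    · rw [hev.2, ind_eq_zero_iff]
      intro hn
      refine (Runs.skip ⟨hx, hf.setReg (by omega), ?_⟩).mono (by norm_num) fun _ h => h
      simp only [State.reg_setReg]
      rw [if_neg (by omega), if_neg (by omega)]
      refine hI.imp_left fun ⟨h1, h2⟩ => ⟨h1, fun p hp hpP => ?_⟩
      rcases Nat.lt_succ_iff_lt_or_eq.1 hp with hp | rfl
      · exact h2 p hp hpP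
      · by_contra h
        exact hn ⟨hpP, h⟩
  · rintro s' h -
    exact h

/-- One scan looks for an unprocessed literal and a second one draws its consequences, so a round is
linear in `D`. The final disjunction says that a round either processes a new literal or leaves
nothing to do, and that a finished propagation is never reopened. -/
theorem runs_propagateOnce {k : ℕ} (hk : k + 4 < 64) (hk4 : 4 ≤ k) {s : State}
    (hW : (2 * D + 2) * (2 * D + 2) ≤ W) (hT : Tables D X mask s)
    (hP : ∀ p < 2 * D, s.arr 4 p = ind (P p)) (hE : ∀ p < 2 * D, s.arr 5 p = ind (p ∈ E))
    (hS : PropState D X mask seeds P E) :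
    Runs W M (propagateOnce k) s (2 * D * 70 + 20) fun s' =>
      Frame (k + 1) 4 s s' ∧ ∃ (P' : ℕ → Prop) (E' : Finset ℕ), PropState D X mask seeds P' E' ∧
        (∀ p < 2 * D, s'.arr 4 p = ind (P' p)) ∧ (∀ p < 2 * D, s'.arr 5 p = ind (p ∈ E')) ∧
        ((E'.card = E.card + 1 ∧ ¬ ∀ p < 2 * D, P p → p ∈ E) ∨ ∀ p < 2 * D, P' p → p ∈ E') := by
  have hW1 : 1 ≤ W := by nlinarith
  have hWD : 3 * D + 1 ≤ W := by nlinarith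
  refine (Runs.seq (t' := 2 * D * 52 + 15)
    ((runs_findUnprocessed hk hk4 hW hT.reg_three hP hE).mono le_rfl ?_)).mono (by omega)
      fun _ h => h
  rintro s₁ ⟨hf, ⟨h0, hall⟩ | ⟨h1, hlt, hPw, hEw⟩⟩
  · refine Runs.cond (t := 2 * D * 50 + 10) (by simp only [Exp.cost]; omega)
      (by change k + 1 < 64; omega) (fun h => absurd h0 h) fun _ => ?_
    refine (Runs.skip ⟨hf.mono le_rfl (by omega), P, E, hS, ?_, ?_, Or.inr hall⟩).mono (by omega)
      fun _ h => h
    · rwa [hf.2 4 (by omega)]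
    · rwa [hf.2 5 (by omega)]
  · refine Runs.cond (t := 2 * D * 52 + 8) (by simp only [Exp.cost]; omega)
      (by change k + 1 < 64; omega) (fun _ => ?_) fun h => by
        simp only [Exp.eval, h1] at h
        omega
    have hT₁ := hT.frame hf (by omega) (by omega)
    set w := s₁.reg (k + 2) with hw
    set s₂ := s₁.setArr 5 w 1 with hs₂
    have hf₂ : Frame (k + 1) 4 s s₂ := by
      refine ⟨hf.1, fun b hb => ?_⟩
      rw [← hf.2 b (by omega)]
      funext y
      rw [hs₂, State.arr_setArr, if_neg (by omega)]
    have hT₂ := hT.frame hf₂ (by omega) (by omega)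
    have h24 : s₂.arr 4 = s.arr 4 := by
      rw [← hf.2 4 (by omega)]
      funext y
      rw [hs₂, State.arr_setArr, if_neg (by omega)]
    refine (Runs.seq (t := 3) (t' := 2 * D * 43 + 3) (Runs.put le_rfl
      (by change k + 2 < 64; omega) (by change 1 ≤ W; omega) ?_)).mono (by omega) fun _ h => h
    change Runs W M _ s₂ _ _
    refine (runs_fill (m := 2 * D)
      (v := fun p => ind (P p ∨ (X w (litNeg D p) ∧ ¬ mask (litVar D p)))) (by omega) (by omega)
      (by omega) hT₂.reg_three ?_).mono ?_ ?_
    · intro i hi s' hr ha hi' hx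
      have hr3 := (hr 3 (by omega)).trans hT₂.reg_three
      have hr2 := (hr 2 (by omega)).trans hT₂.reg_two
      refine Ev.or hW1 (.load (.reg (by omega) hx) ?_) (.and hW1 (ev_clash hW hr3 ?_ (.reg (by omega)
        ?_) (.litNeg hW1 hr2 (.reg (by omega) hx) (by omega)) hlt (litNeg_lt hi)) (.not hW1
        (.load (.litVar hW1 hr2 (.reg (by omega) hx)) ?_)))
      · rw [hi', h24, hP i hi]
      · rw [ha 2 (by norm_num)]
        exact hT₂.clash
      · rw [hr _ (by omega), hw, hs₂, State.reg_setArr]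
      · rw [ha 3 (by norm_num), hT₂.mask _ (litVar_lt hi)]
    · simp [Exp.cost, Exp.or, Exp.and, Exp.not, Exp.clash, Exp.litNeg, Exp.litVar]
    · rintro s' ⟨hr, ha, hv⟩
      refine ⟨hf₂.trans ⟨fun x hx => hr x (by omega), fun b hb => ha b (by omega)⟩ le_rfl le_rfl,
        _, insert w E, hS.step hlt hPw, hv, ?_, 
        Or.inl ⟨Finset.card_insert_of_notMem hEw, fun h => hEw (h w hlt hPw)⟩⟩
      intro p hp
      rw [ha 5 (by norm_num), hs₂, State.arr_setArr]
      split_ifs with h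
      · rw [ind_of (by simp [h.2])]
      · rw [hf.2 5 (by omega), hE p hp]
        refine ind_congr ?_
        rw [Finset.mem_insert]
        tauto

theorem computes_propagate {k : ℕ} (hk : k + 4 < 64) (hk4 : 4 ≤ k) {s : State}
    (hW : (2 * D + 2) * (2 * D + 2) ≤ W) (hD : 1 ≤ D) (hT : Tables D X mask s)
    (hseeds : ∀ p < 2 * D, s.arr 4 p = ind (seeds p)) (h5 : ∀ p < 2 * D, s.arr 5 p = 0)
    (hm : ∀ p < 2 * D, seeds p → ¬ mask (litVar D p)) :
    Computes W M k 4 (propagate k) s (400 * D ^ 2) (ind (Propagates D X mask seeds)) := by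
  have hW1 : 1 ≤ W := by nlinarith
  have hWD : 3 * D + 1 ≤ W := by nlinarith
  have hcost : 2 * D * (2 * D * 70 + 20 + 5) + 3 + (D * (9 + 12) + 7 + 4) ≤ 400 * D ^ 2 := by
    nlinarith
  refine (Runs.seq (t := 2 * D * (2 * D * 70 + 20 + 5) + 3) (t' := D * (9 + 12) + 7 + 4) ?_).mono
    hcost fun _ h => h
  -- After `r` rounds at least `r` literals are processed unless none is left. There are only `2 *
  -- D` literals, so as many rounds suffice.
  refine Runs.forUpto (fun r s' => Frame k 4 s s' ∧
    ∃ (P : ℕ → Prop) (E : Finset ℕ), PropState D X mask seeds P E ∧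
      (∀ p < 2 * D, s'.arr 4 p = ind (P p)) ∧ (∀ p < 2 * D, s'.arr 5 p = ind (p ∈ E)) ∧
      (r ≤ E.card ∨ ∀ p < 2 * D, P p → p ∈ E)) (m := 2 * D) (by omega) (by omega) (by omega)
    ?_ ?_ ?_ ?_
  · intro i s' h
    rw [h.1.1 3 (by omega), hT.reg_three]
  · refine ⟨(Frame.refl _ _ _).setReg le_rfl, seeds, ∅, .start hm, hseeds, fun p hp => ?_,
      Or.inl (Nat.zero_le _)⟩
    rw [ind_of_not (by simp)]
    exact h5 p hp
  · rintro i hi s' ⟨hf, P, E, hS, hP, hE, hc⟩ hx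
    refine (runs_propagateOnce hk hk4 hW (hT.frame hf (by omega) le_rfl) hP hE hS).mono le_rfl ?_
    rintro s'' ⟨hf', P', E', hS', hP', hE', hc'⟩
    refine ⟨by rw [hf'.1 k (by omega), hx], (hf.trans hf' (by omega) le_rfl).setReg le_rfl, P', E',
      hS', hP', hE', ?_⟩
    rcases hc' with hc' | hc'
    · rcases hc with hc | hc
      · left
        omega
      · exact absurd hc hc'.2
    · exact Or.inr hc'
  · rintro s' ⟨hf, P, E, hS, hP, hE, hc⟩ -
    have hall : ∀ p < 2 * D, P p → p ∈ E := by
      rcases hc with hc | hc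
      · exact hS.all_drawn hc
      · exact hc
    have hT' := hT.frame hf (by omega) le_rfl
    refine Runs.seq (t := D * (9 + 12) + 7) (t' := 4)
      ((computes_existsLoop (a := 6) (m := D) (φ := fun j => P j ∧ P (j + D)) (by omega) (by omega)
        (by omega) hT'.reg_two ?_).mono le_rfl ?_)
    · intro i hi s'' hf' hx
      have hev : Ev W M s'' (.and (.load 4 (.reg k)) (.load 4 (.add (.reg k) (.reg 2))))
          (ind (P i ∧ P (i + D))) := by
        refine .and hW1 (.load (.reg (by omega) hx) ?_) (.load (.add (.reg (by omega) hx)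
          (.reg (v := D) (by omega) ?_) (by omega)) ?_)
        · rw [hf'.2 4 (by omega), hP i (by omega)]
        · rw [hf'.1 2 (by omega), hT'.reg_two]
        · rw [hf'.2 4 (by omega), hP _ (by omega)]
      exact computes_assign (by simp [Exp.cost, Exp.and]) hev.1 hev.2
    · rintro s'' ⟨hf', hv⟩
      have hev : Ev W M s'' (.not (.reg k)) (ind (¬ ∃ j < D, P j ∧ P (j + D))) :=
        .not hW1 (.reg (by omega) hv)
      refine Runs.assign le_rfl hev.1 ⟨(hf.trans hf' le_rfl (by omega)).setReg le_rfl, ?_⟩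
      rw [State.reg_setReg, if_pos rfl, hev.2]
      exact ind_congr (hS.propagates_iff hall).symm

end

end Propagation

end DMC

namespace DMC

/-! ### The search over pairs and triples of literals -/

section Search

variable {W : ℕ} {M : ℕ → ℕ → ℕ} {n D : ℕ}

theorem Runs.andThen {p q : Prog} {s : State} {t t₁ t₂ : ℕ} {Q Q' : State → Prop}
    (h : Runs W M p s t₁ Q') (ht : t₁ + t₂ ≤ t) (h' : ∀ s', Q' s' → Runs W M q s' t₂ Q) :
    Runs W M (.seq p q) s t Q :=
  (Runs.seq (h.mono le_rfl h')).mono ht fun _ h => h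

/-- Unit propagation from the literals `i` at which `e` is nonzero; `e` refers to the literal by
register `k`. -/
def propagateFrom (k : ℕ) (e : Exp) : Prog :=
  .seq (fill k 3 5 (.const 0)) (.seq (fill k 3 4 e) (propagate k))

theorem computes_propagateFrom {X : ℕ → ℕ → Prop} {mask seeds : ℕ → Prop} {k : ℕ}
    (hk : k + 4 < 64) (hk4 : 4 ≤ k) {s : State} {e : Exp}
    (hW : (2 * D + 2) * (2 * D + 2) ≤ W) (hD : 1 ≤ D) (hT : Tables D X mask s)
    (he : ∀ i < 2 * D, ∀ s', Frame k 4 s s' → s'.reg k = i → Ev W M s' e (ind (seeds i)))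
    (hm : ∀ p < 2 * D, seeds p → ¬ mask (litVar D p)) :
    Computes W M k 4 (propagateFrom k e) s ((450 + 2 * e.cost) * D ^ 2)
      (ind (Propagates D X mask seeds)) := by
  have hWD : 3 * D + 1 ≤ W := by nlinarith
  have hcost : 2 * D * 8 + 3 + (2 * D * (e.cost + 7) + 3 + 400 * D ^ 2) ≤
      (450 + 2 * e.cost) * D ^ 2 := by
    have : D * e.cost ≤ D ^ 2 * e.cost := Nat.mul_le_mul_right _ (Nat.le_self_pow (by norm_num) D)
    nlinarith
  refine (runs_fill (m := 2 * D) (v := fun _ => 0) (by omega) (by omega) (by omega) hT.reg_three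
    fun i _ s' _ _ _ _ => ⟨Nat.zero_le _, rfl⟩).andThen hcost ?_
  rintro s₁ ⟨hr₁, ha₁, hv₁⟩
  have hf₁ : Frame k 4 s s₁ := ⟨hr₁, fun b hb => ha₁ b (by omega)⟩
  have hT₁ := hT.frame hf₁ hk4 le_rfl
  refine (runs_fill (m := 2 * D) (v := fun i => ind (seeds i)) (by omega) (by omega) (by omega)
    hT₁.reg_three fun i hi s' hr ha _ hx => he i hi s'
      (hf₁.trans ⟨hr, fun b hb => ha b (by omega)⟩ le_rfl le_rfl) hx).andThen le_rfl ?_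
  rintro s₂ ⟨hr₂, ha₂, hv₂⟩
  have hf₂ : Frame k 4 s s₂ := hf₁.trans ⟨hr₂, fun b hb => ha₂ b (by omega)⟩ le_rfl le_rfl
  refine (computes_propagate hk hk4 hW hD (hT.frame hf₂ hk4 le_rfl) hv₂ ?_ hm).mono le_rfl ?_
  · rw [ha₂ 5 (by norm_num)]
    exact hv₁
  · rintro s' ⟨hf, hv⟩
    exact ⟨hf₂.trans hf le_rfl le_rfl, hv⟩

/-- Register `k + 2` becomes `1` if column `k` is unmasked and both of its literals lead to a
contradiction. -/
def columnFails (k : ℕ) : Prog :=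
  cond (.load 3 (.reg k)) (assign (k + 2) (.const 0))
    (.seq (propagateFrom (k + 2) (.eq (.reg (k + 2)) (.reg k)))
      (cond (.reg (k + 2)) (assign (k + 2) (.const 0))
        (.seq (propagateFrom (k + 2) (.eq (.reg (k + 2)) (.add (.reg k) (.reg 2))))
          (assign (k + 2) (.not (.reg (k + 2)))))))

/-- Decides whether the unmasked columns have a model. -/
def satisfiable (k : ℕ) : Prog :=
  .seq (existsLoop k 2 (columnFails k)) (assign k (.not (.reg k)))

theorem computes_columnFails {X : ℕ → ℕ → Prop} {mask : ℕ → Prop} {k i : ℕ} (hk : k + 6 < 64)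
    (hk4 : 4 ≤ k) {s : State} (hW : (2 * D + 2) * (2 * D + 2) ≤ W) (hT : Tables D X mask s)
    (hi : i < D) (hki : s.reg k = i) :
    Computes W M (k + 2) 4 (columnFails k) s (950 * D ^ 2) (ind (¬ mask i ∧
      ¬ (Propagates D X mask (· = i) ∨ Propagates D X mask (· = i + D)))) := by
  have hW1 : 1 ≤ W := by nlinarith
  have hWD : 3 * D + 1 ≤ W := by nlinarith
  have hD2 : 1 ≤ D ^ 2 := Nat.one_le_pow _ _ (by omega)
  have hev : Ev W M s (.load 3 (.reg k)) (ind (mask i)) :=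
    .load (.reg (by omega) hki) (hT.mask i hi)
  refine Runs.cond (t := 932 * D ^ 2 + 10) (by simp only [Exp.cost]; omega) hev.1 ?_ ?_
  · rw [hev.2, ind_ne_zero_iff]
    intro hm
    exact computes_assign (by simp only [Exp.cost]; omega) (Nat.zero_le _)
      (ind_of_not fun h => h.1 hm).symm
  rw [hev.2, ind_eq_zero_iff]
  intro hm
  have hfirst : Computes W M (k + 2) 4 (propagateFrom (k + 2) (.eq (.reg (k + 2)) (.reg k))) s
      (458 * D ^ 2) (ind (Propagates D X mask (· = i))) := by
    refine computes_propagateFrom (by omega) (by omega) hW (by omega) hT ?_ ?_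
    · intro j hj s' hf hx
      exact .eq hW1 (.reg (by omega) hx) (.reg (by omega) (by rw [hf.1 k (by omega), hki]))
    · rintro p hp rfl
      rwa [litVar_of_lt hi]
  refine hfirst.andThen (t₂ := 474 * D ^ 2 + 10) (by omega) ?_
  rintro s₁ ⟨hf₁, hv₁⟩
  have hT₁ := hT.frame hf₁ (by omega) le_rfl
  have hev₁ : Ev W M s₁ (.reg (k + 2)) (ind (Propagates D X mask (· = i))) :=
    .reg (by omega) hv₁
  refine Runs.cond (t := 474 * D ^ 2 + 7) (by simp only [Exp.cost]; omega) hev₁.1 ?_ ?_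
  · rw [hev₁.2, ind_ne_zero_iff]
    intro h
    refine (computes_assign (k := k + 2) (a := 4) (v := 0) le_rfl (Nat.zero_le _) rfl).mono
      (by simp only [Exp.cost]; omega) ?_
    rintro s' ⟨hf', hv'⟩
    refine ⟨hf₁.trans hf' le_rfl le_rfl, ?_⟩
    rw [hv', ind_of_not fun h' => h'.2 (Or.inl h)]
  rw [hev₁.2, ind_eq_zero_iff]
  intro hn
  have hsecond : Computes W M (k + 2) 4
      (propagateFrom (k + 2) (.eq (.reg (k + 2)) (.add (.reg k) (.reg 2)))) s₁
      (462 * D ^ 2) (ind (Propagates D X mask (· = i + D))) := by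
    refine computes_propagateFrom (by omega) (by omega) hW (by omega) hT₁ ?_ ?_
    · intro j hj s' hf hx
      refine .eq hW1 (.reg (by omega) hx) (.add (.reg (by omega) ?_) (.reg (by omega) ?_)
        (by omega))
      · rw [hf.1 k (by omega), hf₁.1 k (by omega), hki]
      · rw [hf.1 2 (by omega), hT₁.reg_two]
    · rintro p hp rfl
      rwa [litVar_add]
  refine hsecond.andThen (t₂ := 4) (by omega) ?_
  rintro s₂ ⟨hf₂, hv₂⟩
  have hev₂ : Ev W M s₂ (.not (.reg (k + 2))) _ := .not hW1 (.reg (by omega) hv₂)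
  refine Runs.assign le_rfl hev₂.1 ⟨(hf₁.trans hf₂ le_rfl le_rfl).setReg le_rfl, ?_⟩
  rw [State.reg_setReg, if_pos rfl, hev₂.2]
  exact ind_congr (by tauto)

/-- By `sat_iff_propagates` it suffices to run at most two propagations for each column, each
quadratic in `D`. -/
theorem computes_satisfiable {X : ℕ → ℕ → Prop} (hX : ∀ p q, X p q → X q p) {mask : ℕ → Prop}
    {k : ℕ} (hk : k + 6 < 64) (hk4 : 4 ≤ k) {s : State} (hW : (2 * D + 2) * (2 * D + 2) ≤ W)
    (hD : 1 ≤ D) (hT : Tables D X mask s) :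
    Computes W M k 4 (satisfiable k) s (1000 * D ^ 3) (ind (Sat D X mask)) := by
  have hW1 : 1 ≤ W := by nlinarith
  have hWD : 3 * D + 1 ≤ W := by nlinarith
  have hcost : D * (950 * D ^ 2 + 12) + 7 + 4 ≤ 1000 * D ^ 3 := by
    have h1 : D ≤ D ^ 3 := Nat.le_self_pow (by norm_num) D
    have h2 : D * D ^ 2 = D ^ 3 := by ring
    rw [mul_add, mul_left_comm, h2]
    omega
  refine (computes_existsLoop (t := 950 * D ^ 2) (a := 4) (m := D) (by omega) (by omega) (by omega)
    hT.reg_two fun i hi s' hf hx => computes_columnFails hk hk4 hW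
      (hT.frame hf hk4 le_rfl) hi hx).andThen hcost ?_
  rintro s₁ ⟨hf₁, hv₁⟩
  have hev : Ev W M s₁ (.not (.reg k)) _ := .not hW1 (.reg (by omega) hv₁)
  refine Runs.assign le_rfl hev.1 ⟨hf₁.setReg le_rfl, ?_⟩
  rw [State.reg_setReg, if_pos rfl, hev.2, sat_iff_propagates hX]
  refine ind_congr ?_
  push Not
  refine forall₂_congr fun j _ => ?_
  tauto

/-- The registers and the array that describe the matrix `S` of the dirty columns of the input. -/
structure Env (M : ℕ → ℕ → ℕ) (S : PMat n D) (s : State) : Prop where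
  reg_zero : s.reg 0 = n
  reg_two : s.reg 2 = D
  reg_three : s.reg 3 = 2 * D
  entry : ∀ i < n, ∀ j < D, M i (s.arr 0 j) = inputOf S i j

theorem Env.frame {S : PMat n D} {s s' : State} {k a : ℕ} (h : Env M S s) (hf : Frame k a s s')
    (hk : 4 ≤ k) (ha : 1 ≤ a) : Env M S s' where
  reg_zero := by rw [hf.1 0 (by omega), h.reg_zero]
  reg_two := by rw [hf.1 2 (by omega), h.reg_two]
  reg_three := by rw [hf.1 3 (by omega), h.reg_three]
  entry := by
    rw [hf.2 0 (by omega)]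
    exact h.entry

/-- Whether row `i` contradicts the literal `p`. -/
def Exp.hit (i p : Exp) : Exp := .eq (.read i (.load 0 (.litVar p))) (.lt p (.reg 2))

theorem Ev.hit {S : PMat n D} {s : State} (hW : 1 ≤ W) (hS : Env M S s) {a b : Exp} {i p : ℕ}
    (ha : Ev W M s a i) (hb : Ev W M s b p) (hi : i < n) (hp : p < 2 * D) :
    Ev W M s (.hit a b) (ind (Hit S i p)) := by
  have h := Ev.eq hW (ha.read (.load (v := s.arr 0 (DMC.litVar D p)) (.litVar hW hS.reg_two hb)
    rfl)) (.lt hW hb (.reg (by norm_num) hS.reg_two))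
  rw [hS.entry i hi _ (litVar_lt hp), ← ite_eq_ind (p < D)] at h
  exact h

/-- The table of clashes is stored row by row, and this shows that distinct pairs of literals use
distinct cells. -/
theorem index_inj {m p q p' q' : ℕ} (hq : q < m) (hq' : q' < m) (h : p * m + q = p' * m + q') :
    p = p' ∧ q = q' := by
  have h1 := congrArg (· / m) h
  simp only [mul_comm _ m, Nat.mul_add_div (by omega : 0 < m), Nat.div_eq_of_lt hq,
    Nat.div_eq_of_lt hq'] at h1
  obtain rfl : p = p' := by omega
  exact ⟨rfl, by omega⟩

/-- Stores whether the literals in registers `4` and `5` clash. -/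
def storeClash : Prog :=
  .seq (existsLoop 6 0 (assign 8 (.and (.hit (.reg 6) (.reg 4)) (.hit (.reg 6) (.reg 5)))))
    (put 2 (.add (.mul (.reg 4) (.reg 3)) (.reg 5))
      (.and (.not (.eq (.litVar (.reg 4)) (.litVar (.reg 5)))) (.reg 6)))

/-- Computes the table of clashes. -/
def buildClash : Prog := forUpto 4 3 (forUpto 5 3 storeClash)

theorem runs_storeClash {S : PMat n D} {s : State} (hW : (2 * D + 2) * (2 * D + 2) ≤ W)
    (hn : n + 1 ≤ W) (hS : Env M S s) {p q : ℕ} (hp : p < 2 * D) (hq : q < 2 * D)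
    (h4 : s.reg 4 = p) (h5 : s.reg 5 = q) :
    Runs W M storeClash s (n * 60 + 60) fun s' => Frame 6 2 s s' ∧
      s'.arr 2 (p * (2 * D) + q) = ind (Clash S p q) ∧
      ∀ x ≠ p * (2 * D) + q, s'.arr 2 x = s.arr 2 x := by
  have hW1 : 1 ≤ W := by nlinarith
  have hpq : p * (2 * D) ≤ 2 * D * (2 * D) := Nat.mul_le_mul_right _ hp.le
  refine Runs.andThen (t₁ := n * (40 + 12) + 7) (t₂ := 40) (computes_existsLoop (a := 3)
    (φ := fun i => Hit S i p ∧ Hit S i q) (by omega) (by omega) hn hS.reg_zero ?_) (by omega) ?_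
  · intro i hi s' hf hx
    have hS' := hS.frame hf (by omega) (by omega)
    have h4' : s'.reg 4 = p := by rw [hf.1 4 (by omega), h4]
    have h5' : s'.reg 5 = q := by rw [hf.1 5 (by omega), h5]
    have hev := Ev.and hW1 (.hit hW1 hS' (.reg (by omega) hx) (.reg (by omega) h4') hi hp)
      (.hit hW1 hS' (.reg (by omega) hx) (.reg (by omega) h5') hi hq)
    exact computes_assign (by simp [Exp.cost, Exp.and, Exp.hit, Exp.litVar]) hev.1 hev.2
  · rintro s₁ ⟨hf, hv⟩
    have hS₁ := hS.frame hf (by omega) (by omega)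
    have h4' : Ev W M s₁ (.reg 4) p := .reg (by omega) (by rw [hf.1 4 (by omega), h4])
    have h5' : Ev W M s₁ (.reg 5) q := .reg (by omega) (by rw [hf.1 5 (by omega), h5])
    have hi : Ev W M s₁ (.add (.mul (.reg 4) (.reg 3)) (.reg 5)) (p * (2 * D) + q) :=
      (h4'.mul (.reg (by omega) hS₁.reg_three) (by nlinarith)).add h5' (by nlinarith)
    have he : Ev W M s₁ (.and (.not (.eq (.litVar (.reg 4)) (.litVar (.reg 5)))) (.reg 6))
        (ind (Clash S p q)) :=
      .and hW1 (.not hW1 (.eq hW1 (.litVar hW1 hS₁.reg_two h4') (.litVar hW1 hS₁.reg_two h5')))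
        (.reg (by omega) hv)
    refine Runs.put (by simp [Exp.cost, Exp.and, Exp.not, Exp.litVar]) hi.1 he.1
      ⟨⟨hf.1, fun b hb => ?_⟩, ?_, fun x hx => ?_⟩
    · rw [← hf.2 b (by omega)]
      funext y
      rw [State.arr_setArr, if_neg (by omega)]
    · rw [State.arr_setArr, hi.2, he.2, if_pos ⟨rfl, rfl⟩]
    · rw [State.arr_setArr, hi.2, if_neg (fun h => hx h.2), hf.2 2 (by omega)]

/-- One pass over the rows for each of the `4 * D ^ 2` pairs. Afterwards a clash is a single
look-up, so propagation no longer depends on the number of rows. -/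
theorem runs_buildClash {S : PMat n D} {s : State} (hW : (2 * D + 2) * (2 * D + 2) ≤ W)
    (hn : n + 1 ≤ W) (hS : Env M S s) :
    Runs W M buildClash s (2 * D * (2 * D * (n * 60 + 65) + 8) + 3) fun s' => Frame 4 2 s s' ∧
      ∀ p < 2 * D, ∀ q < 2 * D, s'.arr 2 (p * (2 * D) + q) = ind (Clash S p q) := by
  have hWD : 3 * D + 1 ≤ W := by nlinarith
  refine Runs.forUpto (t := 2 * D * (n * 60 + 65) + 3) (fun i s' => Frame 4 2 s s' ∧
    ∀ p < i, ∀ q < 2 * D, s'.arr 2 (p * (2 * D) + q) = ind (Clash S p q)) (m := 2 * D)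
    (by omega) (by omega) (by omega) ?_ ⟨?_, ?_⟩ ?_ fun s' h _ => h
  · intro i s' h
    rw [h.1.1 3 (by omega), hS.reg_three]
  · exact (Frame.refl _ _ _).setReg le_rfl
  · exact fun _ h => absurd h (Nat.not_lt_zero _)
  rintro p hp s₁ ⟨hf₁, hall⟩ hp₁
  have hS₁ := hS.frame hf₁ (by omega) (by omega)
  refine Runs.forUpto (t := n * 60 + 60) (fun i s' => Frame 5 2 s₁ s' ∧
    (∀ p' < p, ∀ q < 2 * D, s'.arr 2 (p' * (2 * D) + q) = ind (Clash S p' q)) ∧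
    ∀ q < i, s'.arr 2 (p * (2 * D) + q) = ind (Clash S p q)) (m := 2 * D)
    (by omega) (by omega) (by omega) ?_ ⟨?_, hall, ?_⟩ ?_ ?_
  · intro i s' h
    rw [h.1.1 3 (by omega), hS₁.reg_three]
  · exact (Frame.refl _ _ _).setReg le_rfl
  · exact fun _ h => absurd h (Nat.not_lt_zero _)
  · rintro q hq s₂ ⟨hf₂, hpre, hcur⟩ hq₂
    have hS₂ := hS₁.frame hf₂ (by omega) (by omega)
    refine (runs_storeClash hW hn hS₂ hp hq (by rw [hf₂.1 4 (by omega), hp₁]) hq₂).mono le_rfl ?_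
    rintro s₃ ⟨hf₃, hnew, hold⟩
    refine ⟨by rw [hf₃.1 5 (by omega), hq₂], (hf₂.trans hf₃ (by omega) le_rfl).setReg le_rfl,
      fun p' hp' q' hq' => ?_, fun q' hq' => ?_⟩
    · rw [State.arr_setReg, hold _ fun h => ?_]
      · exact hpre p' hp' q' hq'
      · have := (index_inj hq' hq h).1
        omega
    · rcases Nat.lt_succ_iff_lt_or_eq.1 hq' with hq' | rfl
      · rw [State.arr_setReg, hold _ fun h => ?_]
        · exact hcur q' hq'
        · omega
      · exact hnew
  · rintro s' ⟨hf', hpre, hcur⟩ -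
    refine ⟨by rw [hf'.1 4 (by omega), hp₁], (hf₁.trans hf' (by omega) le_rfl).setReg le_rfl,
      fun p' hp' q hq => ?_⟩
    rcases Nat.lt_succ_iff_lt_or_eq.1 hp' with hp' | rfl
    · exact hpre p' hp' q hq
    · exact hcur q hq

/-- The registers and arrays that the search uses. -/
structure SearchEnv (M : ℕ → ℕ → ℕ) (S : PMat n D) (s : State) : Prop extends Env M S s where
  clash : ∀ p < 2 * D, ∀ q < 2 * D, s.arr 2 (p * (2 * D) + q) = ind (Clash S p q)

theorem SearchEnv.frame {S : PMat n D} {s s' : State} {k a : ℕ} (h : SearchEnv M S s)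
    (hf : Frame k a s s') (hk : 4 ≤ k) (ha : 3 ≤ a) : SearchEnv M S s' where
  toEnv := h.toEnv.frame hf hk (by omega)
  clash := by
    rw [hf.2 2 (by omega)]
    exact h.clash

/-- Masks the columns given by an expression in the counter `k`. -/
theorem runs_fillMask {S : PMat n D} {s : State} {mask : ℕ → Prop} {k : ℕ} {e : Exp}
    (hk : k < 64) (hk4 : 4 ≤ k) (hD : D + 1 ≤ W) (hS : SearchEnv M S s)
    (he : ∀ i < D, ∀ s', Frame k 3 s s' → s'.reg k = i → Ev W M s' e (ind (mask i))) :
    Runs W M (fill k 2 3 e) s (D * (e.cost + 7) + 3) fun s' =>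
      Frame k 3 s s' ∧ Tables D (Clash S) mask s' := by
  refine (runs_fill (m := D) (v := fun i => ind (mask i)) hk (by omega) hD hS.reg_two
    fun i hi s' hr ha _ hx => he i hi s' ⟨hr, fun b hb => ha b (by omega)⟩ hx).mono le_rfl ?_
  rintro s' ⟨hr, ha, hv⟩
  have hf : Frame k 3 s s' := ⟨hr, fun b hb => ha b (by omega)⟩
  have hS' := hS.frame hf hk4 le_rfl
  exact ⟨hf, hS'.reg_two, hS'.reg_three, hS'.clash, hv⟩

/-- Whether some column can be deleted so that the other columns have a model. -/
def firstFamily : Prog :=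
  existsLoop 4 2 (.seq (fill 6 2 3 (.eq (.reg 6) (.reg 4))) (satisfiable 6))

theorem computes_firstFamily {S : PMat n D} {s : State} (hW : (2 * D + 2) * (2 * D + 2) ≤ W)
    (hD : 1 ≤ D) (hS : SearchEnv M S s) :
    Computes W M 4 3 firstFamily s (1100 * D ^ 4) (ind (∃ j < D, Sat D (Clash S) (· = j))) := by
  have hW1 : 1 ≤ W := by nlinarith
  have hWD : 3 * D + 1 ≤ W := by nlinarith
  have hcost : D * (D * 11 + 3 + 1000 * D ^ 3 + 12) + 7 ≤ 1100 * D ^ 4 := by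
    have h1 : D ≤ D ^ 4 := Nat.le_self_pow (by norm_num) D
    have h2 : D ^ 2 ≤ D ^ 4 := Nat.pow_le_pow_right hD (by norm_num)
    have h3 : D * (D * 11 + 3 + 1000 * D ^ 3 + 12) = 11 * D ^ 2 + 15 * D + 1000 * D ^ 4 := by ring
    omega
  refine Runs.mono (computes_existsLoop (by omega) (by omega) (by omega) hS.reg_two ?_) hcost
    fun _ h => h
  intro j hj s₁ hf₁ hx₁
  refine (runs_fillMask (mask := (· = j)) (by omega) (by omega) (by omega)
    (hS.frame hf₁ le_rfl le_rfl) ?_).andThen le_rfl ?_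
  · intro i hi s' hf hx
    exact .eq hW1 (.reg (by omega) hx) (.reg (by omega) (by rw [hf.1 4 (by omega), hx₁]))
  · rintro s₂ ⟨hf₂, hT⟩
    refine (computes_satisfiable (fun _ _ => Clash.symm) (by omega) (by omega) hW hD hT).mono
      le_rfl ?_
    rintro s₃ ⟨hf₃, hv⟩
    exact ⟨hf₂.trans hf₃ le_rfl (by omega), hv⟩

/-- The mask of the columns of the literals in registers `4` and `6` and those on which both force
the same literal. -/
def pairMaskExp : Exp :=
  .or (.eq (.reg 8) (.litVar (.reg 4))) (.or (.eq (.reg 8) (.litVar (.reg 6)))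
    (.or (.and (.clash (.reg 4) (.reg 8)) (.clash (.reg 6) (.reg 8)))
      (.and (.clash (.reg 4) (.add (.reg 8) (.reg 2)))
        (.clash (.reg 6) (.add (.reg 8) (.reg 2))))))

def tripleMaskExp : Exp :=
  .or (.eq (.reg 10) (.litVar (.reg 4))) (.or (.eq (.reg 10) (.litVar (.reg 6)))
    (.eq (.reg 10) (.litVar (.reg 8))))

def tripleSeedsExp : Exp :=
  .and (.not (.load 3 (.litVar (.reg 10)))) (.or (.clash (.reg 4) (.litNeg (.reg 10)))
    (.or (.clash (.reg 6) (.litNeg (.reg 10))) (.clash (.reg 8) (.litNeg (.reg 10)))))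

/-- Tries the literals in registers `4`, `6` and `8`. -/
def tryTriple : Prog :=
  cond (.and (.clash (.reg 4) (.reg 8)) (.clash (.reg 6) (.reg 8)))
    (.seq (fill 10 2 3 tripleMaskExp) (.seq (propagateFrom 10 tripleSeedsExp)
      (cond (.reg 10)
        (.seq (existsLoop 10 0 (assign 12 (.and (.hit (.reg 10) (.reg 4))
          (.and (.hit (.reg 10) (.reg 6)) (.hit (.reg 10) (.reg 8))))))
          (assign 10 (.not (.reg 10))))
        skip)))
    (assign 10 (.const 0))

/-- Tries the literals in registers `4` and `6`. -/
def tryPair : Prog :=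
  cond (.eq (.litVar (.reg 4)) (.litVar (.reg 6))) (assign 8 (.const 0))
    (.seq (fill 8 2 3 pairMaskExp) (.seq (satisfiable 8)
      (cond (.reg 8) (existsLoop 8 3 tryTriple) skip)))

def secondFamily : Prog := existsLoop 4 3 (existsLoop 6 3 tryPair)

/-- One propagation and at most one pass over the rows; no satisfiability test is repeated here. -/
theorem computes_tryTriple {S : PMat n D} {s : State} (hW : (2 * D + 2) * (2 * D + 2) ≤ W)
    (hn : n + 1 ≤ W) (hD : 1 ≤ D) (hS : SearchEnv M S s) {p q r : ℕ} (hp : p < 2 * D)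
    (hq : q < 2 * D) (hr : r < 2 * D) (h4 : s.reg 4 = p) (h6 : s.reg 6 = q) (h8 : s.reg 8 = r) :
    Computes W M 10 3 tryTriple s (900 * D ^ 2 + n * 80) (ind (Clash S p r ∧ Clash S q r ∧
      Propagates D (Clash S) (tripleMask D p q r) (tripleSeeds D (Clash S) p q r) ∧
      ¬ ∃ i < n, Hit S i p ∧ Hit S i q ∧ Hit S i r)) := by
  have hW1 : 1 ≤ W := by nlinarith
  have hWD : 3 * D + 1 ≤ W := by nlinarith
  have hD2 : D ≤ D ^ 2 := Nat.le_self_pow (by norm_num) D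
  have hev4 : ∀ s', Frame 10 3 s s' → Ev W M s' (.reg 4) p := fun s' hf =>
    .reg (by omega) (by rw [hf.1 4 (by omega), h4])
  have hev6 : ∀ s', Frame 10 3 s s' → Ev W M s' (.reg 6) q := fun s' hf =>
    .reg (by omega) (by rw [hf.1 6 (by omega), h6])
  have hev8 : ∀ s', Frame 10 3 s s' → Ev W M s' (.reg 8) r := fun s' hf =>
    .reg (by omega) (by rw [hf.1 8 (by omega), h8])
  have hev := Ev.and hW1
    (ev_clash hW hS.reg_three hS.clash (hev4 s (.refl _ _ _)) (hev8 s (.refl _ _ _)) hp hr)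
    (ev_clash hW hS.reg_three hS.clash (hev6 s (.refl _ _ _)) (hev8 s (.refl _ _ _)) hq hr)
  refine Runs.cond (t := 880 * D ^ 2 + n * 80) (by
    simp only [Exp.cost, Exp.and, Exp.clash]; omega) hev.1 ?_ ?_
  swap
  · rw [hev.2, ind_eq_zero_iff]
    intro hc
    exact computes_assign (by simp only [Exp.cost]; omega) (Nat.zero_le _)
      (ind_of_not (by tauto)).symm
  rw [hev.2, ind_ne_zero_iff]
  rintro ⟨hpr, hqr⟩
  refine (runs_fillMask (mask := tripleMask D p q r) (by omega) (by omega) (by omega) hS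
    ?_).andThen (t₂ := 750 * D ^ 2 + n * 80) ?_ ?_
  · intro i hi s' hf hx
    have hr2 := (hS.frame hf (by omega) le_rfl).reg_two
    exact .or hW1 (.eq hW1 (.reg (by omega) hx) (.litVar hW1 hr2 (hev4 s' hf)))
      (.or hW1 (.eq hW1 (.reg (by omega) hx) (.litVar hW1 hr2 (hev6 s' hf)))
        (.eq hW1 (.reg (by omega) hx) (.litVar hW1 hr2 (hev8 s' hf))))
  · simp only [Exp.cost, tripleMaskExp, Exp.or, Exp.litVar]
    omega
  rintro s₁ ⟨hf₁, hT₁⟩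
  have hS₁ := hS.frame hf₁ (by omega) le_rfl
  have hprop : Computes W M 10 4 (propagateFrom 10 tripleSeedsExp) s₁ (640 * D ^ 2)
      (ind (Propagates D (Clash S) (tripleMask D p q r) (tripleSeeds D (Clash S) p q r))) := by
    refine (computes_propagateFrom (seeds := tripleSeeds D (Clash S) p q r) (by omega) (by omega)
      hW hD hT₁ ?_ ?_).mono (Nat.mul_le_mul_right _ ?_) fun _ h => h
    · intro i hi s' hf hx
      have hf' := hf₁.trans hf le_rfl (by omega)
      have hT' := hT₁.frame hf (by omega) le_rfl
      have hneg : Ev W M s' (.litNeg (.reg 10)) (litNeg D i) :=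
        .litNeg hW1 hT'.reg_two (.reg (by omega) hx) (by omega)
      refine .and hW1 (.not hW1 (.load (.litVar hW1 hT'.reg_two (.reg (by omega) hx))
        (hT'.mask _ (litVar_lt hi)))) (.or hW1 ?_ (.or hW1 ?_ ?_))
      · exact ev_clash hW hT'.reg_three hT'.clash (hev4 s' hf') hneg hp (litNeg_lt hi)
      · exact ev_clash hW hT'.reg_three hT'.clash (hev6 s' hf') hneg hq (litNeg_lt hi)
      · exact ev_clash hW hT'.reg_three hT'.clash (hev8 s' hf') hneg hr (litNeg_lt hi)
    · exact fun _ _ h => h.1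
    · simp [Exp.cost, tripleSeedsExp, Exp.or, Exp.and, Exp.not, Exp.clash, Exp.litVar, Exp.litNeg]
  refine hprop.andThen (t₂ := n * 80 + 30) (by omega) ?_
  rintro s₂ ⟨hf₂', hv₂⟩
  have hf₂ := hf₁.trans hf₂' le_rfl (by omega)
  have hS₂ := hS.frame hf₂ (by omega) le_rfl
  have hev₂ : Ev W M s₂ (.reg 10) _ := .reg (by omega) hv₂
  refine Runs.cond (t := n * 80 + 20) (by simp only [Exp.cost]; omega) hev₂.1 ?_ ?_
  · rw [hev₂.2, ind_ne_zero_iff]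
    intro hpg
    refine Runs.andThen (t₁ := n * (60 + 12) + 7) (t₂ := 4) (computes_existsLoop (a := 3)
      (φ := fun i => Hit S i p ∧ Hit S i q ∧ Hit S i r) (by omega) (by omega) hn hS₂.reg_zero ?_)
      (by omega) ?_
    · intro i hi s' hf hx
      have hf' := hf₂.trans hf le_rfl le_rfl
      have hS' := (hS.frame hf' (by omega) le_rfl).toEnv
      have hevi : Ev W M s' (.reg 10) i := .reg (by omega) hx
      have he := Ev.and hW1 (.hit hW1 hS' hevi (hev4 s' hf') hi hp)
        (.and hW1 (.hit hW1 hS' hevi (hev6 s' hf') hi hq) (.hit hW1 hS' hevi (hev8 s' hf') hi hr))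
      exact computes_assign (by simp [Exp.cost, Exp.and, Exp.hit, Exp.litVar]) he.1 he.2
    · rintro s₃ ⟨hf₃, hv₃⟩
      have hev₃ : Ev W M s₃ (.not (.reg 10)) _ := .not hW1 (.reg (by omega) hv₃)
      refine Runs.assign le_rfl hev₃.1 ⟨(hf₂.trans hf₃ le_rfl le_rfl).setReg le_rfl, ?_⟩
      rw [State.reg_setReg, if_pos rfl, hev₃.2]
      exact ind_congr ⟨fun h => ⟨hpr, hqr, hpg, h⟩, fun h => h.2.2.2⟩
  · rw [hev₂.2, ind_eq_zero_iff]
    intro hpg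
    refine (Runs.skip ⟨hf₂, ?_⟩).mono (by omega) fun _ h => h
    rw [hv₂, ind_of_not hpg, ind_of_not (by tauto)]

/-- The cubic satisfiability test is paid once per pair. Each of the `2 * D` choices of the third
literal costs only O(D^2 + n), so these choices add no more than O(D^3 + nD). -/
theorem computes_tryPair {S : PMat n D} {s : State} (hW : (2 * D + 2) * (2 * D + 2) ≤ W)
    (hn : n + 1 ≤ W) (hD : 1 ≤ D) (hS : SearchEnv M S s) {p q : ℕ} (hp : p < 2 * D)
    (hq : q < 2 * D) (h4 : s.reg 4 = p) (h6 : s.reg 6 = q) :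
    Computes W M 8 3 tryPair s (3000 * D ^ 3 + n * D * 160) (ind (litVar D p ≠ litVar D q ∧
      Sat D (Clash S) (pairMask D (Clash S) p q) ∧ ∃ r < 2 * D, Clash S p r ∧ Clash S q r ∧
      Propagates D (Clash S) (tripleMask D p q r) (tripleSeeds D (Clash S) p q r) ∧
      ¬ ∃ i < n, Hit S i p ∧ Hit S i q ∧ Hit S i r)) := by
  have hW1 : 1 ≤ W := by nlinarith
  have hWD : 3 * D + 1 ≤ W := by nlinarith
  have hD3 : D ≤ D ^ 3 := Nat.le_self_pow (by norm_num) D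
  have hev4 : ∀ s', Frame 8 3 s s' → Ev W M s' (.reg 4) p := fun s' hf =>
    .reg (by omega) (by rw [hf.1 4 (by omega), h4])
  have hev6 : ∀ s', Frame 8 3 s s' → Ev W M s' (.reg 6) q := fun s' hf =>
    .reg (by omega) (by rw [hf.1 6 (by omega), h6])
  have hev := Ev.eq hW1 (.litVar hW1 hS.reg_two (hev4 s (.refl _ _ _)))
    (.litVar hW1 hS.reg_two (hev6 s (.refl _ _ _)))
  refine Runs.cond (t := 2960 * D ^ 3 + n * D * 160) (by
    simp only [Exp.cost, Exp.litVar]; omega) hev.1 ?_ ?_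
  · rw [hev.2, ind_ne_zero_iff]
    intro hc
    exact computes_assign (by simp only [Exp.cost]; omega) (Nat.zero_le _)
      (ind_of_not (by tauto)).symm
  rw [hev.2, ind_eq_zero_iff]
  intro hpq
  refine (runs_fillMask (mask := pairMask D (Clash S) p q) (by omega) (by omega) (by omega) hS
    ?_).andThen (t₂ := 2860 * D ^ 3 + n * D * 160) ?_ ?_
  · intro i hi s' hf hx
    have hS' := hS.frame hf (by omega) le_rfl
    have hr2 := hS'.reg_two
    have hevi : Ev W M s' (.reg 8) i := .reg (by omega) hx
    have hevi' : Ev W M s' (.add (.reg 8) (.reg 2)) (i + D) :=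
      hevi.add (.reg (by omega) hr2) (by omega)
    refine .or hW1 (.eq hW1 hevi (.litVar hW1 hr2 (hev4 s' hf)))
      (.or hW1 (.eq hW1 hevi (.litVar hW1 hr2 (hev6 s' hf)))
        (.or hW1 (.and hW1 ?_ ?_) (.and hW1 ?_ ?_)))
    · exact ev_clash hW hS'.reg_three hS'.clash (hev4 s' hf) hevi hp (by omega)
    · exact ev_clash hW hS'.reg_three hS'.clash (hev6 s' hf) hevi hq (by omega)
    · exact ev_clash hW hS'.reg_three hS'.clash (hev4 s' hf) hevi' hp (by omega)
    · exact ev_clash hW hS'.reg_three hS'.clash (hev6 s' hf) hevi' hq (by omega)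
  · simp only [Exp.cost, pairMaskExp, Exp.or, Exp.and, Exp.clash, Exp.litVar]
    omega
  rintro s₁ ⟨hf₁, hT₁⟩
  refine (computes_satisfiable (fun _ _ => Clash.symm) (by omega) (by omega) hW hD hT₁).andThen
    (t₂ := 1860 * D ^ 3 + n * D * 160) (by omega) ?_
  rintro s₂ ⟨hf₂', hv₂⟩
  have hf₂ := hf₁.trans hf₂' le_rfl (by omega)
  have hS₂ := hS.frame hf₂ (by omega) le_rfl
  have hev₂ : Ev W M s₂ (.reg 8) _ := .reg (by omega) hv₂
  have hcost : 2 * D * (900 * D ^ 2 + n * 80 + 12) + 7 ≤ 1850 * D ^ 3 + n * D * 160 := by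
    have : 2 * D * (900 * D ^ 2 + n * 80 + 12) = 1800 * D ^ 3 + n * D * 160 + 24 * D := by ring
    omega
  refine Runs.cond (t := 1850 * D ^ 3 + n * D * 160) (by simp only [Exp.cost]; omega) hev₂.1 ?_ ?_
  · rw [hev₂.2, ind_ne_zero_iff]
    intro hsat
    refine Runs.mono (computes_existsLoop (a := 3) (m := 2 * D) (by omega) (by omega) (by omega)
      hS₂.reg_three fun r hr s' hf hx => computes_tryTriple hW hn hD
        (hS₂.frame hf (by omega) le_rfl) hp hq hr ?_ ?_ hx) hcost ?_
    · rw [hf.1 4 (by omega), hf₂.1 4 (by omega), h4]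
    · rw [hf.1 6 (by omega), hf₂.1 6 (by omega), h6]
    · rintro s' ⟨hf, hv⟩
      refine ⟨hf₂.trans hf le_rfl le_rfl, ?_⟩
      rw [hv]
      exact ind_congr ⟨fun h => ⟨hpq, hsat, h⟩, fun h => h.2.2⟩
  · rw [hev₂.2, ind_eq_zero_iff]
    intro hsat
    refine (Runs.skip ⟨hf₂, ?_⟩).mono (by omega) fun _ h => h
    rw [hv₂, ind_of_not hsat, ind_of_not fun h => hsat h.2.1]

/-- Decides the criterion for a matrix with dirty columns only. -/
def search : Prog :=
  .seq buildClash (.seq firstFamily (.seq (cond (.reg 4) skip secondFamily) (assign 0 (.reg 4))))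

theorem runs_search {S : PMat n D} {s : State} (hW : (2 * D + 2) * (2 * D + 2) ≤ W)
    (hn : n + 1 ≤ W) (hn1 : 1 ≤ n) (hD : 1 ≤ D) (hDn : D ≤ 3 * n) (hS : Env M S s) :
    Runs W M search s (42000 * (n * D ^ 4)) fun s' => s'.reg 0 = ind (Accepts S) := by
  have hW1 : 1 ≤ W := by nlinarith
  have hWD : 3 * D + 1 ≤ W := by nlinarith
  have hpow : ∀ i ≤ 4, D ^ i ≤ D ^ 4 := fun i hi => Nat.pow_le_pow_right hD hi
  have hnpow : ∀ i ≤ 4, n * D ^ i ≤ n * D ^ 4 := fun i hi => Nat.mul_le_mul_left _ (hpow i hi)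
  have hD4 : D ^ 4 ≤ n * D ^ 4 := Nat.le_mul_of_pos_left _ hn1
  -- The quadratically many pairs at cubic cost give `D ^ 5`. The bound on the number of columns
  -- turns one factor `D` into `3 * n`.
  have hD5 : D ^ 5 ≤ 3 * (n * D ^ 4) := by
    calc D ^ 5 = D * D ^ 4 := by ring
      _ ≤ 3 * n * D ^ 4 := Nat.mul_le_mul_right _ hDn
      _ = 3 * (n * D ^ 4) := by ring
  have hsecond : ∀ s', SearchEnv M S s' → Computes W M 4 3 secondFamily s' (38000 * (n * D ^ 4))
      (ind (∃ p < 2 * D, ∃ q < 2 * D, litVar D p ≠ litVar D q ∧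
        Sat D (Clash S) (pairMask D (Clash S) p q) ∧ ∃ r < 2 * D, Clash S p r ∧ Clash S q r ∧
        Propagates D (Clash S) (tripleMask D p q r) (tripleSeeds D (Clash S) p q r) ∧
        ¬ ∃ i < n, Hit S i p ∧ Hit S i q ∧ Hit S i r)) := by
    intro s' hS'
    refine Runs.mono (computes_existsLoop (a := 3) (m := 2 * D) (by omega) (by omega) (by omega)
      hS'.reg_three fun p hp s₁ hf₁ hx₁ => computes_existsLoop (a := 3) (m := 2 * D) (by omega)
        (by omega) (by omega) (hS'.frame hf₁ le_rfl le_rfl).reg_three fun q hq s₂ hf₂ hx₂ =>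
          computes_tryPair hW hn hD ((hS'.frame hf₁ le_rfl le_rfl).frame hf₂ (by omega) le_rfl)
            hp hq (by rw [hf₂.1 4 (by omega), hx₁]) hx₂) ?_ fun _ h => h
    have h1 := hpow 1 (by norm_num)
    have h2 := hpow 2 (by norm_num)
    have h3 := hnpow 3 (by norm_num)
    have h0 := hpow 0 (by norm_num)
    have : 2 * D * (2 * D * (3000 * D ^ 3 + n * D * 160 + 12) + 7 + 12) + 7 =
        12000 * D ^ 5 + 640 * (n * D ^ 3) + 48 * D ^ 2 + 38 * D ^ 1 + 7 * D ^ 0 := by ring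
    omega
  refine (runs_buildClash hW hn hS).andThen (t₂ := 40000 * (n * D ^ 4)) ?_ ?_
  · have h1 := hpow 1 (by norm_num)
    have h2 := hpow 2 (by norm_num)
    have h3 := hnpow 2 (by norm_num)
    have h0 := hpow 0 (by norm_num)
    have : 2 * D * (2 * D * (n * 60 + 65) + 8) + 3 =
        240 * (n * D ^ 2) + 260 * D ^ 2 + 16 * D ^ 1 + 3 * D ^ 0 := by ring
    omega
  rintro s₁ ⟨hf₁, hcl⟩
  have hS₁ : SearchEnv M S s₁ := ⟨hS.frame hf₁ le_rfl (by omega), hcl⟩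
  have h0 := hpow 0 (by norm_num)
  rw [pow_zero] at h0
  refine (computes_firstFamily hW hD hS₁).andThen (t₂ := 38100 * (n * D ^ 4)) (by omega) ?_
  rintro s₂ ⟨hf₂, hv₂⟩
  have hS₂ := hS₁.frame hf₂ le_rfl le_rfl
  have hev₂ : Ev W M s₂ (.reg 4) _ := .reg (by omega) hv₂
  refine Runs.andThen (t₁ := 38050 * (n * D ^ 4)) (t₂ := 2)
    (Q' := fun s' => s'.reg 4 = ind (Accepts S)) ?_ (by omega) ?_
  · refine Runs.cond (t := 38000 * (n * D ^ 4)) (by simp only [Exp.cost]; omega) hev₂.1 ?_ ?_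
    · rw [hev₂.2, ind_ne_zero_iff]
      intro h
      refine (Runs.skip ?_).mono (by omega) fun _ h => h
      rw [hv₂, ind_of h, ind_of (show Accepts S from Or.inl h)]
    · rw [hev₂.2, ind_eq_zero_iff]
      intro h
      refine (hsecond s₂ hS₂).mono le_rfl ?_
      rintro s₃ ⟨-, hv₃⟩
      rw [hv₃]
      exact ind_congr ⟨fun h' => Or.inr h', fun h' => h'.resolve_left h⟩
  · intro s₃ hv₃
    refine Runs.assign le_rfl (by change 4 < 64; omega) ?_
    simpa [Exp.eval] using hv₃

end Search

end DMC

namespace DMC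

/-! ### Collecting the dirty columns -/

section Preprocessing

variable {W : ℕ} {n l D : ℕ}

theorem inputOf_le (S : PMat n l) (i j : ℕ) : inputOf S i j ≤ 2 := by
  unfold inputOf
  split_ifs with h
  · rcases S ⟨i, h.1⟩ ⟨j, h.2⟩ with - | b
    · exact le_rfl
    · cases b <;> simp [entryCode]
  · exact le_rfl

theorem entryCode_injective : Function.Injective entryCode := by
  rintro (- | a) (- | b) h
  · rfl
  · cases b <;> simp [entryCode] at h
  · cases a <;> simp [entryCode] at h
  · cases a <;> cases b <;> simp [entryCode] at h ⊢

theorem inputOf_eq (S : PMat n l) {i j : ℕ} (hi : i < n) (hj : j < l) :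
    inputOf S i j = entryCode (S ⟨i, hi⟩ ⟨j, hj⟩) := dif_pos ⟨hi, hj⟩

theorem isDirty_iff (S : PMat n l) (j : Fin l) :
    IsDirty S j ↔ (∃ i < n, inputOf S i j = 0) ∧ ∃ i < n, inputOf S i j = 1 := by
  have h : ∀ b : Bool, (∃ i, S i j = some b) ↔ ∃ i < n, inputOf S i j = entryCode (some b) := by
    intro b
    constructor
    · rintro ⟨i, hi⟩
      exact ⟨i, i.2, by rw [inputOf_eq S i.2 j.2, ← hi]⟩
    · rintro ⟨i, hi, h⟩
      rw [inputOf_eq S hi j.2] at h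
      exact ⟨⟨i, hi⟩, entryCode_injective h⟩
  exact and_congr (h false) (h true)

/-- Appends the column in register `4` to the list of dirty columns, if it is dirty. -/
def collectColumn : Prog :=
  .seq (existsLoop 5 0 (assign 7 (.eq (.read (.reg 5) (.reg 4)) (.const 0)))) (.seq
    (existsLoop 6 0 (assign 8 (.eq (.read (.reg 6) (.reg 4)) (.const 1))))
    (cond (.and (.reg 5) (.reg 6))
      (.seq (put 0 (.reg 2) (.reg 4)) (assign 2 (.add (.reg 2) (.const 1)))) skip))

/-- Lists the dirty columns in array `0` and their number in register `2`. -/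
def collectDirty : Prog := forUpto 4 1 collectColumn

/-- Register `2` holds the number of dirty columns of `S` below `m`, and array `0` lists them. -/
structure Collected (S : PMat n l) (m : ℕ) (s : State) : Prop where
  reg_zero : s.reg 0 = n
  reg_one : s.reg 1 = l
  arr_one : s.arr 1 = fun _ => 0
  le : s.reg 2 ≤ m
  lt : ∀ t < s.reg 2, s.arr 0 t < m
  dirty : ∀ t < s.reg 2, ∀ h : s.arr 0 t < l, IsDirty S ⟨s.arr 0 t, h⟩
  inj : ∀ t < s.reg 2, ∀ t' < s.reg 2, s.arr 0 t = s.arr 0 t' → t = t'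
  surj : ∀ j : Fin l, j < m → IsDirty S j → ∃ t < s.reg 2, s.arr 0 t = j

theorem Collected.frame {S : PMat n l} {m : ℕ} {s s' : State} {k a : ℕ} (h : Collected S m s)
    (hf : Frame k a s s') (hk : 3 ≤ k) (ha : 2 ≤ a) : Collected S m s' := by
  obtain ⟨h1, h2, h3, h4, h5, h6, h7, h8⟩ := h
  have e2 := hf.1 2 (by omega)
  have e0 := hf.2 0 (by omega)
  rw [← e2] at h4
  rw [← e2, ← e0] at h5 h6 h7
  simp only [← e2, ← e0] at h8
  exact ⟨by rw [hf.1 0 (by omega), h1], by rw [hf.1 1 (by omega), h2],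
    by rw [hf.2 1 (by omega), h3], h4, h5, h6, h7, h8⟩

/-- All columns listed so far are below `m`, so appending `m` keeps the list free of repetitions. -/
theorem runs_collectColumn {S : PMat n l} {s : State} (hn : n + 1 ≤ W) (hl : l + 1 ≤ W) {m : ℕ}
    (hm : m < l) (hS : Collected S m s) (h4 : s.reg 4 = m) :
    Runs W (inputOf S) collectColumn s (n * 40 + 40) fun s' =>
      s'.reg 4 = m ∧ Collected S (m + 1) s' := by
  have hW1 : 1 ≤ W := by omega
  refine Runs.andThen (t₁ := n * (7 + 12) + 7) (t₂ := n * 20 + 30) (computes_existsLoop (a := 6)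
    (φ := fun i => inputOf S i m = 0) (by omega) (by omega) hn hS.reg_zero ?_) (by omega) ?_
  · intro i hi s' hf hx
    have hev := Ev.eq hW1 (Ev.read (M := inputOf S) (.reg (x := 5) (by omega) hx)
      (.reg (x := 4) (v := m) (by omega) (by rw [hf.1 4 (by omega), h4])))
      (.const (Nat.zero_le _))
    exact computes_assign (by simp [Exp.cost]) hev.1 hev.2
  rintro s₁ ⟨hf₁, hv₁⟩
  have hS₁ := hS.frame hf₁ (by omega) (by omega)
  have h4₁ : s₁.reg 4 = m := by rw [hf₁.1 4 (by omega), h4]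
  refine Runs.andThen (t₁ := n * (7 + 12) + 7) (t₂ := 20) (computes_existsLoop (a := 6)
    (φ := fun i => inputOf S i m = 1) (by omega) (by omega) hn hS₁.reg_zero ?_) (by omega) ?_
  · intro i hi s' hf hx
    have hev := Ev.eq hW1 (Ev.read (M := inputOf S) (.reg (x := 6) (by omega) hx)
      (.reg (x := 4) (v := m) (by omega) (by rw [hf.1 4 (by omega), h4₁]))) (.const hW1)
    exact computes_assign (by simp [Exp.cost]) hev.1 hev.2
  rintro s₂ ⟨hf₂, hv₂⟩
  have hS₂ := hS₁.frame hf₂ (by omega) (by omega)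
  have h4₂ : s₂.reg 4 = m := by rw [hf₂.1 4 (by omega), h4₁]
  have h5₂ : s₂.reg 5 = ind (∃ i < n, inputOf S i m = 0) := by rw [hf₂.1 5 (by omega), hv₁]
  have hev : Ev W (inputOf S) s₂ (.and (.reg 5) (.reg 6))
      (ind ((∃ i < n, inputOf S i m = 0) ∧ ∃ i < n, inputOf S i m = 1)) :=
    .and hW1 (.reg (by omega) h5₂) (.reg (by omega) hv₂)
  have hdirty := isDirty_iff S ⟨m, hm⟩
  refine Runs.cond (t := 10) (by simp [Exp.cost, Exp.and]) hev.1 ?_ ?_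
  · rw [hev.2, ind_ne_zero_iff]
    intro hd
    have hle := hS₂.le
    refine Runs.andThen (t₁ := 3) (t₂ := 4) (Runs.put (Q := fun s' =>
      s' = s₂.setArr 0 (s₂.reg 2) m) (by simp [Exp.cost]) (by change 2 < 64; omega)
        (by change 4 < 64; omega) ?_) (by omega) ?_
    · simp [Exp.eval, h4₂]
    · rintro _ rfl
      have hadd : Ev W (inputOf S) (s₂.setArr 0 (s₂.reg 2) m) (.add (.reg 2) (.const 1))
          (s₂.reg 2 + 1) := .add (.reg (by omega) (by simp)) (.const hW1) (by omega)
      refine Runs.assign le_rfl hadd.1 ?_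
      rw [hadd.2]
      refine ⟨by simp [h4₂], by simp [hS₂.reg_zero], by simp [hS₂.reg_one], ?_, ?_, ?_, ?_, ?_, ?_⟩
      · rw [← hS₂.arr_one]
        funext y
        simp
      · simp [hle]
      · intro t ht
        simp only [State.reg_setReg, if_true, State.arr_setReg, State.arr_setArr, true_and] at ht ⊢
        split_ifs with h
        · omega
        · have := hS₂.lt t (by omega)
          omega
      · intro t ht
        simp only [State.reg_setReg, if_true, State.arr_setReg, State.arr_setArr, true_and] at ht ⊢
        split_ifs with h
        · exact fun _ => hdirty.2 hd
        · exact hS₂.dirty t (by omega)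
      · intro t ht t' ht'
        simp only [State.reg_setReg, if_true, State.arr_setReg, State.arr_setArr, true_and]
          at ht ht' ⊢
        split_ifs with h h' h'
        · omega
        · have := hS₂.lt t' (by omega)
          omega
        · have := hS₂.lt t (by omega)
          omega
        · exact hS₂.inj t (by omega) t' (by omega)
      · intro j hj hjd
        simp only [State.reg_setReg, if_true, State.arr_setReg, State.arr_setArr, true_and]
        rcases Nat.lt_succ_iff_lt_or_eq.1 hj with hj | hj
        · obtain ⟨t, ht, htj⟩ := hS₂.surj j hj hjd
          exact ⟨t, by omega, by rw [if_neg (by omega), htj]⟩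
        · exact ⟨s₂.reg 2, by omega, by rw [if_pos rfl, hj]⟩
  · rw [hev.2, ind_eq_zero_iff]
    intro hd
    have hle := hS₂.le
    refine (Runs.skip ⟨h4₂, hS₂.reg_zero, hS₂.reg_one, hS₂.arr_one, by omega,
      fun t ht => (hS₂.lt t ht).trans (Nat.lt_succ_self m), hS₂.dirty, hS₂.inj,
      fun j hj hjd => ?_⟩).mono (by omega) fun _ h => h
    rcases Nat.lt_succ_iff_lt_or_eq.1 hj with hj | hj
    · exact hS₂.surj j hj hjd
    · obtain rfl : j = ⟨m, hm⟩ := Fin.ext hj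
      exact absurd (hdirty.1 hjd) hd

theorem runs_collectDirty (S : PMat n l) (hn : n + 1 ≤ W) (hl : l + 1 ≤ W) :
    Runs W (inputOf S) collectDirty (initState n l) (l * (n * 40 + 45) + 3)
      (Collected S l) := by
  refine Runs.forUpto (Collected S) (by omega) (by omega) hl (fun i s' h => h.reg_one) ?_ ?_
    fun s' h _ => h
  · refine ⟨rfl, rfl, rfl, le_rfl, ?_, ?_, ?_, ?_⟩
    · exact fun t ht => absurd ht (Nat.not_lt_zero t)
    · exact fun t ht => absurd ht (Nat.not_lt_zero t)
    · exact fun t ht => absurd ht (Nat.not_lt_zero t)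
    · exact fun j hj => absurd hj (Nat.not_lt_zero _)
  · intro i hi s' hS hx
    refine (runs_collectColumn hn hl hi hS hx).mono le_rfl ?_
    rintro s'' ⟨hx', hS'⟩
    exact ⟨hx', hS'.frame (k := 4) (a := 2) ((Frame.refl _ _ _).setReg le_rfl) (by omega) le_rfl⟩

theorem Collected.exists_columns {S : PMat n l} {s : State} (h : Collected S l s) :
    ∃ c : Fin (s.reg 2) → Fin l, Function.Injective c ∧ (∀ j, IsDirty S j → ∃ k, c k = j) ∧
      (∀ k, IsDirty S (c k)) ∧ ∀ k : Fin (s.reg 2), s.arr 0 k = c k := by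
  refine ⟨fun k => ⟨s.arr 0 k, h.lt k k.2⟩, fun k k' hk => ?_, fun j hj => ?_,
    fun k => h.dirty k k.2 _, fun _ => rfl⟩
  · exact Fin.ext (h.inj k k.2 k' k'.2 (Fin.mk.inj hk))
  · obtain ⟨t, ht, htj⟩ := h.surj j j.2 hj
    exact ⟨⟨t, ht⟩, Fin.ext htj⟩

end Preprocessing

/-! ### Tabulated answers for few dirty columns -/

section FewColumns

/-- A number that encodes the digits `f 0, …, f (k - 1)` and their number `k`. -/
def digitCode (f : ℕ → ℕ) : ℕ → ℕ
  | 0 => 1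
  | k + 1 => 3 * digitCode f k + f k

theorem digitCode_pos (f : ℕ → ℕ) (k : ℕ) : 1 ≤ digitCode f k := by
  induction k with
  | zero => exact le_rfl
  | succ k ih =>
    rw [digitCode]
    omega

theorem digitCode_lt {f : ℕ → ℕ} (hf : ∀ j, f j ≤ 2) (k : ℕ) :
    digitCode f k + 1 ≤ 2 * 3 ^ k := by
  induction k with
  | zero => simp [digitCode]
  | succ k ih =>
    have := hf k
    rw [digitCode, pow_succ]
    omega

/-- The leading digit `1` records the length: the empty word has code `1` and every longer one a
code of at least `3`. The other digits are recovered one by one modulo `3`. -/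
theorem digitCode_inj {f g : ℕ → ℕ} (hf : ∀ j, f j ≤ 2) (hg : ∀ j, g j ≤ 2) {k k' : ℕ}
    (h : digitCode f k = digitCode g k') : k = k' ∧ ∀ j < k, f j = g j := by
  induction k generalizing k' with
  | zero =>
    cases k' with
    | zero => exact ⟨rfl, fun j hj => absurd hj (Nat.not_lt_zero j)⟩
    | succ k' =>
      have := digitCode_pos g k'
      rw [digitCode, digitCode] at h
      omega
  | succ k ih =>
    cases k' with
    | zero =>
      have := digitCode_pos f k
      rw [digitCode, digitCode] at h
      omega
    | succ k' =>
      have h1 := hf k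
      have h2 := hg k'
      rw [digitCode, digitCode] at h
      obtain ⟨rfl, hj⟩ := ih (k' := k') (by omega)
      refine ⟨rfl, fun j hj' => ?_⟩
      rcases Nat.lt_succ_iff_lt_or_eq.1 hj' with hj' | rfl
      · exact hj j hj'
      · omega

variable {n D : ℕ}

/-- The codes of the rows of a matrix. -/
def rowCodes (S : PMat n D) : Finset ℕ :=
  (Finset.range n).image fun i => digitCode (inputOf S i) D

theorem mem_rowCodes {S : PMat n D} {c : ℕ} :
    c ∈ rowCodes S ↔ ∃ i < n, digitCode (inputOf S i) D = c := by
  simp [rowCodes]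

/-- Whether some yes-instance has the row codes `F`. -/
def CodesYes (F : Finset ℕ) : Prop :=
  ∃ (n D : ℕ) (S : PMat n D), 0 < n ∧ rowCodes S = F ∧ IsYes 0 3 S

/-- Copies of a row are completed in the same way and have distance zero. So repeating, omitting or
permuting rows preserves yes-instances. -/
theorem IsYes.of_rows {n' : ℕ} {S : PMat n D} {S' : PMat n' D} (h : IsYes 0 3 S)
    (hS : ∀ i', ∃ i, S i = S' i') : IsYes 0 3 S' := by
  obtain ⟨T, hST, hT⟩ := isYes_zero_three_iff.1 h
  choose f hf using hS
  refine isYes_zero_three_iff.2 ⟨fun i' => T (f i'), fun i' j => ?_, fun i i' => hT _ _⟩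
  rw [← hf]
  exact hST _ j

/-- As there is a row, the codes determine the number of columns and the set of rows, and by
`IsYes.of_rows` the answer depends on nothing else. -/
theorem codesYes_rowCodes_iff {S : PMat n D} (hn : 0 < n) :
    CodesYes (rowCodes S) ↔ IsYes 0 3 S := by
  constructor
  · rintro ⟨n', D', S', hn', hc, hy⟩
    have hrow : ∀ i : Fin n, D = D' ∧ ∃ i' : Fin n', ∀ j < D, inputOf S i j = inputOf S' i' j := by
      intro i
      have hi : digitCode (inputOf S i) D ∈ rowCodes S := mem_rowCodes.2 ⟨i, i.2, rfl⟩
      rw [← hc, mem_rowCodes] at hi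
      obtain ⟨i', hi', h⟩ := hi
      obtain ⟨h1, h2⟩ := digitCode_inj (inputOf_le S i) (inputOf_le S' i') h.symm
      exact ⟨h1, ⟨i', hi'⟩, h2⟩
    obtain ⟨rfl, -⟩ := hrow ⟨0, hn⟩
    refine hy.of_rows fun i => ?_
    obtain ⟨-, i', h⟩ := hrow i
    refine ⟨i', funext fun j => entryCode_injective ?_⟩
    have := h j j.2
    rw [inputOf_eq S i.2 j.2, inputOf_eq S' i'.2 j.2] at this
    exact this.symm
  · exact fun h => ⟨n, D, S, hn, rfl, h⟩

/-- Marks the codes of the rows of the matrix of the dirty columns in array `1`. -/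
def markRows : Prog :=
  forUpto 4 0 (.seq (assign 5 (.const 1)) (.seq
    (forUpto 6 2 (assign 5 (.add (.mul (.const 3) (.reg 5))
      (.read (.reg 4) (.load 0 (.reg 6))))))
    (put 1 (.reg 5) (.const 1))))

/-- Looks up the marks of the codes below the first argument, and answers according to the set of
marked codes. -/
noncomputable def decisionTree : ℕ → Finset ℕ → Prog
  | 0, F => assign 0 (.const (ind (CodesYes F)))
  | c + 1, F => cond (.load 1 (.const c)) (decisionTree c (insert c F)) (decisionTree c F)

variable {W : ℕ} {M : ℕ → ℕ → ℕ}

theorem runs_markRows {S : PMat n D} {s : State} (hn : n + 1 ≤ W) (hW : 2 * 3 ^ D + D + 1 ≤ W)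
    (h0 : s.reg 0 = n) (h2 : s.reg 2 = D) (h1 : s.arr 1 = fun _ => 0)
    (hM : ∀ i < n, ∀ j < D, M i (s.arr 0 j) = inputOf S i j) :
    Runs W M markRows s (n * (D * 15 + 20) + 3) fun s' =>
      ∀ c, s'.arr 1 c = ind (c ∈ rowCodes S) := by
  have hW1 : 2 ≤ W := by
    have := Nat.one_le_pow D 3 (by norm_num)
    omega
  refine Runs.mono (Runs.forUpto (t := D * (9 + 5) + 10) (fun i s' => Frame 4 1 s s' ∧
    ∀ c, s'.arr 1 c = ind (∃ i' < i, digitCode (inputOf S i') D = c)) (m := n) (by omega)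
    (by omega) hn ?_ ⟨?_, ?_⟩ ?_ (Q := fun s' => ∀ c, s'.arr 1 c = ind (c ∈ rowCodes S)) ?_)
    ?_ fun _ h => h
  · intro i s' h
    rw [h.1.1 0 (by omega), h0]
  · exact (Frame.refl _ _ _).setReg le_rfl
  · intro c
    rw [State.arr_setReg, h1, ind_of_not (by simp)]
  · rintro i hi s₁ ⟨hf₁, hc₁⟩ hx₁
    refine Runs.andThen (t₁ := 2) (t₂ := D * (9 + 5) + 3 + 3)
      (Q' := fun s' => s' = s₁.setReg 5 1) (Runs.assign le_rfl (by change 1 ≤ W; omega) rfl)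
      (by omega) ?_
    rintro _ rfl
    refine Runs.andThen (t₂ := 3) (Q' := fun s' => Frame 5 2 s₁ s' ∧
      s'.reg 5 = digitCode (inputOf S i) D) (Runs.forUpto (t := 9) (fun j s' => Frame 5 2 s₁ s' ∧
      s'.reg 5 = digitCode (inputOf S i) j) (m := D) (by omega) (by omega) (by omega)
      ?_ ⟨?_, ?_⟩ ?_ fun s' h _ => h) le_rfl ?_
    · intro j s' h
      rw [h.1.1 2 (by omega), hf₁.1 2 (by omega), h2]
    · exact ((Frame.refl _ _ _).setReg le_rfl).setReg (by omega)
    · simp [digitCode]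
    · rintro j hj s₂ ⟨hf₂, h5⟩ hx₂
      have hread : Ev W M s₂ (.read (.reg 4) (.load 0 (.reg 6))) (inputOf S i j) := by
        have := Ev.read (W := W) (M := M) (s := s₂) (a := .reg 4) (b := .load 0 (.reg 6))
          (u := i) (v := s₂.arr 0 j) (.reg (by omega) (by rw [hf₂.1 4 (by omega), hx₁]))
          (.load (.reg (by omega) hx₂) rfl)
        rwa [hf₂.2 0 (by omega), hf₁.2 0 (by omega), hM i hi j hj] at this
      have hlt := digitCode_lt (inputOf_le S i) (j + 1)
      have hpow : 3 ^ (j + 1) ≤ 3 ^ D := Nat.pow_le_pow_right (by norm_num) hj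
      rw [digitCode] at hlt
      have hmul : Ev W M s₂ (.mul (.const 3) (.reg 5)) (3 * digitCode (inputOf S i) j) := by
        have := digitCode_pos (inputOf S i) j
        exact .mul (.const (by omega)) (.reg (by omega) h5) (by omega)
      have hev := hmul.add hread (by omega)
      refine Runs.assign (by simp [Exp.cost]) hev.1 ⟨by simp [hx₂],
        (hf₂.setReg le_rfl).setReg (by omega), ?_⟩
      rw [State.reg_setReg, if_neg (by omega), State.reg_setReg, if_pos rfl, hev.2, digitCode]
    · rintro s₂ ⟨hf₂, h5⟩
      refine Runs.put le_rfl (by change 5 < 64; omega) (by change 1 ≤ W; omega) ⟨?_, ?_, ?_⟩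
      · rw [State.reg_setArr, hf₂.1 4 (by omega), hx₁]
      · refine ⟨fun x hx => ?_, fun b hb => ?_⟩
        · rw [State.reg_setReg, if_neg (by omega), State.reg_setArr, hf₂.1 x (by omega),
            hf₁.1 x hx]
        · rw [← hf₁.2 b hb, ← hf₂.2 b (by omega)]
          funext y
          rw [State.arr_setReg, State.arr_setArr, if_neg (by omega)]
      · intro c
        simp only [State.arr_setReg, State.arr_setArr, true_and, Exp.eval, h5]
        split_ifs with h
        · rw [ind_of ⟨i, by omega, h.symm⟩]
        · rw [hf₂.2 1 (by omega), hc₁ c]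
          refine ind_congr ⟨fun ⟨i', hi', h'⟩ => ⟨i', by omega, h'⟩, fun ⟨i', hi', h'⟩ => ?_⟩
          rcases Nat.lt_succ_iff_lt_or_eq.1 hi' with hi' | rfl
          · exact ⟨i', hi', h'⟩
          · exact absurd h'.symm h
  · rintro s' ⟨-, hc⟩ - c
    rw [hc c]
    exact ind_congr mem_rowCodes.symm
  · have : n * (D * (9 + 5) + 10 + 5) ≤ n * (D * 15 + 20) := Nat.mul_le_mul_left _ (by omega)
    omega

/-- A tree of fixed depth is one fixed finite program with the answers built into its leaves. A run
performs one look-up per level, at four steps each. -/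
theorem runs_decisionTree {G : Finset ℕ} (hW1 : 1 ≤ W) (c : ℕ) (hc : c ≤ W) (F : Finset ℕ)
    {s : State} (hs : ∀ x, s.arr 1 x = ind (x ∈ G)) :
    Runs W M (decisionTree c F) s (c * 4 + 2) fun s' =>
      s'.reg 0 = ind (CodesYes (F ∪ (Finset.range c).filter (· ∈ G))) := by
  induction c generalizing F with
  | zero =>
    refine Runs.assign (by simp [Exp.cost]) ((ind_le_one _).trans hW1) ?_
    simp [Exp.eval]
  | succ c ih =>
    have hev : Ev W M s (.load 1 (.const c)) (ind (c ∈ G)) := .load (.const (by omega)) (hs c)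
    refine Runs.cond (t := c * 4 + 2) (by simp only [Exp.cost]; omega) hev.1 ?_ ?_
    · rw [hev.2, ind_ne_zero_iff]
      intro h
      refine (ih (by omega) (insert c F)).mono le_rfl fun s' hs' => ?_
      rw [hs', Finset.range_add_one, Finset.filter_insert, if_pos h, Finset.insert_union,
        Finset.union_insert]
    · rw [hev.2, ind_eq_zero_iff]
      intro h
      refine (ih (by omega) F).mono le_rfl fun s' hs' => ?_
      rw [hs', Finset.range_add_one, Finset.filter_insert, if_neg h]

theorem rowCodes_filter_range {S : PMat n D} {K : ℕ} (hK : 2 * 3 ^ D ≤ K) :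
    (Finset.range K).filter (· ∈ rowCodes S) = rowCodes S := by
  ext c
  rw [Finset.mem_filter, Finset.mem_range, and_iff_right_iff_imp, mem_rowCodes]
  rintro ⟨i, -, rfl⟩
  have := digitCode_lt (inputOf_le S i) D
  omega

end FewColumns

/-! ### The complete program and its running time -/

section Main

variable {n l : ℕ}

theorem isYes_of_mul_eq_zero (S : PMat n l) (h : n * l = 0) : IsYes 0 3 S := by
  refine isYes_zero_three_iff.2 ⟨fillWith S fun _ => false, isCompletion_fillWith _ _, ?_⟩
  intro i i'
  rcases Nat.mul_eq_zero.1 h with rfl | rfl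
  · exact i.elim0
  · simp [diffSet]

/-- The program that decides whether a matrix has a completion of diameter at most three. Below
`14` dirty columns, it looks up the answer for the set of rows, which has less than `K` possible
elements. -/
noncomputable def diameterThree (K : ℕ) : Prog :=
  cond (.mul (.reg 0) (.reg 1))
    (.seq collectDirty
      (cond (.lt (.reg 2) (.const 14))
        (.seq markRows (decisionTree K ∅))
        (cond (.lt (.mul (.const 3) (.reg 0)) (.reg 2)) (assign 0 (.const 0))
          (.seq (assign 3 (.add (.reg 2) (.reg 2))) search))))
    (assign 0 (.const 1))

theorem inputOf_comp {S : PMat n l} {D : ℕ} (c : Fin D → Fin l) {i j : ℕ} (hi : i < n)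
    (hj : j < D) : inputOf S i (c ⟨j, hj⟩) = inputOf (fun i k => S i (c k) : PMat n D) i j := by
  rw [inputOf_eq S hi (c ⟨j, hj⟩).2, inputOf_eq _ hi hj]

/-- Let D be the number of dirty columns of a nonempty matrix. The table answers if D < 14. The
input is rejected if D > 3n, as each row differs from the first in at most three columns. In the
remaining range both the criterion and the time bound of the search apply. -/
theorem runs_diameterThree {W K : ℕ} (S : PMat n l) (hn : n * 3 + 1 ≤ W) (hl : l + 1 ≤ W)
    (hnl : n * l ≤ W) (hW : (2 * l + 2) * (2 * l + 2) ≤ W) (hK : ∀ D < 14, 2 * 3 ^ D ≤ K)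
    (hKW : K + 14 ≤ W) :
    Runs W (inputOf S) (diameterThree K) (initState n l) ((43000 + K * 4) * (n * l ^ 4 + 1))
      fun s' => s'.reg 0 = ind (IsYes 0 3 S) := by
  have h0 : Ev W (inputOf S) (initState n l) (.mul (.reg 0) (.reg 1)) (n * l) :=
    .mul (.reg (by omega) rfl) (.reg (by omega) rfl) hnl
  have hexp : 43000 * (n * l ^ 4) + K * 4 + 43000 ≤ (43000 + K * 4) * (n * l ^ 4 + 1) := by
    nlinarith [Nat.zero_le (K * (n * l ^ 4))]
  refine Runs.mono ?_ hexp fun _ h => h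
  clear hexp
  refine Runs.cond (t := 42900 * (n * l ^ 4) + K * 4 + 42900) (by
    simp only [Exp.cost]; omega) h0.1 ?_ ?_
  swap
  · rw [h0.2]
    intro h
    refine Runs.assign (by simp only [Exp.cost]; omega) (by change 1 ≤ W; omega) ?_
    rw [ind_of (isYes_of_mul_eq_zero S h)]
    rfl
  rw [h0.2]
  intro hne
  have hn0 : 1 ≤ n := Nat.pos_of_ne_zero (left_ne_zero_of_mul hne)
  have hl0 : 1 ≤ l := Nat.pos_of_ne_zero (right_ne_zero_of_mul hne)
  have hl4 : l ≤ l ^ 4 := Nat.le_self_pow (by norm_num) l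
  have hnl4 : n * l ≤ n * l ^ 4 := Nat.mul_le_mul_left _ hl4
  have hn_le : n ≤ n * l := Nat.le_mul_of_pos_right _ hl0
  have hl_le : l ≤ n * l := Nat.le_mul_of_pos_left _ hn0
  refine (runs_collectDirty S (by omega) hl).andThen
    (t₂ := 42800 * (n * l ^ 4) + K * 4 + 42800) ?_ ?_
  · have : l * (n * 40 + 45) = 40 * (n * l) + 45 * l := by ring
    omega
  intro s₁ hS₁
  obtain ⟨c, hc, hcd, hdirty, hcol⟩ := hS₁.exists_columns
  have hyes := isYes_comp_iff hc hcd
  have hD := hS₁.le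
  generalize hDs : s₁.reg 2 = D at *
  set S' : PMat n D := fun i k => S i (c k) with hS'
  have hdirty' : ∀ k, IsDirty S' k := hdirty
  have hentry : ∀ i < n, ∀ j < D, inputOf S i (s₁.arr 0 j) = inputOf S' i j := by
    intro i hi j hj
    rw [hcol ⟨j, hj⟩, inputOf_comp c hi hj]
  have h1 : Ev W (inputOf S) s₁ (.lt (.reg 2) (.const 14)) (ind (D < 14)) :=
    .lt (by omega) (.reg (by omega) hDs) (.const (by omega))
  refine Runs.cond (t := 42700 * (n * l ^ 4) + K * 4 + 42700) (by
    simp only [Exp.cost]; omega) h1.1 ?_ ?_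
  · rw [h1.2, ind_ne_zero_iff]
    intro hD14
    have hKD := hK D hD14
    refine (runs_markRows (S := S') (by omega) (by omega) hS₁.reg_zero hDs hS₁.arr_one
      hentry).andThen (t₂ := K * 4 + 2) ?_ ?_
    · have : n * (D * 15 + 20) ≤ n * 230 := Nat.mul_le_mul_left _ (by omega)
      omega
    · intro s₂ hs₂
      refine (runs_decisionTree (by omega) K (by omega) ∅ hs₂).mono le_rfl fun s' hs' => ?_
      rw [hs', Finset.empty_union, rowCodes_filter_range hKD]
      exact ind_congr ((codesYes_rowCodes_iff hn0).trans hyes.symm)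
  · rw [h1.2, ind_eq_zero_iff]
    intro hD14
    have h2 : Ev W (inputOf S) s₁ (.lt (.mul (.const 3) (.reg 0)) (.reg 2)) (ind (3 * n < D)) :=
      .lt (by omega) (.mul (.const (by omega)) (.reg (by omega) hS₁.reg_zero) (by omega))
        (.reg (by omega) hDs)
    refine Runs.cond (t := 42500 * (n * l ^ 4) + 100) (by simp only [Exp.cost]; omega) h2.1 ?_ ?_
    · rw [h2.2, ind_ne_zero_iff]
      intro hDn
      refine Runs.assign (by simp only [Exp.cost]; omega) (Nat.zero_le _) ?_
      rw [ind_of_not fun h => ?_]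
      · rfl
      · have := le_three_mul_of_isYes hn0 hdirty' (hyes.1 h)
        omega
    · rw [h2.2, ind_eq_zero_iff]
      intro hDn
      have hWD : (2 * D + 2) * (2 * D + 2) ≤ W :=
        (Nat.mul_le_mul (by omega) (by omega)).trans hW
      have h3 : Ev W (inputOf S) s₁ (.add (.reg 2) (.reg 2)) (D + D) :=
        .add (.reg (by omega) hDs) (.reg (by omega) hDs) (by nlinarith)
      have hD4 : n * D ^ 4 ≤ n * l ^ 4 := Nat.mul_le_mul_left _ (Nat.pow_le_pow_left hD 4)
      refine Runs.andThen (t₁ := 4) (t₂ := 42000 * (n * D ^ 4))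
        (Q' := fun s' => s' = s₁.setReg 3 (D + D)) (Runs.assign le_rfl h3.1 (by rw [h3.2]))
        (by omega) ?_
      rintro _ rfl
      have henv : Env (inputOf S) S' (s₁.setReg 3 (D + D)) :=
        ⟨by simp [hS₁.reg_zero], by simp [hDs], by simp [two_mul], hentry⟩
      refine (runs_search hWD (by omega) hn0 (by omega) (by omega) henv).mono le_rfl
        fun s' hs' => ?_
      rw [hs']
      exact ind_congr ((isYes_iff_accepts (by omega) hdirty').symm.trans hyes.symm)

theorem decidesInTime_diameterThree {K k : ℕ} (hK : ∀ D < 14, 2 * 3 ^ D ≤ K) (hk : 4 ≤ k)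
    (hKk : K + 14 ≤ 2 ^ k) :
    DecidesInTime (diameterThree K) (fun _ _ S => IsYes 0 3 S)
      (fun n l => (43000 + K * 4) * (n * l ^ 4 + 1)) := by
  refine ⟨k, by omega, fun n l S => ?_⟩
  have hB : 2 ≤ n + l + 2 := by omega
  have hbig : K + 14 ≤ (n + l + 2) ^ k := hKk.trans (Nat.pow_le_pow_left hB k)
  -- A base of at least two makes its fourth power at least four times its square, which covers the
  -- table indices and the product `n * l`.
  have hsq : 4 * ((n + l + 2) * (n + l + 2)) ≤ (n + l + 2) ^ k := by
    refine le_trans ?_ (Nat.pow_le_pow_right (by omega) hk)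
    rw [show (n + l + 2) ^ 4 = (n + l + 2) ^ 2 * ((n + l + 2) * (n + l + 2)) by ring]
    exact Nat.mul_le_mul_right _ (Nat.pow_le_pow_left hB 2)
  generalize (n + l + 2) ^ k = W at *
  obtain ⟨s₁, s', t, h3, h4, h5, h6⟩ := runs_diameterThree S (by nlinarith) (by nlinarith)
    (by nlinarith) (by nlinarith) hK hbig (initState n l) (Sim.refl _)
  have h7 : s₁.reg 0 = ind (IsYes 0 3 S) := (h5.2 0 (by norm_num)).trans h6
  exact ⟨s₁, t, h3, h4, fun h => by rw [h7, ind_of h], fun h => by rw [h7, ind_of_not h]⟩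

end Main

end DMC

theorem mainTheorem2 :
    -- `(0, 3)`-DMC can be solved in `O(n l ^ 4)` time
    (∃ (p : DMC.Prog) (C : ℕ),
      DMC.DecidesInTime p (fun _ _ S => DMC.IsYes 0 3 S) (fun n l => C * (n * l ^ 4 + 1))) ∧
    -- the sunflower structure of diameter-three matrices
    (∀ (n l : ℕ) (T : DMC.CMat n l), 14 ≤ l → (∀ j, DMC.IsDirty T.toPMat j) →
      DMC.delta T = 3 →
        (∃ r : Fin n, 5 ≤ (DMC.diffSystem T r 3).card) ∧
        ∀ r : Fin n, 5 ≤ (DMC.diffSystem T r 3).card → DMC.HasSunflowerStructure T r) ∧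
    -- columns that are not dirty can be deleted
    (∀ (n l : ℕ) (S : DMC.PMat n l), DMC.IsYes 0 3 S ↔ DMC.IsYes 0 3 (DMC.dirtyPart S)) ∧
    -- the reduction to `O(l ^ 3)` instances of ConRMC with radius at most one
    (∀ (n l : ℕ) (S : DMC.PMat n l), 14 ≤ l → (∀ j, DMC.IsDirty S j) →
      (DMC.reductionInstances S).Finite ∧
      (DMC.reductionInstances S).ncard ≤ 9 * l ^ 3 ∧
      (∀ I ∈ DMC.reductionInstances S, ∀ i, I.radius i ≤ 1) ∧
      (DMC.IsYes 0 3 S ↔ ∃ I ∈ DMC.reductionInstances S, I.IsYes)) := by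
  -- Rows with at most 13 columns have codes below `2 * 3 ^ 13`. The exponent `24` below leaves room
  -- for this constant, since the base of the word bound is at least two.
  have hK : ∀ D < 14, 2 * 3 ^ D ≤ 2 * 3 ^ 13 := fun D hD =>
    Nat.mul_le_mul_left _ (Nat.pow_le_pow_right (by norm_num) (by omega))
  refine ⟨⟨_, _, DMC.decidesInTime_diameterThree (k := 24) hK (by norm_num) (by norm_num)⟩,
    fun n l T hl hd hT => ?_,
    fun n l S => DMC.isYes_dirtyPart_iff S, fun n l S hl hd =>
      ⟨DMC.finite_reductionInstances S, DMC.ncard_reductionInstances_le S,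
        fun I hI i => DMC.radius_le_one_of_mem hI i,
        (DMC.isYes_iff_exists_good hl hd).trans DMC.exists_reduction_iff.symm⟩⟩
  have hdiam : DMC.DiamLeThree T := DMC.delta_le_three_iff.1 hT.le
  -- The value three is attained: distances are integers, so otherwise all would be at most two, and
  -- so would their supremum.
  obtain ⟨i, r, hir⟩ : ∃ i r,
      (DMC.diffSet (DMC.toPartial (T i)) (DMC.toPartial (T r))).card = 3 := by
    by_contra! hne
    have h2 : DMC.delta T ≤ ((2 : ℕ) : ℕ∞) := by
      refine iSup_le fun i => iSup_le fun i' => iSup_le fun _ => ?_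
      have h1 := hdiam i i'
      have h2 := hne i i'
      rw [Nat.cast_le, DMC.hdist]
      omega
    rw [hT] at h2
    exact absurd (Nat.cast_le.1 h2 : 3 ≤ 2) (by norm_num)
  exact ⟨DMC.exists_five_le_card hl hd hdiam hir, fun r hr => DMC.hasSunflowerStructure hdiam hr⟩
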